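/- Let $2<m<\omega$ and let $n>m$ be an ordinal. $\mathsf{CA}_k$ denotes the class of cylindric algebras of dimension $k$; for $\mathfrak D\in\mathsf{CA}_n$, $\mathfrak{Nr}_m\mathfrak D\in\mathsf{CA}_m$ is its neat $m$-reduct, with universe $\{x\in D: \mathsf c_ix=x \text{ for all } m\le i<n\}$ and the operations of $\mathsf{CA}_m$ induced from $\mathfrak D$. For $\mathfrak A\in\mathsf{CA}_m$ we write $\mathfrak A\in \mathbf S\,\mathfrak{Nr}_m\mathsf{CA}_n$ if there are $\mathfrak D\in\mathsf{CA}_n$ and an injective homomorphism $g:\mathfrak A\to\mathfrak{Nr}_m\mathfrak D$, and $\mathfrak A\in \mathbf S_c\,\mathfrak{Nr}_m\mathsf{CA}_n$ if moreover $\mathfrak D,g$ can be chosen so that for every $X\subseteq A$ with $\sum^{\mathfrak A}X=1$ one has $\sum^{\mathfrak{Nr}_m\mathfrak D}g[X]=1$. For sequences, $t\equiv_i s$ means that $t_j=s_j$ for all $j\ne i$. A relativized representation of $\mathfrak A\in\mathsf{CA}_m$ is a non-empty set $M$ with a set $V\subseteq{}^mM$ such that $M=\bigcup_{s\in V}\operatorname{rng}(s)$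 and an injective homomorphism $f:\mathfrak A\to\wp(V)$, where $\wp(V)$ carries the Boolean set operations, $\mathsf c_iX=\{s\in V:\exists t\in X,\ t\equiv_i s\}$ and $\mathsf d_{ij}=\{s\in V:s_i=s_j\}$. It is complete if $f(\prod X)=\bigcap_{x\in X}f(x)$ (computed in $\wp(V)$) for all $X\subseteq A$ such that $\prod X$ exists in $\mathfrak A$. A clique is a set $C\subseteq M$ with ${}^mC\subseteq V$, and $C^n(M)$ is the set of all $\bar a\in{}^nM$ whose range is a clique. Let $L(A)^n$ be the set of first order formulas built by Boolean connectives and the quantifiers $\exists x_i$ $(i<n)$ from the atomic formulas $r(x_{l(0)},\dots,x_{l(m-1)})$, where $r\in A$ and $l:m\to n$. For $\bar a\in C^n(M)$, clique guarded satisfaction $M\models_C\phi[\bar a]$ is defined by: $M\models_C r(x_{l(0)},\dots,x_{l(m-1)})[\bar a]$ iff $(a_{l(0)},\dots,a_{l(m-1)})\in f(r)$; Boolean connectives as usual; $M\models_C\exists x_i\phi[\bar a]$ iff $M\models_C\phi[\bar b]$ for some $\bar b\in C^n(M)$ with $\bar b\equiv_i\bar a$. The relativized representation is $n$-square if for all $\bar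 s\in C^n(M)$, $a\in A$, $i<m$ and injective $l:m\to n$ with $(s_{l(0)},\dots,s_{l(m-1)})\in f(\mathsf c_ia)$ there is $\bar t\in C^n(M)$ with $\bar t\equiv_{l(i)}\bar s$ and $(t_{l(0)},\dots,t_{l(m-1)})\in f(a)$. It is $n$-flat if it is $n$-square and, for all $\phi\in L(A)^n$, $\bar a\in C^n(M)$ and $i,j<n$, $M\models_C(\exists x_i\exists x_j\phi\leftrightarrow\exists x_j\exists x_i\phi)[\bar a]$. Then: 1. If $\mathfrak A\in\mathsf{CA}_m$ has an $n$-flat relativized representation, then $\mathfrak A\in\mathbf S\,\mathfrak{Nr}_m\mathsf{CA}_n$. 2. If $\mathfrak A\in\mathsf{CA}_m$ has a complete $n$-flat relativized representation, then $\mathfrak A\in\mathbf S_c\,\mathfrak{Nr}_m\mathsf{CA}_n$. 3. If $n\ge m+3$, then the class of all $\mathfrak A\in\mathsf{CA}_m$ that have a complete $n$-flat relativized representation is not elementary, i.e. it is not the class of all $\mathsf{CA}_m$s satisfying some set of first order sentences in the language of $\mathsf{CA}_m$. -/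

import Mathlib

universe u v w

/-- Cylindric algebras whose dimension is the index type `ι`: a Boolean algebra with
cylindrifications `cyl i` and diagonal elements `diag i j`. -/
class CylindricAlgebra (ι : Type v) (A : Type u) [BooleanAlgebra A] where
  cyl : ι → A → A
  diag : ι → ι → A
  cyl_bot : ∀ i, cyl i ⊥ = ⊥
  le_cyl : ∀ i x, x ≤ cyl i x
  cyl_inf_cyl : ∀ i x y, cyl i (x ⊓ cyl i y) = cyl i x ⊓ cyl i y
  cyl_comm : ∀ i j x, cyl i (cyl j x) = cyl j (cyl i x)
  diag_self : ∀ i, diag i i = ⊤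
  diag_eq : ∀ i j k, k ≠ i → k ≠ j → diag i j = cyl k (diag i k ⊓ diag k j)
  cyl_diag : ∀ i j x, i ≠ j → cyl i (diag i j ⊓ x) ⊓ cyl i (diag i j ⊓ xᶜ) = ⊥

namespace CylindricAlgebra

section Basic

variable {ι : Type v} {A : Type u} [BooleanAlgebra A] [CylindricAlgebra ι A]

theorem cyl_cyl (i : ι) (x : A) : cyl i (cyl i x) = cyl i x := by
  have h := cyl_inf_cyl i (⊤ : A) x
  have ht : cyl i (⊤ : A) = ⊤ := top_le_iff.1 (le_cyl i ⊤)
  simpa [ht] using h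

theorem cyl_mono (i : ι) {x y : A} (h : x ≤ y) : cyl i x ≤ cyl i y := by
  have h1 : x ⊓ cyl i y = x := inf_eq_left.2 (h.trans (le_cyl i y))
  have h2 := cyl_inf_cyl i x y
  rw [h1] at h2
  exact inf_eq_left.1 h2.symm

theorem cyl_inf_of_fixed (i : ι) {x y : A} (hx : cyl i x = x) (hy : cyl i y = y) :
    cyl i (x ⊓ y) = x ⊓ y := by
  have h := cyl_inf_cyl i x y
  rwa [hy, hx] at h

theorem cyl_compl_of_fixed (i : ι) {x : A} (hx : cyl i x = x) : cyl i xᶜ = xᶜ := by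
  refine le_antisymm ?_ (le_cyl i _)
  have h := cyl_inf_cyl i xᶜ x
  rw [hx, compl_inf_eq_bot, cyl_bot] at h
  exact (disjoint_iff.2 h.symm).le_compl_right

theorem cyl_sup_of_fixed (i : ι) {x y : A} (hx : cyl i x = x) (hy : cyl i y = y) :
    cyl i (x ⊔ y) = x ⊔ y := by
  have h := cyl_compl_of_fixed i
    (cyl_inf_of_fixed i (cyl_compl_of_fixed i hx) (cyl_compl_of_fixed i hy))
  simpa [compl_inf] using h

theorem cyl_diag_of_ne (i j k : ι) (hi : k ≠ i) (hj : k ≠ j) :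
    cyl k (diag i j : A) = diag i j := by
  rw [diag_eq i j k hi hj, cyl_cyl]

end Basic

section NeatReduct

variable {κ : Type w} {ι : Type v} (e : κ ↪ ι) (A : Type u) [BooleanAlgebra A]
  [CylindricAlgebra ι A]

/-- The universe of the neat reduct of `A` to the dimensions in the range of `e`: the elements
fixed by all other cylindrifications. -/
def neatReduct : BooleanSubalgebra A where
  carrier := {x | ∀ i, i ∉ Set.range e → cyl i x = x}
  supClosed' := fun _ hx _ hy i hi => cyl_sup_of_fixed i (hx i hi) (hy i hi)
  infClosed' := fun _ hx _ hy i hi => cyl_inf_of_fixed i (hx i hi) (hy i hi)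
  compl_mem' := fun hx i hi => cyl_compl_of_fixed i (hx i hi)
  bot_mem' := fun i _ => cyl_bot i

/-- The neat reduct is an algebra of dimension `κ`, with the operations induced from `A`. -/
instance instNeatReduct : CylindricAlgebra κ (neatReduct e A) where
  cyl k x := ⟨cyl (e k) x.1, fun i hi => by rw [cyl_comm, x.2 i hi]⟩
  diag k l := ⟨diag (e k) (e l), fun i hi =>
    cyl_diag_of_ne _ _ _ (fun h => hi ⟨k, h.symm⟩) (fun h => hi ⟨l, h.symm⟩)⟩
  cyl_bot k := Subtype.ext (cyl_bot (e k))
  le_cyl k x := le_cyl (e k) x.1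
  cyl_inf_cyl k x y := Subtype.ext (cyl_inf_cyl (e k) x.1 y.1)
  cyl_comm k l x := Subtype.ext (cyl_comm (e k) (e l) x.1)
  diag_self k := Subtype.ext (diag_self (e k))
  diag_eq k l p hk hl := Subtype.ext
    (diag_eq (e k) (e l) (e p) (fun h => hk (e.injective h)) (fun h => hl (e.injective h)))
  cyl_diag k l x h := Subtype.ext (cyl_diag (e k) (e l) x.1 (fun h' => h (e.injective h')))

end NeatReduct

/-- Injective homomorphisms of cylindric algebras of the same dimension. -/
structure IsEmbedding (ι : Type v) {A : Type u} {B : Type w} [BooleanAlgebra A]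
    [CylindricAlgebra ι A] [BooleanAlgebra B] [CylindricAlgebra ι B] (g : A → B) : Prop where
  injective : Function.Injective g
  map_bot : g ⊥ = ⊥
  map_top : g ⊤ = ⊤
  map_sup : ∀ x y, g (x ⊔ y) = g x ⊔ g y
  map_inf : ∀ x y, g (x ⊓ y) = g x ⊓ g y
  map_compl : ∀ x, g xᶜ = (g x)ᶜ
  map_cyl : ∀ (i : ι) (x : A), g (cyl i x) = cyl i (g x)
  map_diag : ∀ i j : ι, g (diag i j) = diag i j

end CylindricAlgebra

open CylindricAlgebra

/-- The inclusion of the finite ordinal `m` into an ordinal `n ≥ m`. -/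
noncomputable def dimIncl (m : ℕ) (n : Ordinal.{u}) (h : (m : Ordinal.{u}) ≤ n) :
    Fin m ↪ n.ToType where
  toFun k := Ordinal.ToType.mk
    ⟨((k : ℕ) : Ordinal.{u}), lt_of_lt_of_le (Nat.cast_lt.2 k.isLt) h⟩
  inj' k l hkl := by
    have := congrArg Subtype.val (Ordinal.ToType.mk.injective hkl)
    exact Fin.ext (Nat.cast_injective this)

/-- `A ∈ S Nr_m CA_n` (subalgebras up to isomorphism). -/
def MemSNr (m : ℕ) (n : Ordinal.{u}) (h : (m : Ordinal.{u}) ≤ n) (A : Type u) [BooleanAlgebra A]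
    [CylindricAlgebra (Fin m) A] : Prop :=
  ∃ (D : Type u) (_ : BooleanAlgebra D) (_ : CylindricAlgebra n.ToType D)
    (g : A → neatReduct (dimIncl m n h) D), IsEmbedding (Fin m) g

/-- `A ∈ S_c Nr_m CA_n` (complete subalgebras up to isomorphism): every subset of `A` whose
supremum in `A` is `⊤` still has supremum `⊤` in the neat reduct. -/
def MemScNr (m : ℕ) (n : Ordinal.{u}) (h : (m : Ordinal.{u}) ≤ n) (A : Type u) [BooleanAlgebra A]
    [CylindricAlgebra (Fin m) A] : Prop :=
  ∃ (D : Type u) (_ : BooleanAlgebra D) (_ : CylindricAlgebra n.ToType D)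
    (g : A → neatReduct (dimIncl m n h) D), IsEmbedding (Fin m) g ∧
      ∀ X : Set A, IsLUB X ⊤ → IsLUB (g '' X) ⊤

/-- `EqOff i s t`: the sequences `s` and `t` agree except possibly at `i`. -/
def EqOff {κ : Type w} {M : Type v} (i : κ) (s t : κ → M) : Prop :=
  ∀ j, j ≠ i → s j = t j

/-- A relativized representation of `A` with base `M`, unit `V` and representing function `f`:
an injective homomorphism from `A` to the powerset of `V` with the concrete operations
relativized to `V`. -/
structure RelRep (m : ℕ) (A : Type u) [BooleanAlgebra A] [CylindricAlgebra (Fin m) A]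
    (M : Type v) where
  V : Set (Fin m → M)
  f : A → Set (Fin m → M)
  base_nonempty : Nonempty M
  base_eq : ∀ x : M, ∃ s ∈ V, x ∈ Set.range s
  injective : Function.Injective f
  map_bot : f ⊥ = ∅
  map_top : f ⊤ = V
  map_sup : ∀ a b, f (a ⊔ b) = f a ∪ f b
  map_inf : ∀ a b, f (a ⊓ b) = f a ∩ f b
  map_compl : ∀ a, f aᶜ = V \ f a
  map_cyl : ∀ (i : Fin m) (a : A), f (cyl i a) = {s | s ∈ V ∧ ∃ t ∈ f a, EqOff i t s}
  map_diag : ∀ i j : Fin m, f (diag i j) = {s | s ∈ V ∧ s i = s j}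

/-- First order formulas with variables indexed by `κ` in the signature with an `m`-ary
predicate symbol for every element of `A`. -/
inductive CGFormula (m : ℕ) (A : Type u) (κ : Type w) : Type (max u w)
  | rel (r : A) (l : Fin m → κ) : CGFormula m A κ
  | neg (φ : CGFormula m A κ) : CGFormula m A κ
  | and (φ ψ : CGFormula m A κ) : CGFormula m A κ
  | ex (i : κ) (φ : CGFormula m A κ) : CGFormula m A κ

namespace RelRep

variable {m : ℕ} {A : Type u} [BooleanAlgebra A] [CylindricAlgebra (Fin m) A] {M : Type v}
  (R : RelRep m A M)

/-- Cliques: sets all of whose `m`-tuples lie in the unit. -/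
def IsClique (C : Set M) : Prop :=
  ∀ s : Fin m → M, (∀ k, s k ∈ C) → s ∈ R.V

/-- The `κ`-sequences whose range is a clique. -/
def cliqueSeqs (κ : Type w) : Set (κ → M) :=
  {a | R.IsClique (Set.range a)}

/-- Clique guarded semantics (used at sequences `a` in `cliqueSeqs`). -/
def Sat {κ : Type w} : CGFormula m A κ → (κ → M) → Prop
  | .rel r l, a => (fun k => a (l k)) ∈ R.f r
  | .neg φ, a => ¬ Sat φ a
  | .and φ ψ, a => Sat φ a ∧ Sat ψ a
  | .ex i φ, a => ∃ b ∈ R.cliqueSeqs κ, EqOff i b a ∧ Sat φ b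

/-- Squareness in the dimension `κ`. -/
def IsSquare (κ : Type w) : Prop :=
  ∀ s ∈ R.cliqueSeqs κ, ∀ (a : A) (i : Fin m) (l : Fin m → κ), Function.Injective l →
    (fun k => s (l k)) ∈ R.f (cyl i a) →
      ∃ t ∈ R.cliqueSeqs κ, EqOff (l i) t s ∧ (fun k => t (l k)) ∈ R.f a

/-- Flatness in the dimension `κ`: squareness, and quantifiers commute in the clique guarded
semantics. -/
def IsFlat (κ : Type w) : Prop :=
  R.IsSquare κ ∧ ∀ (φ : CGFormula m A κ), ∀ a ∈ R.cliqueSeqs κ, ∀ i j : κ,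
    (R.Sat (.ex i (.ex j φ)) a ↔ R.Sat (.ex j (.ex i φ)) a)

/-- Completeness: existing infima are taken to intersections in the powerset of the unit. -/
def IsComplete : Prop :=
  ∀ (X : Set A) (a : A), IsGLB X a → R.f a = {s | s ∈ R.V ∧ ∀ x ∈ X, s ∈ R.f x}

end RelRep

/-- `A` has an `n`-flat relativized representation. -/
def HasFlatRep (m : ℕ) (n : Ordinal.{u}) (A : Type u) [BooleanAlgebra A]
    [CylindricAlgebra (Fin m) A] : Prop :=
  ∃ (M : Type u) (R : RelRep m A M), R.IsFlat n.ToType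

/-- `A` has a complete `n`-flat relativized representation. -/
def HasCompleteFlatRep (m : ℕ) (n : Ordinal.{u}) (A : Type u) [BooleanAlgebra A]
    [CylindricAlgebra (Fin m) A] : Prop :=
  ∃ (M : Type u) (R : RelRep m A M), R.IsFlat n.ToType ∧ R.IsComplete

/-- The function symbols of the language of `m`-dimensional cylindric algebras. -/
inductive CAFunc (m : ℕ) : ℕ → Type
  | bot : CAFunc m 0
  | top : CAFunc m 0
  | diag (i j : Fin m) : CAFunc m 0
  | compl : CAFunc m 1
  | cyl (i : Fin m) : CAFunc m 1
  | sup : CAFunc m 2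
  | inf : CAFunc m 2

/-- The first order language of `m`-dimensional cylindric algebras. -/
def caLang (m : ℕ) : FirstOrder.Language.{0, 0} where
  Functions := CAFunc m
  Relations := fun _ => Empty

instance caStructure (m : ℕ) (A : Type u) [BooleanAlgebra A] [CylindricAlgebra (Fin m) A] :
    (caLang m).Structure A where
  funMap := fun {k} (F : CAFunc m k) =>
    match k, F with
    | _, .bot => fun _ => ⊥
    | _, .top => fun _ => ⊤
    | _, .diag i j => fun _ => diag i j
    | _, .compl => fun x => (x 0)ᶜ
    | _, .cyl i => fun x => cyl i (x 0)
    | _, .sup => fun x => x 0 ⊔ x 1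
    | _, .inf => fun x => x 0 ⊓ x 1
  RelMap := fun r => r.elim

/-- A class of `m`-dimensional cylindric algebras is elementary if it is the class of all
`m`-dimensional cylindric algebras that satisfy some set of first order sentences. (As the
axioms of cylindric algebras are first order, this is the same as being axiomatizable among all
structures for the language.) -/
def IsElementaryClass (m : ℕ)
    (K : ∀ (A : Type u) [BooleanAlgebra A] [CylindricAlgebra (Fin m) A], Prop) : Prop :=
  ∃ T : (caLang m).Theory, ∀ (A : Type u) [BooleanAlgebra A] [CylindricAlgebra (Fin m) A],
    K A ↔ FirstOrder.Language.Theory.Model A T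

/-! Items 1 and 2. The sets of clique sequences definable by formulas of `L(A)^n` form a field of
sets closed under relativized cylindrifications and containing the diagonals. Clique sequences are
closed under substitutions, so all cylindric axioms hold automatically except that cylindrifications
commute, and this is what flatness says (`RelRep.IsFlat.algebra`). Sending `a` to the set defined by
the atomic formula `a(x₀, …, x_{m-1})` embeds `A` into the neat reduct of this algebra; squareness
yields both injectivity and preservation of cylindrifications (`RelRep.IsFlat.exists_embedding`). If
the representation is complete, a set with sum `1` covers all tuples of the unit, so its image has
sum `1` too.

Item 3 is a rainbow construction; write `m = d + 3`. A coloured structure (`Net`) has for each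
injective `d`-tuple, its context, an edge-coloured graph on the remaining points, subject to laws
for triangles. An `m`-tuple shows at most three points outside a context that it contains, so it
sees triangles only. The atoms are the isomorphism types of `m`-tuples in coloured structures, and
the algebra is the full complex algebra of the atoms. A point joined to `b₀` by a tint `t` and to
`b₁` by green is an apex of tint `t` over the base `b₀`, `b₁`. Apexes with different tints over one
base must be joined by a red edge whose indices satisfy `Rainbow.hom`, and the reds of a triangle
have matching indices. Tints are integers, red indices are natural numbers, and an index must drop
when the tint grows by one.

This algebra has no complete square representation in a dimension `≥ d + 5`
(`RelRep.not_isComplete_of_isSquare`). Completeness puts every tuple of the unit into an atom. With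
`d` places for a context, two for a base and three for apexes, one can go on adding apexes of tints
`0, 1, 2, …` while reusing the oldest apex place, and the red indices would descend forever.

Over a nonprincipal ultrapower some map `ρ` from tints to red indices meets all constraints at once
(`exists_hom_ultrapower`). With its help coloured structures over the ultrapower of the index sets
can always be extended by a point realizing a given atom. The invariant is a valuation, which gives
for each base a map from tints to red indices (`exists_complete`, `Net.exists_extend_val`). Zorn's
lemma yields a saturated structure (`exists_isSaturated`), and the ultrapower of the algebra is
isomorphic to a field of sets of all `m`-tuples of its points (`Net.IsSaturated.exists_equiv`). Each
tuple lies in an atom of this field, so the ultrapower has a complete `n`-flat representation for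
every `n`. By Łoś's theorem the algebra and its ultrapower satisfy the same sentences, so no set of
sentences defines the class. -/

/-! ### Cylindric algebras of sets of sequences -/

section SequenceAlgebra

variable {κ : Type w} {M : Type v}

theorem EqOff.refl (i : κ) (s : κ → M) : EqOff i s s := fun _ _ => rfl

theorem EqOff.symm {i : κ} {s t : κ → M} (h : EqOff i s t) : EqOff i t s :=
  fun j hj => (h j hj).symm

theorem EqOff.trans {i : κ} {s t r : κ → M} (h : EqOff i s t) (h' : EqOff i t r) : EqOff i s r :=
  fun j hj => (h j hj).trans (h' j hj)

theorem eqOff_update [DecidableEq κ] (i : κ) (s : κ → M) (x : M) : EqOff i (Function.update s i x) s :=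
  fun _ hj => Function.update_of_ne hj _ _

open Classical in
theorem EqOff.eq_update {i : κ} {s t : κ → M} (h : EqOff i t s) :
    t = Function.update s i (t i) := by
  funext j
  by_cases hj : j = i
  · subst hj; simp
  · rw [Function.update_of_ne hj, h j hj]

/-- Cylindrification relativized to a set `W` of sequences. -/
def seqCyl (W : Set (κ → M)) (i : κ) (x : Set W) : Set W :=
  {s | ∃ t ∈ x, EqOff i t.1 s.1}

/-- Diagonals relativized to a set `W` of sequences. -/
def seqDiag (W : Set (κ → M)) (i j : κ) : Set W := {s | s.1 i = s.1 j}

open Classical in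
/-- A field of sets of sequences, closed under the relativized operations, is a cylindric algebra
when its unit is closed under substitutions and the cylindrifications commute. -/
@[reducible] def seqAlgebra (W : Set (κ → M))
    (hW : ∀ s ∈ W, ∀ i k, Function.update s k (s i) ∈ W) (B : BooleanSubalgebra (Set W))
    (hc : ∀ i, ∀ x ∈ B, seqCyl W i x ∈ B) (hd : ∀ i j, seqDiag W i j ∈ B)
    (hcomm : ∀ i j, ∀ x ∈ B, seqCyl W i (seqCyl W j x) ⊆ seqCyl W j (seqCyl W i x)) :
    CylindricAlgebra κ B where
  cyl i x := ⟨seqCyl W i x.1, hc i x.1 x.2⟩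
  diag i j := ⟨seqDiag W i j, hd i j⟩
  cyl_bot i := by
    apply Subtype.ext
    ext s
    constructor
    · rintro ⟨t, ht, -⟩; exact ht
    · intro h; exact h.elim
  le_cyl i x := fun s hs => ⟨s, hs, EqOff.refl i _⟩
  cyl_inf_cyl i x y := by
    apply Subtype.ext
    ext s
    constructor
    · rintro ⟨t, ⟨ht, r, hr, hrt⟩, hts⟩
      exact ⟨⟨t, ht, hts⟩, r, hr, hrt.trans hts⟩
    · rintro ⟨⟨t, ht, hts⟩, r, hr, hrs⟩
      exact ⟨t, ⟨ht, r, hr, hrs.trans hts.symm⟩, hts⟩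
  cyl_comm i j x := Subtype.ext
    (Set.Subset.antisymm (hcomm i j x.1 x.2) (hcomm j i x.1 x.2))
  diag_self i := by
    apply Subtype.ext
    ext s
    exact ⟨fun _ => trivial, fun _ => rfl⟩
  diag_eq i j k hi hj := by
    apply Subtype.ext
    ext s
    constructor
    · intro h
      refine ⟨⟨_, hW s.1 s.2 i k⟩, ⟨?_, ?_⟩, eqOff_update _ _ _⟩
      · change Function.update s.1 k (s.1 i) i = Function.update s.1 k (s.1 i) k
        rw [Function.update_of_ne hi.symm]; simp
      · change Function.update s.1 k (s.1 i) k = Function.update s.1 k (s.1 i) j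
        rw [Function.update_of_ne hj.symm, Function.update_self]; exact h
    · rintro ⟨t, ⟨h1, h2⟩, ht⟩
      change s.1 i = s.1 j
      rw [← ht i hi.symm, ← ht j hj.symm]
      exact Eq.trans h1 h2
  cyl_diag i j x hij := by
    apply Subtype.ext
    ext s
    constructor
    · rintro ⟨⟨t, ⟨h1, h2⟩, h3⟩, r, ⟨h4, h5⟩, h6⟩
      have : t = r := by
        apply Subtype.ext
        funext k
        by_cases hk : k = i
        · subst hk
          calc t.1 k = t.1 j := h1
            _ = s.1 j := h3 j hij.symm
            _ = r.1 j := (h6 j hij.symm).symm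
            _ = r.1 k := Eq.symm h4
        · exact (h3 k hk).trans (h6 k hk).symm
      exact (h5 (this ▸ h2)).elim
    · intro h; exact h.elim

end SequenceAlgebra

/-! ### Definable sets of a flat representation: items 1 and 2 -/

namespace RelRep

variable {m : ℕ} {A : Type u} [BooleanAlgebra A] [CylindricAlgebra (Fin m) A] {M : Type v}
  (R : RelRep m A M)

theorem subset_V (a : A) : R.f a ⊆ R.V := by
  rw [← R.map_top, ← sup_top_eq a, R.map_sup]
  exact Set.subset_union_left

/-- Every cylindric algebra satisfies `cyl i (diag i j) = ⊤`. Hence a tuple of the unit has a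
neighbour along `i` in the unit that lies on the diagonal, and this neighbour is the substituted
tuple. -/
theorem update_mem {s : Fin m → M} (hs : s ∈ R.V) (i j : Fin m) :
    Function.update s i (s j) ∈ R.V := by
  by_cases hij : i = j
  · subst hij; simpa using hs
  have h : cyl i (diag i j : A) = ⊤ := by
    have h2 : cyl i (diag j j : A) = cyl i (cyl i (diag j i ⊓ diag i j)) := by
      rw [diag_eq j j i hij hij]
    have h4 : cyl i (⊤ : A) = ⊤ := top_le_iff.1 (le_cyl i _)
    rw [diag_self, h4, cyl_cyl] at h2
    exact top_le_iff.1 (h2.le.trans (cyl_mono i inf_le_right))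
  have h1 : s ∈ R.f (cyl i (diag i j : A)) := by rw [h, R.map_top]; exact hs
  rw [R.map_cyl] at h1
  obtain ⟨-, t, ht, hts⟩ := h1
  rw [R.map_diag] at ht
  have : t = Function.update s i (s j) := by
    have h2 := hts.eq_update
    rw [show t i = s j from ht.2.trans (hts j (Ne.symm hij))] at h2
    convert! h2
  exact this ▸ ht.1

theorem mem_cyl {s t : Fin m → M} {a : A} (i : Fin m) (hs : s ∈ R.V) (ht : t ∈ R.f a)
    (h : EqOff i t s) : s ∈ R.f (cyl i a) := by
  rw [R.map_cyl]; exact ⟨hs, t, ht, h⟩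

/-- The point is an entry of some tuple of the unit. Copying this entry into the other coordinates
one at a time stays in the unit and ends in the constant tuple. -/
theorem isClique_singleton (x : M) : R.IsClique {x} := by
  intro s hs
  obtain ⟨t, ht, k, rfl⟩ := R.base_eq x
  have key : ∀ F : Finset (Fin m), (fun i => if i ∈ F then t k else t i) ∈ R.V := by
    intro F
    induction F using Finset.induction_on with
    | empty => simpa using ht
    | insert i F hi ih =>
      have h := R.update_mem ih i k
      convert h using 1
      funext j
      by_cases hj : j = i
      · subst hj; simp
      · simp [hj]
  have := key Finset.univ
  convert this using 1
  funext i
  simpa using hs i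

theorem isClique_mono {C D : Set M} (h : C ⊆ D) (hD : R.IsClique D) : R.IsClique C :=
  fun s hs => hD s fun k => h (hs k)

theorem comp_mem_V {κ : Type w} {a : κ → M} (ha : a ∈ R.cliqueSeqs κ) (l : Fin m → κ) :
    (fun k => a (l k)) ∈ R.V := ha _ fun k => ⟨l k, rfl⟩

theorem const_mem_cliqueSeqs (κ : Type w) (x : M) : (fun _ : κ => x) ∈ R.cliqueSeqs κ :=
  R.isClique_mono (by rintro _ ⟨_, rfl⟩; rfl) (R.isClique_singleton x)

open Classical in
theorem update_mem_cliqueSeqs {κ : Type w} {a : κ → M} (ha : a ∈ R.cliqueSeqs κ) (i k : κ) :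
    Function.update a k (a i) ∈ R.cliqueSeqs κ := by
  refine R.isClique_mono ?_ ha
  rintro _ ⟨j, rfl⟩
  by_cases hj : j = k
  · subst hj; exact ⟨i, by simp⟩
  · exact ⟨j, by simp [Function.update_of_ne hj]⟩

/-- In a square representation, every nonzero element is realized on a clique. -/
theorem IsSquare.exists_mem {κ : Type w} (hR : R.IsSquare κ) (e : Fin m ↪ κ) [NeZero m] {a : A}
    (ha : a ≠ ⊥) : ∃ t ∈ R.cliqueSeqs κ, (fun k => t (e k)) ∈ R.f a := by
  obtain ⟨s, hs⟩ : (R.f a).Nonempty := by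
    rw [Set.nonempty_iff_ne_empty, ← R.map_bot]
    exact fun h => ha (R.injective h)
  have hV := R.subset_V a hs
  -- The entries are overwritten by `s 0` one at a time, and `a` is cylindrified at each step. The
  -- final tuple is constant, so it comes from a clique sequence, from which squareness undoes the
  -- cylindrifications in reverse order.
  have key : ∀ F : Finset (Fin m), (fun i => if i ∈ F then s 0 else s i) ∈ R.V ∧
      ∃ b : A, (fun i => if i ∈ F then s 0 else s i) ∈ R.f b ∧
        ((∃ t ∈ R.cliqueSeqs κ, (fun k => t (e k)) ∈ R.f b) →
          ∃ t ∈ R.cliqueSeqs κ, (fun k => t (e k)) ∈ R.f a) := by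
    intro F
    induction F using Finset.induction_on with
    | empty => exact ⟨by simpa using hV, a, by simpa using hs, id⟩
    | insert i F hi ih =>
      obtain ⟨h1, b, h2, h3⟩ := ih
      have h4 : (fun j => if j ∈ insert i F then s 0 else s j) =
          Function.update (fun j => if j ∈ F then s 0 else s j) i
            ((fun j => if j ∈ F then s 0 else s j) 0) := by
        funext j
        by_cases hj : j = i
        · subst hj; simp
        · simp [hj]
      have h5 := R.update_mem h1 i 0
      rw [← h4] at h5
      refine ⟨h5, cyl i b, R.mem_cyl i h5 h2 ?_, ?_⟩
      · intro j hj; simp [hj]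
      · rintro ⟨t, ht, htb⟩
        obtain ⟨t', ht', -, h⟩ := hR t ht b i e e.injective htb
        exact h3 ⟨t', ht', h⟩
  obtain ⟨-, b, h2, h3⟩ := key Finset.univ
  exact h3 ⟨fun _ => s 0, R.const_mem_cliqueSeqs κ _, by simpa using h2⟩

variable (κ : Type w)

/-- The set of clique sequences that satisfy a formula. -/
def satSet (φ : CGFormula m A κ) : Set (R.cliqueSeqs κ) := {a | R.Sat φ a.1}

theorem satSet_ex (i : κ) (φ : CGFormula m A κ) :
    R.satSet κ (.ex i φ) = seqCyl _ i (R.satSet κ φ) := by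
  ext s
  constructor
  · rintro ⟨b, hb, h1, h2⟩; exact ⟨⟨b, hb⟩, h2, h1⟩
  · rintro ⟨b, h2, h1⟩; exact ⟨b.1, b.2, h1, h2⟩

variable {κ}

/-- The field of sets of clique sequences definable in the clique guarded semantics. -/
def definable [Inhabited κ] : BooleanSubalgebra (Set (R.cliqueSeqs κ)) where
  carrier := Set.range (R.satSet κ)
  supClosed' := by
    rintro _ ⟨φ, rfl⟩ _ ⟨ψ, rfl⟩
    refine ⟨.neg (.and (.neg φ) (.neg ψ)), ?_⟩
    ext s
    change ¬ (¬ R.Sat φ s.1 ∧ ¬ R.Sat ψ s.1) ↔ R.Sat φ s.1 ∨ R.Sat ψ s.1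
    tauto
  infClosed' := by
    rintro _ ⟨φ, rfl⟩ _ ⟨ψ, rfl⟩
    exact ⟨.and φ ψ, rfl⟩
  compl_mem' := by
    rintro _ ⟨φ, rfl⟩
    exact ⟨.neg φ, rfl⟩
  bot_mem' := by
    refine ⟨.rel ⊥ fun _ => default, ?_⟩
    ext s
    change _ ∈ R.f ⊥ ↔ _
    rw [R.map_bot]; rfl

/-- The cylindric algebra of definable sets of a flat representation. -/
@[reducible] def IsFlat.algebra [Inhabited κ] (hm : 2 ≤ m) (hR : R.IsFlat κ) :
    CylindricAlgebra κ (R.definable (κ := κ)) :=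
  seqAlgebra (R.cliqueSeqs κ) (fun _ hs i k => R.update_mem_cliqueSeqs hs i k) R.definable
    (by rintro i _ ⟨φ, rfl⟩; exact ⟨.ex i φ, R.satSet_ex κ i φ⟩)
    (by
      intro i j
      -- The atomic formula with symbol `diag 0 1`, variable `i` in place `0` and `j` in all the
      -- others, says that the entries `i` and `j` are equal.
      refine ⟨.rel (diag (⟨0, by omega⟩ : Fin m) ⟨1, by omega⟩)
        fun k => if k.1 = 0 then i else j, ?_⟩
      ext s
      change _ ∈ R.f (diag _ _) ↔ s.1 i = s.1 j
      rw [R.map_diag]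
      exact ⟨fun h => h.2, fun h => ⟨R.comp_mem_V s.2 _, h⟩⟩)
    (by
      rintro i j _ ⟨φ, rfl⟩ s hs
      rw [← R.satSet_ex, ← R.satSet_ex] at hs ⊢
      exact (hR.2 φ s.1 s.2 i j).1 hs)

/-- The canonical embedding of `A` into the neat reduct of the algebra of definable sets. -/
theorem IsFlat.exists_embedding [Inhabited κ] (hm : 2 ≤ m) (hR : R.IsFlat κ) (e : Fin m ↪ κ) :
    letI := IsFlat.algebra R hm hR
    ∃ g : A → neatReduct e (R.definable (κ := κ)), IsEmbedding (Fin m) g ∧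
      ∀ a (s : R.cliqueSeqs κ), s ∈ (g a).1.1 ↔ (fun k => s.1 (e k)) ∈ R.f a := by
  have : NeZero m := ⟨by omega⟩
  let _ := IsFlat.algebra R hm hR
  have hV : ∀ s : R.cliqueSeqs κ, (fun k => s.1 (e k)) ∈ R.V := fun s => R.comp_mem_V s.2 _
  let g : A → neatReduct e (R.definable (κ := κ)) := fun a =>
    ⟨⟨R.satSet κ (.rel a e), _, rfl⟩, by
      intro i hi
      apply Subtype.ext
      ext s
      constructor
      · rintro ⟨t, ht, hts⟩
        change (fun k => s.1 (e k)) ∈ R.f a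
        have : (fun k => s.1 (e k)) = fun k => t.1 (e k) :=
          funext fun k => (hts (e k) fun h => hi ⟨k, h⟩).symm
        rw [this]; exact ht
      · intro h; exact ⟨s, h, EqOff.refl _ _⟩⟩
  have hg : ∀ a (s : R.cliqueSeqs κ), s ∈ (g a).1.1 ↔ (fun k => s.1 (e k)) ∈ R.f a :=
    fun a s => Iff.rfl
  have ext : ∀ x y : neatReduct e (R.definable (κ := κ)), (∀ s, s ∈ x.1.1 ↔ s ∈ y.1.1) → x = y :=
    fun x y h => Subtype.ext (Subtype.ext (Set.ext h))
  have map_inf : ∀ x y, g (x ⊓ y) = g x ⊓ g y := by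
    intro x y; apply ext; intro s
    change _ ↔ s ∈ (g x).1.1 ∧ s ∈ (g y).1.1
    rw [hg, hg, hg, R.map_inf]; rfl
  have map_compl : ∀ x, g xᶜ = (g x)ᶜ := by
    intro x; apply ext; intro s
    change _ ↔ ¬ s ∈ (g x).1.1
    rw [hg, hg, R.map_compl]
    exact ⟨fun h => h.2, fun h => ⟨hV s, h⟩⟩
  have map_bot : g ⊥ = ⊥ := by
    apply ext; intro s
    change _ ↔ False
    rw [hg, R.map_bot]; rfl
  refine ⟨g, ⟨?_, map_bot, ?_, ?_, map_inf, map_compl, ?_, ?_⟩, hg⟩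
  · have h0 : ∀ a, g a = ⊥ → a = ⊥ := by
      intro a h
      by_contra ha
      obtain ⟨t, ht, hta⟩ := IsSquare.exists_mem R hR.1 e ha
      have : (⟨t, ht⟩ : R.cliqueSeqs κ) ∈ (g a).1.1 := hta
      rw [h] at this
      exact this
    intro x y h
    have le : ∀ x y, g x = g y → x ≤ y := by
      intro x y h
      have h1 : x ⊓ yᶜ = ⊥ := h0 _ (by rw [map_inf, map_compl, h, inf_compl_eq_bot])
      rw [← compl_compl y]; exact (disjoint_iff.2 h1).le_compl_right
    exact le_antisymm (le x y h) (le y x h.symm)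
  · apply ext; intro s
    change _ ↔ True
    rw [hg, R.map_top]; simpa using hV s
  · intro x y; apply ext; intro s
    change _ ↔ s ∈ (g x).1.1 ∨ s ∈ (g y).1.1
    rw [hg, hg, hg, R.map_sup]; rfl
  · intro i a; apply ext; intro s
    change _ ↔ ∃ t, t ∈ (g a).1.1 ∧ EqOff (e i) t.1 s.1
    rw [hg]
    constructor
    · intro h
      obtain ⟨t, ht, hts, hta⟩ := hR.1 s.1 s.2 a i e e.injective h
      exact ⟨⟨t, ht⟩, hta, hts⟩
    · rintro ⟨t, ht, hts⟩
      exact R.mem_cyl i (hV s) ht fun k hk => hts (e k) fun h => hk (e.injective h)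
  · intro i j; apply ext; intro s
    change _ ↔ s.1 (e i) = s.1 (e j)
    rw [hg, R.map_diag]
    exact ⟨fun h => h.2, fun h => ⟨hV s, h⟩⟩

end RelRep

theorem HasFlatRep.memSNr {m : ℕ} (hm : 2 ≤ m) {n : Ordinal.{u}} (hmn : (m : Ordinal.{u}) ≤ n)
    {A : Type u} [BooleanAlgebra A] [CylindricAlgebra (Fin m) A] (h : HasFlatRep m n A) :
    MemSNr m n hmn A := by
  obtain ⟨M, R, hR⟩ := h
  let _ : Inhabited n.ToType := ⟨dimIncl m n hmn ⟨0, by omega⟩⟩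
  let _ := RelRep.IsFlat.algebra R hm hR
  obtain ⟨g, hg, -⟩ := RelRep.IsFlat.exists_embedding R hm hR (dimIncl m n hmn)
  exact ⟨R.definable (κ := n.ToType), inferInstance, inferInstance, g, hg⟩

/-- If `X` has sum `⊤`, the complements of its elements have infimum `⊥`, so completeness leaves no
tuple of the unit outside all `f x`. A clique sequence missed by an upper bound of the image would
restrict to such a tuple. -/
theorem HasCompleteFlatRep.memScNr {m : ℕ} (hm : 2 ≤ m) {n : Ordinal.{u}}
    (hmn : (m : Ordinal.{u}) ≤ n) {A : Type u} [BooleanAlgebra A] [CylindricAlgebra (Fin m) A]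
    (h : HasCompleteFlatRep m n A) : MemScNr m n hmn A := by
  obtain ⟨M, R, hR, hC⟩ := h
  let _ : Inhabited n.ToType := ⟨dimIncl m n hmn ⟨0, by omega⟩⟩
  let _ := RelRep.IsFlat.algebra R hm hR
  obtain ⟨g, hg, hmem⟩ := RelRep.IsFlat.exists_embedding R hm hR (dimIncl m n hmn)
  refine ⟨R.definable (κ := n.ToType), inferInstance, inferInstance, g, hg, ?_⟩
  intro X hX
  refine ⟨fun _ _ => le_top, fun y hy s _ => ?_⟩
  have hglb : IsGLB (compl '' X) (⊥ : A) := by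
    refine ⟨fun _ _ => bot_le, fun b hb => ?_⟩
    have : (⊤ : A) ≤ bᶜ := hX.2 fun x hx => by
      have := hb ⟨x, hx, rfl⟩
      exact le_compl_comm.1 this
    rw [← compl_compl b, top_le_iff.1 this, compl_top]
  have h := hC _ _ hglb
  rw [R.map_bot] at h
  have hs : (fun k => s.1 (dimIncl m n hmn k)) ∈ R.V := R.comp_mem_V s.2 _
  by_contra hsy
  have : (fun k => s.1 (dimIncl m n hmn k)) ∈ (∅ : Set (Fin m → M)) := by
    rw [h]
    refine ⟨hs, ?_⟩
    rintro _ ⟨x, hx, rfl⟩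
    rw [R.map_compl]
    refine ⟨hs, fun hx' => hsy ?_⟩
    exact hy ⟨x, hx, rfl⟩ ((hmem x s).2 hx')
  exact this

/-! ### Rainbow colours and the laws for triangles -/

/-- Index sets for tints and red colours, with a relation `hom s t k l` saying that assigning the
red indices `k`, `l` to the tints `s`, `t` is admissible. -/
class Rainbow (G R : Type u) where
  hom : G → G → R → R → Prop
  hom_symm : ∀ {s t k l}, hom s t k l → hom t s l k
  hom_self : ∀ s k, hom s s k k
  eq_of_hom : ∀ {s k l}, hom s s k l → k = l

/-- Edge colours: two families of whites, each with a list of admissible tints (`none` stands for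
all tints), greens with and without a tint, and reds with two indices. -/
inductive Color (G R : Type u) : Type u
  | white (i : Bool) (S : Option (G × G))
  | tint (s : G)
  | green
  | red (k l : R)

namespace Color

variable {G R : Type u}

/-- The neutral colour. -/
def neutral : Color G R := white false none

/-- The colour of the reversed edge. -/
def conv : Color G R → Color G R
  | red k l => red l k
  | a => a

@[simp] theorem conv_conv (a : Color G R) : a.conv.conv = a := by cases a <;> rfl

/-- The tint `s` is admissible for the list `S`. -/
def Allowed (S : Option (G × G)) (s : G) : Prop := ∀ p ∈ S, s = p.1 ∨ s = p.2

/-- Red edges `x y`, `y z`, `x z` of a triangle have matching indices. -/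
def Coherent : Color G R → Color G R → Color G R → Prop
  | red k l, red l' p, red k' p' => k = k' ∧ l = l' ∧ p = p'
  | _, _, _ => True

theorem Coherent.rotate {a b c : Color G R} (h : Coherent a b c) : Coherent c b.conv a := by
  cases a <;> cases b <;> cases c <;>
    first | trivial | exact ⟨h.1.symm, h.2.2.symm, h.2.1.symm⟩

theorem Coherent.rotate' {a b c : Color G R} (h : Coherent a b c) : Coherent c.conv a b.conv := by
  cases a <;> cases b <;> cases c <;>
    first | trivial | exact ⟨h.2.2.symm, h.1.symm, h.2.1⟩

variable [Rainbow G R]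

/-- The condition at the vertex `x` of a triangle `x`, `y`, `z` in which `x y`, `x z` and `y z` have
the colours `a`, `c` and `b`. -/
def VertexLaw : Color G R → Color G R → Color G R → Prop
  -- In the tint–tint and green–green cases `y` and `z` may be apexes over a base containing `x`.
  -- The first case admits only whites marked `true` and the second only whites marked `false`, so
  -- two apexes seen from both points of a common base can only be joined by a red edge.
  | tint s, tint t, red k l => Rainbow.hom s t k l
  | tint _, tint _, white i _ => i = true
  | tint _, tint _, _ => False
  | green, green, red _ _ => True
  | green, green, white i _ => i = false
  | green, green, _ => False
  -- Now `x` is an apex over `y`, `z`. The list on the white base edge restricts the tints of the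
  -- apexes over it.
  | tint s, green, white _ S => Allowed S s
  | tint _, green, _ => False
  | green, tint s, white _ S => Allowed S s
  | green, tint _, _ => False
  | _, _, _ => True

/-- The law for a triangle in which `x y`, `x z` and `y z` have the colours `a`, `c` and `b`. -/
def Tri (a c b : Color G R) : Prop := VertexLaw a c b ∧ Coherent a b c

theorem VertexLaw.symm {a c b : Color G R} (h : VertexLaw a c b) : VertexLaw c a b.conv := by
  cases a <;> cases c <;> cases b <;> first | exact h | exact Rainbow.hom_symm h

theorem VertexLaw.conv {a c b : Color G R} (h : VertexLaw a c b) :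
    VertexLaw a.conv c.conv b := by
  cases a <;> cases c <;> exact h

/-- Two neutral edges make any triangle lawful. So neutral is a safe colour wherever nothing is
prescribed. -/
theorem tri_neutral_left (b : Color G R) : Tri neutral neutral b := by
  cases b <;> exact ⟨trivial, trivial⟩

theorem tri_neutral_mid (a : Color G R) : Tri a neutral neutral := by
  cases a <;> exact ⟨trivial, trivial⟩

theorem tri_neutral_right (c : Color G R) : Tri neutral c neutral := by
  cases c <;> exact ⟨trivial, trivial⟩

end Color

open Color

/-! ### Coloured structures and patterns of sequences -/

/-- `Proper c x y`: `c` is an injective sequence and `x`, `y` are different points outside it. -/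
def Proper {d : ℕ} {X : Type v} (c : Fin d → X) (x y : X) : Prop :=
  Function.Injective c ∧ x ∉ Set.range c ∧ y ∉ Set.range c ∧ x ≠ y

theorem Proper.symm {d : ℕ} {X : Type v} {c : Fin d → X} {x y : X} (h : Proper c x y) :
    Proper c y x := ⟨h.1, h.2.2.1, h.2.1, h.2.2.2.symm⟩

theorem proper_comp_iff {d : ℕ} {X Y : Type*} {f : X → Y} (hf : Function.Injective f)
    {c : Fin d → X} {x y : X} : Proper (f ∘ c) (f x) (f y) ↔ Proper c x y := by
  have h : ∀ z, f z ∈ Set.range (f ∘ c) ↔ z ∈ Set.range c := fun z =>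
    ⟨fun ⟨k, hk⟩ => ⟨k, hf hk⟩, fun ⟨k, hk⟩ => ⟨k, congrArg f hk⟩⟩
  simp only [Proper, h, hf.ne_iff, hf.of_comp_iff]

/-- A coloured structure on `X`: for every injective sequence `c` of length `d`, a coloured graph
on the points outside `c`. -/
structure Net (d : ℕ) (G R : Type u) [Rainbow G R] (X : Type v) where
  col : (Fin d → X) → X → X → Color G R
  col_neutral : ∀ {c x y}, ¬ Proper c x y → col c x y = neutral
  col_conv : ∀ c x y, col c y x = (col c x y).conv
  tri : ∀ {c x y z}, Proper c x y → Proper c x z → Proper c y z →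
    Tri (col c x y) (col c x z) (col c y z)

/-- The isomorphism type of a sequence of length `d + 3` of points of a coloured structure. -/
@[ext] structure Pat (d : ℕ) (G R : Type u) where
  eq : Fin (d + 3) → Fin (d + 3) → Prop
  col : (Fin d → Fin (d + 3)) → Fin (d + 3) → Fin (d + 3) → Color G R

namespace Pat

variable {d : ℕ} {G R : Type u}

/-- `Proper` modulo the equality recorded in a pattern. -/
def IsProper (p : Pat d G R) (h : Fin d → Fin (d + 3)) (a b : Fin (d + 3)) : Prop :=
  (∀ k l, p.eq (h k) (h l) → k = l) ∧ (∀ k, ¬ p.eq (h k) a) ∧ (∀ k, ¬ p.eq (h k) b) ∧ ¬ p.eq a b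

/-- The patterns of sequences in coloured structures. -/
structure IsAtom [Rainbow G R] (p : Pat d G R) : Prop where
  equiv : Equivalence p.eq
  congr : ∀ h h' a a' b b', (∀ k, p.eq (h k) (h' k)) → p.eq a a' → p.eq b b' →
    p.col h a b = p.col h' a' b'
  col_neutral : ∀ h a b, ¬ p.IsProper h a b → p.col h a b = neutral
  col_conv : ∀ h a b, p.col h b a = (p.col h a b).conv
  tri : ∀ h a b c, p.IsProper h a b → p.IsProper h a c → p.IsProper h b c →
    Tri (p.col h a b) (p.col h a c) (p.col h b c)

/-- Two patterns agree on a set of coordinates. -/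
def Agree (W : Set (Fin (d + 3))) (p q : Pat d G R) : Prop :=
  (∀ a ∈ W, ∀ b ∈ W, (p.eq a b ↔ q.eq a b)) ∧
    ∀ h : Fin d → Fin (d + 3), (∀ k, h k ∈ W) → ∀ a ∈ W, ∀ b ∈ W, p.col h a b = q.col h a b

theorem Agree.refl (W : Set (Fin (d + 3))) (p : Pat d G R) : Agree W p p :=
  ⟨fun _ _ _ _ => Iff.rfl, fun _ _ _ _ _ _ => rfl⟩

theorem Agree.symm {W : Set (Fin (d + 3))} {p q : Pat d G R} (h : Agree W p q) : Agree W q p :=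
  ⟨fun a ha b hb => (h.1 a ha b hb).symm, fun g hg a ha b hb => (h.2 g hg a ha b hb).symm⟩

theorem Agree.trans {W : Set (Fin (d + 3))} {p q r : Pat d G R} (h : Agree W p q)
    (h' : Agree W q r) : Agree W p r :=
  ⟨fun a ha b hb => (h.1 a ha b hb).trans (h'.1 a ha b hb),
    fun g hg a ha b hb => (h.2 g hg a ha b hb).trans (h'.2 g hg a ha b hb)⟩

theorem Agree.mono {W W' : Set (Fin (d + 3))} {p q : Pat d G R} (h : Agree W p q) (hW : W' ⊆ W) :
    Agree W' p q :=
  ⟨fun a ha b hb => h.1 a (hW ha) b (hW hb),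
    fun g hg a ha b hb => h.2 g (fun k => hW (hg k)) a (hW ha) b (hW hb)⟩

theorem Agree.eq {p q : Pat d G R} (h : Agree Set.univ p q) : p = q := by
  apply Pat.ext
  · funext a b; exact propext (h.1 a trivial b trivial)
  · funext g a b; exact h.2 g (fun _ => trivial) a trivial b trivial

/-- Agreement of atoms extends to a coordinate that duplicates an old one in both of them. -/
theorem Agree.insert [Rainbow G R] {p q : Pat d G R} (hp : p.IsAtom) (hq : q.IsAtom)
    {W : Set (Fin (d + 3))} (h : Agree W p q) {i j : Fin (d + 3)} (hj : j ∈ W)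
    (hpij : p.eq i j) (hqij : q.eq i j) : Agree (insert i W) p q := by
  classical
  let f : Fin (d + 3) → Fin (d + 3) := fun a => if a = i then j else a
  have hf : ∀ a ∈ Insert.insert i W, f a ∈ W := by
    intro a haW
    by_cases ha : a = i
    · simpa [f, ha] using hj
    · simpa [f, ha] using haW.resolve_left ha
  have hpf : ∀ a, p.eq a (f a) := by
    intro a
    by_cases ha : a = i
    · simpa [f, ha] using hpij
    · simpa [f, ha] using hp.equiv.refl a
  have hqf : ∀ a, q.eq a (f a) := by
    intro a
    by_cases ha : a = i
    · simpa [f, ha] using hqij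
    · simpa [f, ha] using hq.equiv.refl a
  constructor
  · intro a ha b hb
    have h1 := h.1 _ (hf a ha) _ (hf b hb)
    constructor
    · intro hab
      have := h1.1 (hp.equiv.trans (hp.equiv.symm (hpf a)) (hp.equiv.trans hab (hpf b)))
      exact hq.equiv.trans (hqf a) (hq.equiv.trans this (hq.equiv.symm (hqf b)))
    · intro hab
      have := h1.2 (hq.equiv.trans (hq.equiv.symm (hqf a)) (hq.equiv.trans hab (hqf b)))
      exact hp.equiv.trans (hpf a) (hp.equiv.trans this (hp.equiv.symm (hpf b)))
  · intro g hg a ha b hb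
    rw [hp.congr g (f ∘ g) a (f a) b (f b) (fun k => hpf _) (hpf a) (hpf b),
      hq.congr g (f ∘ g) a (f a) b (f b) (fun k => hqf _) (hqf a) (hqf b)]
    exact h.2 _ (fun k => hf _ (hg k)) _ (hf a ha) _ (hf b hb)

/-- A pattern in which the coordinate `i` duplicates `j` is determined by the other coordinates. -/
theorem IsAtom.eq_of_agree [Rainbow G R] {p q : Pat d G R} (hp : p.IsAtom) (hq : q.IsAtom)
    {i j : Fin (d + 3)} (hij : i ≠ j) (h : Agree {i}ᶜ p q) (hpij : p.eq i j) (hqij : q.eq i j) :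
    p = q :=
  ((h.insert hp hq (Ne.symm hij) hpij hqij).mono fun a _ => Classical.em (a = i)).eq

end Pat

namespace Net

variable {d : ℕ} {G R : Type u} [Rainbow G R] {X : Type v}

/-- The pattern of a sequence. -/
def pat (N : Net d G R X) (s : Fin (d + 3) → X) : Pat d G R where
  eq a b := s a = s b
  col h a b := N.col (s ∘ h) (s a) (s b)

theorem proper_pat_iff (N : Net d G R X) (s : Fin (d + 3) → X) (h a b) :
    (N.pat s).IsProper h a b ↔ Proper (s ∘ h) (s a) (s b) := by
  constructor
  · rintro ⟨h1, h2, h3, h4⟩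
    exact ⟨fun k l => h1 k l, by rintro ⟨k, hk⟩; exact h2 k hk, by rintro ⟨k, hk⟩; exact h3 k hk, h4⟩
  · rintro ⟨h1, h2, h3, h4⟩
    exact ⟨fun k l hkl => h1 hkl, fun k hk => h2 ⟨k, hk⟩, fun k hk => h3 ⟨k, hk⟩, h4⟩

theorem isAtom_pat (N : Net d G R X) (s : Fin (d + 3) → X) : (N.pat s).IsAtom where
  equiv := ⟨fun _ => rfl, fun h => Eq.symm h, fun h h' => Eq.trans h h'⟩
  congr h h' a a' b b' hh ha hb := by
    have h1 : s ∘ h = s ∘ h' := funext hh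
    have h2 : s a = s a' := ha
    have h3 : s b = s b' := hb
    change N.col _ _ _ = N.col _ _ _
    rw [h1, h2, h3]
  col_neutral h a b hab := N.col_neutral (by rwa [proper_pat_iff] at hab)
  col_conv h a b := N.col_conv _ _ _
  tri h a b c hab hac hbc := by
    rw [proper_pat_iff] at hab hac hbc
    exact N.tri hab hac hbc

theorem pat_agree (N : Net d G R X) {s t : Fin (d + 3) → X} {W : Set (Fin (d + 3))}
    (h : ∀ a ∈ W, s a = t a) : (N.pat s).Agree W (N.pat t) := by
  refine ⟨fun a ha b hb => ?_, fun g hg a ha b hb => ?_⟩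
  · change s a = s b ↔ t a = t b
    rw [h a ha, h b hb]
  · have : s ∘ g = t ∘ g := funext fun k => h _ (hg k)
    change N.col _ _ _ = N.col _ _ _
    rw [h a ha, h b hb, this]

theorem pat_agree_of_eqOff (N : Net d G R X) {s t : Fin (d + 3) → X} {i : Fin (d + 3)}
    (h : EqOff i s t) : (N.pat s).Agree {i}ᶜ (N.pat t) :=
  N.pat_agree fun a ha => h a ha

end Net

/-- The coordinates modulo the recorded equality carry the recorded colouring. So `Pat.IsAtom`
describes exactly the patterns of sequences, and facts about atoms can be proved by extending
structures. -/
theorem Pat.IsAtom.exists_net {d : ℕ} {G R : Type u} [Rainbow G R] {p : Pat d G R}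
    (hp : p.IsAtom) : ∃ (X : Type) (_ : Finite X) (N : Net d G R X) (s : Fin (d + 3) → X),
      N.pat s = p := by
  let S : Setoid (Fin (d + 3)) := ⟨p.eq, hp.equiv⟩
  have hout : ∀ a : Fin (d + 3), p.eq (Quotient.mk S a).out a := fun a =>
    Quotient.exact (Quotient.out_eq (Quotient.mk S a))
  have heq : ∀ x y : Quotient S, p.eq x.out y.out ↔ x = y := fun x y =>
    ⟨fun h => by rw [← Quotient.out_eq x, ← Quotient.out_eq y]; exact Quotient.sound h,
      fun h => h ▸ hp.equiv.refl _⟩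
  have hproper : ∀ (c : Fin d → Quotient S) (x y : Quotient S),
      p.IsProper (fun k => (c k).out) x.out y.out ↔ Proper c x y := by
    intro c x y
    simp only [Pat.IsProper, heq]
    constructor
    · rintro ⟨h1, h2, h3, h4⟩
      exact ⟨fun k l => h1 k l, by rintro ⟨k, hk⟩; exact h2 k hk,
        by rintro ⟨k, hk⟩; exact h3 k hk, h4⟩
    · rintro ⟨h1, h2, h3, h4⟩
      exact ⟨fun k l hkl => h1 hkl, fun k hk => h2 ⟨k, hk⟩, fun k hk => h3 ⟨k, hk⟩, h4⟩
  refine ⟨Quotient S, inferInstance,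
    ⟨fun c x y => p.col (fun k => (c k).out) x.out y.out, ?_, ?_, ?_⟩, Quotient.mk S, ?_⟩
  · intro c x y h; exact hp.col_neutral _ _ _ (by rwa [hproper])
  · intro c x y; exact hp.col_conv _ _ _
  · intro c x y z h1 h2 h3
    exact hp.tri _ _ _ _ ((hproper _ _ _).2 h1) ((hproper _ _ _).2 h2) ((hproper _ _ _).2 h3)
  · apply Pat.ext
    · funext a b
      exact propext ⟨fun h => Quotient.exact h, fun h => Quotient.sound h⟩
    · funext h a b
      exact hp.congr _ _ _ _ _ _ (fun k => hout _) (hout a) (hout b)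

/-! ### One-point extensions of coloured structures -/

section Extension

variable {d : ℕ} {G R : Type u} {X : Type v}

/-- The colouring of a graph with one new point. -/
def optCol (col : X → X → Color G R) (e : X → Color G R) : Option X → Option X → Color G R
  | some x, some y => col x y
  | some x, none => e x
  | none, some y => (e y).conv
  | none, none => neutral

theorem optCol_conv {col : X → X → Color G R} (hcol : ∀ x y, col y x = (col x y).conv)
    (e : X → Color G R) (x y : Option X) : optCol col e y x = (optCol col e x y).conv := by
  cases x <;> cases y <;> first | rfl | exact (conv_conv _).symm | exact hcol _ _

variable [Rainbow G R]

/-- The law for the colours `e x` of the edges from points `x` of `S` to a new point. -/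
def NewLaw (col : X → X → Color G R) (e : X → Color G R) (S : Set X) : Prop :=
  ∀ x ∈ S, ∀ y ∈ S, x ≠ y →
    VertexLaw (col x y) (e x) (e y) ∧ VertexLaw (e x) (e y) (col x y) ∧
      Coherent (col x y) (e y) (e x)

/-- The new point can be any of the three vertices. Its law as first vertex is the second clause of
`NewLaw`; the other two places give the first clause, up to the symmetry of the laws. -/
theorem optCol_tri {col : X → X → Color G R} {e : X → Color G R} {S : Set X}
    (htri : ∀ x ∈ S, ∀ y ∈ S, ∀ z ∈ S, x ≠ y → x ≠ z → y ≠ z →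
      Tri (col x y) (col x z) (col y z))
    (he : NewLaw col e S) {x y z : Option X} (hx : ∀ x' ∈ x, x' ∈ S) (hy : ∀ x' ∈ y, x' ∈ S)
    (hz : ∀ x' ∈ z, x' ∈ S) (hxy : x ≠ y) (hxz : x ≠ z) (hyz : y ≠ z) :
    Tri (optCol col e x y) (optCol col e x z) (optCol col e y z) := by
  rcases x with _ | x <;> rcases y with _ | y <;> rcases z with _ | z <;>
    first | exact absurd rfl hxy | exact absurd rfl hxz | exact absurd rfl hyz | skip
  · obtain ⟨h1, h2, h3⟩ := he y (hy y rfl) z (hz z rfl) fun h => hyz (h ▸ rfl)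
    exact ⟨h2.conv, h3.rotate'⟩
  · obtain ⟨h1, h2, h3⟩ := he x (hx x rfl) z (hz z rfl) fun h => hxz (h ▸ rfl)
    exact ⟨h1.symm, h3.rotate⟩
  · obtain ⟨h1, h2, h3⟩ := he x (hx x rfl) y (hy y rfl) fun h => hxy (h ▸ rfl)
    exact ⟨h1, h3⟩
  · exact htri x (hx x rfl) y (hy y rfl) z (hz z rfl) (fun h => hxy (h ▸ rfl))
      (fun h => hxz (h ▸ rfl)) fun h => hyz (h ▸ rfl)

/-- The condition on the colours `K` of the contexts containing a new point. -/
structure ContextLaw (K : (Fin d → Option X) → X → X → Color G R) : Prop where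
  conv : ∀ c x y, K c y x = (K c x y).conv
  tri : ∀ c x y z, Proper c (some x) (some y) → Proper c (some x) (some z) →
    Proper c (some y) (some z) → Tri (K c x y) (K c x z) (K c y z)

open Classical in
/-- The colouring of a one-point extension. -/
noncomputable def extCol (N : Net d G R X) (e : (Fin d → X) → X → Color G R)
    (K : (Fin d → Option X) → X → X → Color G R) (c : Fin d → Option X) (x y : Option X) :
    Color G R :=
  if Proper c x y then
    if h : ∃ c₀ : Fin d → X, c = some ∘ c₀ then optCol (N.col h.choose) (e h.choose) x y
    else match x, y with
      | some x, some y => K c x y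
      | _, _ => neutral
  else neutral

theorem extCol_of_not (N : Net d G R X) (e : (Fin d → X) → X → Color G R)
    (K : (Fin d → Option X) → X → X → Color G R) {c : Fin d → Option X} {x y : Option X}
    (h : ¬ Proper c x y) : extCol N e K c x y = neutral := by
  unfold extCol
  exact if_neg h

theorem extCol_old (N : Net d G R X) (e : (Fin d → X) → X → Color G R)
    (K : (Fin d → Option X) → X → X → Color G R) (c : Fin d → X) {x y : Option X}
    (h : Proper (some ∘ c) x y) :
    extCol N e K (some ∘ c) x y = optCol (N.col c) (e c) x y := by
  have h1 : ∃ c₀ : Fin d → X, (some ∘ c : Fin d → Option X) = some ∘ c₀ := ⟨c, rfl⟩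
  have h2 : h1.choose = c := by
    have := h1.choose_spec
    exact (funext fun k => Option.some_injective _ (congrFun this k)).symm
  unfold extCol
  rw [if_pos h, dif_pos h1, h2]

theorem extCol_new (N : Net d G R X) (e : (Fin d → X) → X → Color G R)
    (K : (Fin d → Option X) → X → X → Color G R) (c : Fin d → Option X) {x y : X}
    (h : Proper c (some x) (some y)) (hc : none ∈ Set.range c) :
    extCol N e K c (some x) (some y) = K c x y := by
  unfold extCol
  rw [if_pos h, dif_neg]
  rintro ⟨c₀, rfl⟩
  obtain ⟨k, hk⟩ := hc
  exact absurd hk (by simp)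

theorem exists_old_of_none_notMem {c : Fin d → Option X} (h : none ∉ Set.range c) :
    ∃ c₀ : Fin d → X, c = some ∘ c₀ := by
  have : ∀ k, ∃ x, c k = some x := fun k =>
    Option.ne_none_iff_exists'.1 fun hk => h ⟨k, hk⟩
  choose c₀ hc₀ using this
  exact ⟨c₀, funext hc₀⟩

/-- One-point extensions of coloured structures. -/
noncomputable def Net.extend (N : Net d G R X) (e : (Fin d → X) → X → Color G R)
    (K : (Fin d → Option X) → X → X → Color G R)
    (he : ∀ c, Function.Injective c → NewLaw (N.col c) (e c) (Set.range c)ᶜ)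
    (hK : ContextLaw K) : Net d G R (Option X) where
  col := extCol N e K
  col_neutral h := extCol_of_not N e K h
  col_conv c x y := by
    by_cases h : Proper c x y
    · by_cases hc : none ∈ Set.range c
      · rcases x with _ | x
        · exact absurd hc h.2.1
        rcases y with _ | y
        · exact absurd hc h.2.2.1
        rw [extCol_new N e K c h hc, extCol_new N e K c h.symm hc, hK.conv]
      · obtain ⟨c₀, rfl⟩ := exists_old_of_none_notMem hc
        rw [extCol_old N e K _ h, extCol_old N e K _ h.symm, optCol_conv (N.col_conv c₀)]
    · rw [extCol_of_not N e K h, extCol_of_not N e K fun h' => h h'.symm]; rfl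
  tri {c x y z} hxy hxz hyz := by
    by_cases hc : none ∈ Set.range c
    · rcases x with _ | x
      · exact absurd hc hxy.2.1
      rcases y with _ | y
      · exact absurd hc hyz.2.1
      rcases z with _ | z
      · exact absurd hc hyz.2.2.1
      rw [extCol_new N e K c hxy hc, extCol_new N e K c hxz hc, extCol_new N e K c hyz hc]
      exact hK.tri c x y z hxy hxz hyz
    · obtain ⟨c, rfl⟩ := exists_old_of_none_notMem hc
      rw [extCol_old N e K _ hxy, extCol_old N e K _ hxz, extCol_old N e K _ hyz]
      have hinj : Function.Injective c := (Function.Injective.of_comp_iff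
        (Option.some_injective X) c).1 hxy.1
      have hmem : ∀ o : Option X, o ∉ Set.range (some ∘ c) → ∀ x' ∈ o, x' ∈ (Set.range c)ᶜ := by
        rintro _ ho x' rfl ⟨k, rfl⟩
        exact ho ⟨k, rfl⟩
      refine optCol_tri ?_ (he c hinj) (hmem x hxy.2.1) (hmem y hxy.2.2.1) (hmem z hyz.2.2.1)
        hxy.2.2.2 hxz.2.2.2 hyz.2.2.2
      intro x hx y hy z hz hxy hxz hyz
      exact N.tri ⟨hinj, hx, hy, hxy⟩ ⟨hinj, hx, hz, hxz⟩ ⟨hinj, hy, hz, hyz⟩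

end Extension

/-! ### Realizing an atom over part of a sequence -/

section Request

variable {d : ℕ} {G R : Type u} [Rainbow G R] {X : Type v}

/-- The coordinates in `W` of the sequence `t` realize the equalities of the atom `q`. -/
theorem Pat.IsAtom.exists_transfer {q : Pat d G R} (hq : q.IsAtom) {Y : Type v}
    (t : Fin (d + 3) → Y) (W : Set (Fin (d + 3)))
    (ht : ∀ a ∈ W, ∀ b ∈ W, (q.eq a b ↔ t a = t b)) :
    ∃ K : (Fin d → Y) → Y → Y → Color G R,
      (∀ h a b, (∀ k, h k ∈ W) → a ∈ W → b ∈ W → K (t ∘ h) (t a) (t b) = q.col h a b) ∧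
      (∀ c x y, K c x y ≠ neutral → (∃ h : Fin d → Fin (d + 3), (∀ k, h k ∈ W) ∧ c = t ∘ h) ∧
        (∃ a ∈ W, x = t a) ∧ ∃ b ∈ W, y = t b) ∧
      (∀ c x y, K c y x = (K c x y).conv) ∧
      ∀ c x y z, Proper c x y → Proper c x z → Proper c y z →
        Tri (K c x y) (K c x z) (K c y z) := by
  classical
  -- The colour is read off from any coordinates in `W` naming `c`, `x`, `y`; as `q` respects its
  -- equality, the names chosen do not matter. What has no name becomes neutral.
  let K : (Fin d → Y) → Y → Y → Color G R := fun c x y =>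
    if H : ∃ v, ∃ h a b, (∀ k, h k ∈ W) ∧ a ∈ W ∧ b ∈ W ∧ c = t ∘ h ∧ x = t a ∧ y = t b ∧
      v = q.col h a b then H.choose else neutral
  have hK1 : ∀ h a b, (∀ k, h k ∈ W) → a ∈ W → b ∈ W → K (t ∘ h) (t a) (t b) = q.col h a b := by
    intro h a b hh ha hb
    have H : ∃ v, ∃ h' a' b', (∀ k, h' k ∈ W) ∧ a' ∈ W ∧ b' ∈ W ∧ t ∘ h = t ∘ h' ∧ t a = t a' ∧
      t b = t b' ∧ v = q.col h' a' b' := ⟨_, h, a, b, hh, ha, hb, rfl, rfl, rfl, rfl⟩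
    obtain ⟨h', a', b', hh', ha', hb', e1, e2, e3, e4⟩ := H.choose_spec
    simp only [K]
    rw [dif_pos H, e4]
    exact hq.congr _ _ _ _ _ _ (fun k => (ht _ (hh' k) _ (hh k)).2 (congrFun e1 k).symm)
      ((ht _ ha' _ ha).2 e2.symm) ((ht _ hb' _ hb).2 e3.symm)
  have hK2 : ∀ c x y, K c x y ≠ neutral →
      (∃ h : Fin d → Fin (d + 3), (∀ k, h k ∈ W) ∧ c = t ∘ h) ∧
        (∃ a ∈ W, x = t a) ∧ ∃ b ∈ W, y = t b := by
    intro c x y hne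
    by_cases H : ∃ v, ∃ h a b, (∀ k, h k ∈ W) ∧ a ∈ W ∧ b ∈ W ∧ c = t ∘ h ∧ x = t a ∧ y = t b ∧
      v = q.col h a b
    · obtain ⟨v, h, a, b, hh, ha, hb, e1, e2, e3, -⟩ := H
      exact ⟨⟨h, hh, e1⟩, ⟨a, ha, e2⟩, b, hb, e3⟩
    · exact absurd (dif_neg H) hne
  refine ⟨K, hK1, hK2, ?_, ?_⟩
  · intro c x y
    by_cases H : (∃ h : Fin d → Fin (d + 3), (∀ k, h k ∈ W) ∧ c = t ∘ h) ∧
        (∃ a ∈ W, x = t a) ∧ ∃ b ∈ W, y = t b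
    · obtain ⟨⟨h, hh, rfl⟩, ⟨a, ha, rfl⟩, b, hb, rfl⟩ := H
      rw [hK1 h a b hh ha hb, hK1 h b a hh hb ha, hq.col_conv]
    · have h1 : K c x y = neutral := by
        by_contra h; exact H (hK2 _ _ _ h)
      have h2 : K c y x = neutral := by
        by_contra h; exact H ⟨(hK2 _ _ _ h).1, (hK2 _ _ _ h).2.2, (hK2 _ _ _ h).2.1⟩
      rw [h1, h2]; rfl
  · intro c x y z hxy hxz hyz
    have hn : ∀ x y, ¬ ((∃ h : Fin d → Fin (d + 3), (∀ k, h k ∈ W) ∧ c = t ∘ h) ∧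
        (∃ a ∈ W, x = t a) ∧ ∃ b ∈ W, y = t b) → K c x y = neutral := by
      intro x y H
      by_contra h; exact H (hK2 _ _ _ h)
    by_cases hx : ∃ a ∈ W, x = t a
    swap
    · rw [hn x y fun H => hx H.2.1, hn x z fun H => hx H.2.1]; exact tri_neutral_left _
    by_cases hy : ∃ a ∈ W, y = t a
    swap
    · rw [hn x y fun H => hy H.2.2, hn y z fun H => hy H.2.1]; exact tri_neutral_right _
    by_cases hz : ∃ a ∈ W, z = t a
    swap
    · rw [hn x z fun H => hz H.2.2, hn y z fun H => hz H.2.2]; exact tri_neutral_mid _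
    by_cases hc : ∃ h : Fin d → Fin (d + 3), (∀ k, h k ∈ W) ∧ c = t ∘ h
    swap
    · rw [hn x y fun H => hc H.1, hn x z fun H => hc H.1]; exact tri_neutral_left _
    obtain ⟨h, hh, rfl⟩ := hc
    obtain ⟨a, ha, rfl⟩ := hx
    obtain ⟨b, hb, rfl⟩ := hy
    obtain ⟨e, he, rfl⟩ := hz
    have hp : ∀ a b, a ∈ W → b ∈ W → Proper (t ∘ h) (t a) (t b) → q.IsProper h a b := by
      rintro a b ha hb ⟨h1, h2, h3, h4⟩
      refine ⟨fun k l hkl => h1 ((ht _ (hh k) _ (hh l)).1 hkl), fun k hk => ?_, fun k hk => ?_,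
        fun hk => h4 ((ht _ ha _ hb).1 hk)⟩
      · exact h2 ⟨k, (ht _ (hh k) _ ha).1 hk⟩
      · exact h3 ⟨k, (ht _ (hh k) _ hb).1 hk⟩
    rw [hK1 h a b hh ha hb, hK1 h a e hh ha he, hK1 h b e hh hb he]
    exact hq.tri h a b e (hp _ _ ha hb hxy) (hp _ _ ha he hxz) (hp _ _ hb he hyz)

open Classical in
/-- One-point extensions realizing a given atom over part of a sequence, for given colours `e` of
the new edges. -/
theorem Net.exists_extend (N : Net d G R X) (s : Fin (d + 3) → X) {i : Fin (d + 3)}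
    {W : Set (Fin (d + 3))} (hi : i ∉ W) {q : Pat d G R} (hq : q.IsAtom)
    (hag : q.Agree W (N.pat s)) (hfresh : ∀ j ∈ W, ¬ q.eq i j)
    (e : (Fin d → X) → X → Color G R)
    (he : ∀ c, Function.Injective c → NewLaw (N.col c) (e c) (Set.range c)ᶜ)
    (hes : ∀ h : Fin d → Fin (d + 3), (∀ k, h k ∈ W) → Function.Injective (s ∘ h) → ∀ a ∈ W,
      s a ∉ Set.range (s ∘ h) → e (s ∘ h) (s a) = q.col h a i) :
    ∃ N' : Net d G R (Option X),
      (∀ c x y, N'.col (some ∘ c) (some x) (some y) = N.col c x y) ∧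
      (∀ c x, Function.Injective c → x ∉ Set.range c →
        N'.col (some ∘ c) (some x) none = e c x) ∧
      q.Agree (insert i W) (N'.pat (Function.update (some ∘ s) i none)) ∧
      ∀ c x y, none ∈ Set.range c → N'.col c x y ≠ neutral →
        (∃ h : Fin d → Fin (d + 3), c = Function.update (some ∘ s) i none ∘ h) ∧
        (∃ a, x = Function.update (some ∘ s) i none a) ∧
        ∃ b, y = Function.update (some ∘ s) i none b := by
  set t := Function.update (some ∘ s) i none with ht
  have hti : t i = none := by simp [ht]
  have htW : ∀ a ∈ W, t a = some (s a) := fun a ha => by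
    rw [ht, Function.update_of_ne (ne_of_mem_of_not_mem ha hi)]; rfl
  have heq : ∀ a ∈ insert i W, ∀ b ∈ insert i W, (q.eq a b ↔ t a = t b) := by
    rintro a (rfl | ha) b (rfl | hb)
    · exact ⟨fun _ => rfl, fun _ => hq.equiv.refl _⟩
    · rw [hti, htW b hb]
      exact ⟨fun h => absurd h (hfresh b hb), fun h => by simp at h⟩
    · rw [hti, htW a ha]
      exact ⟨fun h => absurd (hq.equiv.symm h) (hfresh a ha), fun h => by simp at h⟩
    · rw [htW a ha, htW b hb, Option.some_inj]; exact hag.1 a ha b hb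
  -- In contexts that contain the new point only the colours prescribed by `q` are used. All other
  -- edges there are neutral, which is the last claim of the theorem.
  obtain ⟨K, hK1, hK2, hK3, hK4⟩ := hq.exists_transfer t (insert i W) heq
  have hKlaw : ContextLaw (fun (c : Fin d → Option X) x y => K c (some x) (some y)) :=
    ⟨fun c x y => hK3 c _ _, fun c x y z => hK4 c _ _ _⟩
  have hold : ∀ c x y, Proper c x y → (N.extend e _ he hKlaw).col (some ∘ c) (some x) (some y) =
      N.col c x y := by
    intro c x y h
    exact extCol_old N e (fun (c : Fin d → Option X) x y => K c (some x) (some y)) c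
      ((proper_comp_iff (Option.some_injective X)).2 h)
  have hnew : ∀ c x, Function.Injective c → x ∉ Set.range c →
      (N.extend e _ he hKlaw).col (some ∘ c) (some x) none = e c x := by
    intro c x hc hx
    refine extCol_old N e (fun (c : Fin d → Option X) x y => K c (some x) (some y)) c
      ⟨(Option.some_injective X).comp hc, ?_, ?_, by simp⟩
    · rintro ⟨k, hk⟩; exact hx ⟨k, Option.some_injective X hk⟩
    · rintro ⟨k, hk⟩; exact absurd hk (by simp)
  refine ⟨N.extend e _ he hKlaw, ?_, hnew, ⟨heq, ?_⟩, ?_⟩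
  · intro c x y
    by_cases h : Proper c x y
    · exact hold c x y h
    · rw [N.col_neutral h, Net.col_neutral]
      rwa [proper_comp_iff (Option.some_injective X)]
  · intro h hh a ha b hb
    have hpiff : q.IsProper h a b ↔ Proper (t ∘ h) (t a) (t b) := by
      rw [← Net.proper_pat_iff (N.extend e _ he hKlaw) t h a b]
      simp only [Pat.IsProper, heq _ (hh _) _ (hh _), heq _ (hh _) _ ha, heq _ (hh _) _ hb,
        heq _ ha _ hb]
      rfl
    by_cases hp : Proper (t ∘ h) (t a) (t b)
    swap
    · change _ = (N.extend e _ he hKlaw).col _ _ _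
      rw [Net.col_neutral _ hp, hq.col_neutral _ _ _ fun h => hp (hpiff.1 h)]
    change _ = (N.extend e _ he hKlaw).col _ _ _
    by_cases hn : none ∈ Set.range (t ∘ h)
    · have h1 : ∃ x, t a = some x := Option.ne_none_iff_exists'.1 fun h => hp.2.1 (h ▸ hn)
      have h2 : ∃ x, t b = some x := Option.ne_none_iff_exists'.1 fun h => hp.2.2.1 (h ▸ hn)
      obtain ⟨x, hx⟩ := h1
      obtain ⟨y, hy⟩ := h2
      have := extCol_new N e (fun c x y => K c (some x) (some y)) (t ∘ h) (x := x) (y := y)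
        (by rw [← hx, ← hy]; exact hp) hn
      rw [hx, hy]
      refine Eq.trans ?_ this.symm
      rw [← hx, ← hy, hK1 h a b hh ha hb]
    · have hhW : ∀ k, h k ∈ W := by
        intro k
        rcases hh k with hk | hk
        · exact absurd ⟨k, by change t (h k) = none; rw [hk, hti]⟩ hn
        · exact hk
      have hth : t ∘ h = some ∘ (s ∘ h) := funext fun k => htW _ (hhW k)
      rw [hth] at hp ⊢
      have hinj : Function.Injective (s ∘ h) :=
        (Function.Injective.of_comp_iff (Option.some_injective X) _).1 hp.1
      have hmem : ∀ a ∈ W, t a ∉ Set.range (some ∘ (s ∘ h)) → s a ∉ Set.range (s ∘ h) := by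
        rintro a ha h1 ⟨k, hk⟩
        exact h1 ⟨k, by rw [htW a ha, ← hk]; rfl⟩
      rcases ha with rfl | ha
      · rcases hb with rfl | hb
        · exact absurd rfl hp.2.2.2
        · rw [Net.col_conv, hti, htW b hb, hnew _ _ hinj (hmem b hb hp.2.2.1),
            hes h hhW hinj b hb (hmem b hb hp.2.2.1), ← hq.col_conv]
      · rcases hb with rfl | hb
        · rw [hti, htW a ha, hnew _ _ hinj (hmem a ha hp.2.1),
            hes h hhW hinj a ha (hmem a ha hp.2.1)]
        · rw [htW a ha, htW b hb] at hp ⊢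
          rw [hold _ _ _ ((proper_comp_iff (Option.some_injective X)).1 hp)]
          exact hag.2 h hhW a ha b hb
  · intro c x y hc hne
    have hp : Proper c x y := by
      by_contra h
      exact hne (Net.col_neutral _ h)
    rcases x with _ | x
    · exact absurd hc hp.2.1
    rcases y with _ | y
    · exact absurd hc hp.2.2.1
    have h1 : (N.extend e _ he hKlaw).col c (some x) (some y) = K c (some x) (some y) :=
      
      extCol_new N e (fun (c : Fin d → Option X) x y => K c (some x) (some y)) c hp hc
    rw [h1] at hne
    obtain ⟨⟨h, -, h2⟩, ⟨a, -, h3⟩, b, -, h4⟩ := hK2 _ _ _ hne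
    exact ⟨⟨h, h2⟩, ⟨a, h3⟩, b, h4⟩

/-- An injective context uses up `d` of the `d + 3` coordinates. This count is why an atom never
prescribes more than a triangle in a context. -/
theorem not_four_outside {h : Fin d → Fin (d + 3)} (hh : Function.Injective h)
    {g : Fin 4 → Fin (d + 3)} (hg : Function.Injective g) (hhg : ∀ k l, h k ≠ g l) : False := by
  have : Function.Injective (Sum.elim h g) := hh.sumElim hg hhg
  have := Fintype.card_le_of_injective _ this
  simp at this

theorem injective_vec_four {Y : Type*} {a b c e : Y} (hab : a ≠ b) (hac : a ≠ c) (hae : a ≠ e)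
    (hbc : b ≠ c) (hbe : b ≠ e) (hce : c ≠ e) : Function.Injective ![a, b, c, e] := by
  intro x y hxy
  fin_cases x <;> fin_cases y <;> simp_all

/-- The colours prescribed by an atom for the edges to a new point. -/
theorem Pat.IsAtom.exists_prescribed {q : Pat d G R} (hq : q.IsAtom) {W : Set (Fin (d + 3))}
    {N : Net d G R X} {s : Fin (d + 3) → X} (hag : q.Agree W (N.pat s)) (i : Fin (d + 3)) :
    ∃ g : (Fin d → X) → X → Color G R, ∀ h : Fin d → Fin (d + 3), (∀ k, h k ∈ W) → ∀ a ∈ W,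
      g (s ∘ h) (s a) = q.col h a i := by
  classical
  refine ⟨fun c x => if H : ∃ v, ∃ h a, (∀ k, h k ∈ W) ∧ a ∈ W ∧ c = s ∘ h ∧ x = s a ∧
    v = q.col h a i then H.choose else neutral, ?_⟩
  intro h hh a ha
  have H : ∃ v, ∃ h' a', (∀ k, h' k ∈ W) ∧ a' ∈ W ∧ s ∘ h = s ∘ h' ∧ s a = s a' ∧
    v = q.col h' a' i := ⟨_, h, a, hh, ha, rfl, rfl, rfl⟩
  obtain ⟨h', a', hh', ha', e1, e2, e3⟩ := H.choose_spec
  simp only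
  rw [dif_pos H, e3]
  exact hq.congr _ _ _ _ _ _ (fun k => (hag.1 _ (hh' k) _ (hh k)).2 (congrFun e1 k).symm)
    ((hag.1 _ ha' _ ha).2 e2.symm) (hq.equiv.refl i)

/-- A white colour that completes a triangle, given the colours at the opposite vertex. -/
def fitWhite : Color G R → Color G R → Color G R
  | tint _, tint _ => white true none
  | _, _ => neutral

theorem vertexLaw_fitWhite (a c : Color G R) : VertexLaw a c (fitWhite a c) := by
  cases a <;> cases c <;> first | trivial | rfl | exact fun p hp => absurd hp (by simp)

omit [Rainbow G R] in
theorem exists_fitWhite (a c : Color G R) : ∃ i, fitWhite a c = white i none := by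
  cases a <;> cases c <;> exact ⟨_, rfl⟩

/-- A new edge to a single point can be completed by white edges. -/
theorem exists_newLaw_single (col : X → X → Color G R) (A : X) (g : Color G R) (S : Set X) :
    ∃ e : X → Color G R, e A = g ∧ NewLaw col e S := by
  classical
  refine ⟨fun x => if x = A then g else fitWhite (col A x) g, by simp, ?_⟩
  intro x _ y _ hxy
  by_cases hx : x = A
  · subst hx
    obtain ⟨i, hi⟩ := exists_fitWhite (col x y) g
    simp only [if_true, if_neg hxy.symm]
    have h1 := vertexLaw_fitWhite (col x y) g
    rw [hi] at h1 ⊢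
    refine ⟨h1, ?_, ?_⟩
    · cases g <;> trivial
    · cases col x y <;> cases g <;> trivial
  · by_cases hy : y = A
    · subst hy
      obtain ⟨i, hi⟩ := exists_fitWhite (col y x) g
      simp only [if_true, if_neg hxy]
      rw [hi]
      refine ⟨?_, ?_, ?_⟩
      · cases col x y <;> trivial
      · cases g <;> trivial
      · cases col x y <;> cases g <;> trivial
    · obtain ⟨i, hi⟩ := exists_fitWhite (col A x) g
      obtain ⟨j, hj⟩ := exists_fitWhite (col A y) g
      simp only [if_neg hx, if_neg hy]
      rw [hi, hj]
      refine ⟨?_, trivial, ?_⟩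
      · cases col x y <;> trivial
      · cases col x y <;> trivial

/-- Amalgamation of atoms: changing two coordinates can be done in either order. -/
theorem Pat.IsAtom.exists_agree {p q r : Pat d G R} (hp : p.IsAtom) (hr : r.IsAtom)
    {i j : Fin (d + 3)} (hpq : Agree {i}ᶜ p q) (hqr : Agree {j}ᶜ q r) :
    ∃ q' : Pat d G R, q'.IsAtom ∧ Agree {j}ᶜ p q' ∧ Agree {i}ᶜ q' r := by
  classical
  by_cases hij : i = j
  · subst hij; exact ⟨p, hp, Agree.refl _ _, hpq.trans hqr⟩
  -- The atom `q'` is obtained from a sequence `s` with pattern `p` by replacing its `j`-th point by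
  -- one that is placed over the coordinates other than `i`, `j` as `r` demands.
  obtain ⟨X, -, N, s, rfl⟩ := hp.exists_net
  set W : Set (Fin (d + 3)) := {i, j}ᶜ with hW
  have hWi : W ⊆ {i}ᶜ := Set.compl_subset_compl.2 (by simp)
  have hWj : W ⊆ {j}ᶜ := Set.compl_subset_compl.2 (by simp)
  have hins : ({i}ᶜ : Set (Fin (d + 3))) ⊆ insert j W := by
    intro a ha
    by_cases haj : a = j
    · exact Or.inl haj
    · refine Or.inr ?_
      rintro (h | h)
      · exact ha h
      · exact haj h
  have hag : r.Agree W (N.pat s) := ((hpq.mono hWi).trans (hqr.mono hWj)).symm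
  have hjW : j ∉ W := fun h => h (by simp)
  by_cases hfresh : ∃ k ∈ W, r.eq j k
  · obtain ⟨k, hk, hjk⟩ := hfresh
    refine ⟨N.pat (Function.update s j (s k)), N.isAtom_pat _,
      N.pat_agree_of_eqOff (eqOff_update j s _).symm, ?_⟩
    have h1 : (N.pat (Function.update s j (s k))).Agree W r :=
      ((N.pat_agree_of_eqOff (eqOff_update j s (s k))).mono hWj).trans hag.symm
    refine (h1.insert (N.isAtom_pat _) hr hk ?_ hjk).mono hins
    change Function.update s j (s k) j = Function.update s j (s k) k
    rw [Function.update_self, Function.update_of_ne (ne_of_mem_of_not_mem hk hjW)]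
  · push Not at hfresh
    obtain ⟨g, hg⟩ := hr.exists_prescribed hag j
    -- The coordinates `i` and `j` lie outside every context taken from `W`, so at most one further
    -- point of the sequence does. Each context thus prescribes at most one edge to the new point,
    -- and white edges complete it.
    have he : ∀ c : Fin d → X, ∃ e : X → Color G R, NewLaw (N.col c) e (Set.range c)ᶜ ∧
        (Function.Injective c → ∀ h : Fin d → Fin (d + 3), (∀ k, h k ∈ W) → c = s ∘ h → ∀ a ∈ W,
          s a ∉ Set.range c → e (s a) = r.col h a j) := by
      intro c
      by_cases H : ∃ h : Fin d → Fin (d + 3), (∀ k, h k ∈ W) ∧ c = s ∘ h ∧ ∃ a ∈ W,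
          s a ∉ Set.range c
      · obtain ⟨h, hh, rfl, a, ha, hac⟩ := H
        obtain ⟨e, he1, he2⟩ := exists_newLaw_single (N.col (s ∘ h)) (s a) (r.col h a j)
          (Set.range (s ∘ h))ᶜ
        refine ⟨e, he2, fun hinj h' hh' hc a' ha' hac' => ?_⟩
        have hsa : s a' = s a := by
          by_contra hne
          refine not_four_outside (hinj.of_comp) (g := ![a, a', i, j])
            (injective_vec_four (fun h => hne (h ▸ rfl)) (ne_of_mem_of_not_mem ha (by simp [hW]))
              (ne_of_mem_of_not_mem ha hjW) (ne_of_mem_of_not_mem ha' (by simp [hW]))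
              (ne_of_mem_of_not_mem ha' hjW) hij) ?_
          intro k l
          fin_cases l
          · rintro rfl; exact hac ⟨k, rfl⟩
          · rintro rfl; exact hac' ⟨k, rfl⟩
          · exact ne_of_mem_of_not_mem (hh k) (by simp [hW])
          · exact ne_of_mem_of_not_mem (hh k) hjW
        rw [hsa, he1, ← hg h hh a ha, ← hg h' hh' a' ha', ← hc, hsa]
      · refine ⟨fun _ => neutral, ?_, fun _ h hh hc a ha hac => (H ⟨h, hh, hc, a, ha, hac⟩).elim⟩
        intro x _ y _ _
        refine ⟨?_, trivial, ?_⟩ <;> cases N.col c x y <;> trivial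
    choose e he1 he2 using he
    obtain ⟨N', h1, -, h3, -⟩ := N.exists_extend s hjW hr hag hfresh e (fun c _ => he1 c)
      (fun h hh hinj a ha hac => he2 _ hinj h hh rfl a ha hac)
    refine ⟨_, N'.isAtom_pat _, ?_, (h3.mono hins).symm⟩
    have h4 : N.pat s = N'.pat (some ∘ s) := by
      apply Pat.ext
      · funext a b; exact propext (Option.some_injective X).eq_iff.symm
      · funext h a b; exact (h1 _ _ _).symm
    rw [h4]
    exact N'.pat_agree_of_eqOff (eqOff_update j _ _).symm

end Request

/-! ### The complex algebra of the atoms -/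

section ComplexAlgebra

variable {d : ℕ} {G R : Type u} [Rainbow G R]

/-- The type of atoms. -/
abbrev Atoms (d : ℕ) (G R : Type u) [Rainbow G R] : Type u := {p : Pat d G R // p.IsAtom}

theorem Pat.IsAtom.exists_duplicate {p : Pat d G R} (hp : p.IsAtom) (i k : Fin (d + 3)) :
    ∃ q : Pat d G R, q.IsAtom ∧ p.Agree {k}ᶜ q ∧ q.eq i k := by
  classical
  obtain ⟨X, -, N, s, rfl⟩ := hp.exists_net
  refine ⟨N.pat (Function.update s k (s i)), N.isAtom_pat _,
    N.pat_agree_of_eqOff (eqOff_update k s _).symm, ?_⟩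
  change Function.update s k (s i) i = Function.update s k (s i) k
  by_cases h : i = k
  · subst h; rfl
  · rw [Function.update_of_ne h, Function.update_self]

/-- The full complex algebra of the atoms. -/
instance complexAlgebra : CylindricAlgebra (Fin (d + 3)) (Set (Atoms d G R)) where
  cyl i x := {p | ∃ q ∈ x, q.1.Agree {i}ᶜ p.1}
  diag i j := {p | p.1.eq i j}
  cyl_bot i := by
    ext p
    exact ⟨fun ⟨q, hq, _⟩ => hq, fun h => h.elim⟩
  le_cyl i x := fun p hp => ⟨p, hp, Pat.Agree.refl _ _⟩
  cyl_inf_cyl i x y := by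
    ext p
    constructor
    · rintro ⟨q, ⟨hq, r, hr, hrq⟩, hqp⟩
      exact ⟨⟨q, hq, hqp⟩, r, hr, hrq.trans hqp⟩
    · rintro ⟨⟨q, hq, hqp⟩, r, hr, hrp⟩
      exact ⟨q, ⟨hq, r, hr, hrp.trans hqp.symm⟩, hqp⟩
  cyl_comm i j x := by
    have key : ∀ i j, {p : Atoms d G R | ∃ q : Atoms d G R, (∃ r ∈ x, r.1.Agree {j}ᶜ q.1) ∧
        q.1.Agree {i}ᶜ p.1} ⊆ {p | ∃ q : Atoms d G R, (∃ r ∈ x, r.1.Agree {i}ᶜ q.1) ∧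
        q.1.Agree {j}ᶜ p.1} := by
      rintro i j p ⟨q, ⟨r, hr, hrq⟩, hqp⟩
      obtain ⟨q', hq', h1, h2⟩ := r.2.exists_agree p.2 hrq hqp
      exact ⟨⟨q', hq'⟩, ⟨r, hr, h1⟩, h2⟩
    exact Set.Subset.antisymm (key i j) (key j i)
  diag_self i := by
    ext p
    exact ⟨fun _ => trivial, fun _ => p.2.equiv.refl i⟩
  diag_eq i j k hi hj := by
    ext p
    constructor
    · intro h
      obtain ⟨q, hq, h1, h2⟩ := p.2.exists_duplicate i k
      refine ⟨⟨q, hq⟩, ⟨h2, ?_⟩, h1.symm⟩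
      exact hq.equiv.trans (hq.equiv.symm h2) ((h1.1 i hi.symm j hj.symm).1 h)
    · rintro ⟨q, ⟨h1, h2⟩, h3⟩
      exact (h3.1 i hi.symm j hj.symm).1 (q.2.equiv.trans h1 h2)
  cyl_diag i j x hij := by
    ext p
    constructor
    · rintro ⟨⟨q, ⟨h1, h2⟩, h3⟩, r, ⟨h4, h5⟩, h6⟩
      exact h5 ((Subtype.ext (q.2.eq_of_agree r.2 hij (h3.trans h6.symm) h1 h4) : q = r) ▸ h2)
    · intro h; exact h.elim

end ComplexAlgebra

/-! ### Atoms in complete square representations -/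

namespace RelRep

section AtomRep

variable {d : ℕ} {G R : Type u} [Rainbow G R] {M : Type v}
  (S : RelRep (d + 3) (Set (Atoms d G R)) M)

/-- The complements of the singletons have infimum `∅`, so by completeness no tuple of the unit
avoids all the sets `S.f {p}`. -/
theorem exists_atom_of_isComplete (hS : S.IsComplete) {s : Fin (d + 3) → M} (hs : s ∈ S.V) :
    ∃ p, s ∈ S.f {p} := by
  have hglb : IsGLB (Set.range fun p : Atoms d G R => ({p} : Set (Atoms d G R))ᶜ) ∅ := by
    refine ⟨fun _ _ => Set.empty_subset _, fun b hb p hp => ?_⟩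
    exact hb ⟨p, rfl⟩ hp rfl
  have h := hS _ _ hglb
  by_contra hcon
  push Not at hcon
  have : s ∈ S.f ∅ := by
    rw [h]
    refine ⟨hs, ?_⟩
    rintro _ ⟨p, rfl⟩
    simp only
    rw [S.map_compl]
    exact ⟨hs, hcon p⟩
  have hb : S.f ∅ = ∅ := S.map_bot
  rw [hb] at this
  exact this

theorem mem_of_mem_atom {s : Fin (d + 3) → M} {p : Atoms d G R} (hp : s ∈ S.f {p})
    {a : Set (Atoms d G R)} (ha : s ∈ S.f a) : p ∈ a := by
  by_contra hpa
  have h1 : ({p} : Set (Atoms d G R)) ⊓ a = ⊥ := by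
    ext q
    constructor
    · rintro ⟨rfl, h⟩; exact hpa h
    · intro h; exact h.elim
  have h2 : s ∈ S.f (({p} : Set (Atoms d G R)) ⊓ a) := by rw [S.map_inf]; exact ⟨hp, ha⟩
  rw [h1, S.map_bot] at h2
  exact h2

theorem atom_unique {s : Fin (d + 3) → M} {p q : Atoms d G R} (hp : s ∈ S.f {p})
    (hq : s ∈ S.f {q}) : p = q := S.mem_of_mem_atom hp hq

theorem f_mono {a b : Set (Atoms d G R)} (h : a ⊆ b) : S.f a ⊆ S.f b := by
  have : a ⊔ b = b := sup_eq_right.2 h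
  rw [← this, S.map_sup]
  exact Set.subset_union_left

theorem atom_agree {s t : Fin (d + 3) → M} {p q : Atoms d G R} (hp : s ∈ S.f {p})
    (hq : t ∈ S.f {q}) {i : Fin (d + 3)} (h : EqOff i s t) : p.1.Agree {i}ᶜ q.1 := by
  obtain ⟨q', rfl, hq'⟩ := S.mem_of_mem_atom hp (S.mem_cyl i (S.subset_V _ hp) hq h.symm)
  exact hq'.symm

theorem atom_eq_iff {s : Fin (d + 3) → M} {p : Atoms d G R} (hp : s ∈ S.f {p})
    (i j : Fin (d + 3)) : p.1.eq i j ↔ s i = s j := by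
  constructor
  · intro h
    have : s ∈ S.f (diag i j) := S.f_mono (by rintro _ rfl; exact h) hp
    rw [S.map_diag] at this
    exact this.2
  · intro h
    refine S.mem_of_mem_atom hp (a := diag i j) ?_
    rw [S.map_diag]
    exact ⟨S.subset_V _ hp, h⟩

theorem IsSquare.exists_extend {κ : Type w} (hS : S.IsSquare κ) {s : κ → M}
    (hs : s ∈ S.cliqueSeqs κ) {l : Fin (d + 3) → κ} (hl : Function.Injective l)
    {p q : Atoms d G R} (hp : (fun k => s (l k)) ∈ S.f {p}) {i : Fin (d + 3)}
    (hpq : p.1.Agree {i}ᶜ q.1) :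
    ∃ t ∈ S.cliqueSeqs κ, EqOff (l i) t s ∧ (fun k => t (l k)) ∈ S.f {q} := by
  refine hS s hs {q} i l hl (S.f_mono ?_ hp)
  rintro _ rfl
  exact ⟨q, rfl, hpq.symm⟩

/-- In a complete square representation of the full complex algebra all atoms are realized. -/
theorem IsSquare.exists_realize {κ : Type w} (hS : S.IsSquare κ) (hC : S.IsComplete)
    {l : Fin (d + 3) → κ} (hl : Function.Injective l) (q : Atoms d G R) :
    ∃ s ∈ S.cliqueSeqs κ, (fun k => s (l k)) ∈ S.f {q} := by
  obtain ⟨q, hq⟩ := q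
  obtain ⟨X, -, N, r, rfl⟩ := hq.exists_net
  -- The pattern of a constant sequence is realized by any constant sequence. From there the entries
  -- of `r` are put in one at a time, each change being a move along one coordinate.
  have key : ∀ F : Finset (Fin (d + 3)), ∃ s ∈ S.cliqueSeqs κ, (fun k => s (l k)) ∈
      S.f {(⟨N.pat fun i => if i ∈ F then r i else r 0, N.isAtom_pat _⟩ : Atoms d G R)} := by
    intro F
    induction F using Finset.induction_on with
    | empty =>
      obtain ⟨x⟩ := S.base_nonempty
      refine ⟨fun _ => x, S.const_mem_cliqueSeqs κ x, ?_⟩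
      obtain ⟨p, hp⟩ := S.exists_atom_of_isComplete hC
        (S.comp_mem_V (S.const_mem_cliqueSeqs κ x) l)
      have heq : ∀ i j, p.1.eq i j := fun i j => (S.atom_eq_iff hp i j).2 rfl
      have : p = ⟨N.pat fun i => if i ∈ (∅ : Finset (Fin (d + 3))) then r i else r 0,
          N.isAtom_pat _⟩ := by
        apply Subtype.ext
        apply Pat.ext
        · funext a b
          exact propext ⟨fun _ => rfl, fun _ => heq a b⟩
        · funext h a b
          rw [p.2.col_neutral _ _ _ fun H => H.2.2.2 (heq a b)]
          exact (N.col_neutral fun H => H.2.2.2 rfl).symm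
      rw [← this]; exact hp
    | insert i F hi ih =>
      obtain ⟨s, hs, hsp⟩ := ih
      obtain ⟨t, ht, -, htq⟩ := IsSquare.exists_extend S hS hs hl hsp (i := i)
        (q := ⟨N.pat fun j => if j ∈ insert i F then r j else r 0, N.isAtom_pat _⟩)
        (N.pat_agree fun a ha => by
          have : a ≠ i := ha
          simp [Finset.mem_insert, this])
      exact ⟨t, ht, htq⟩
  simpa using key Finset.univ

end AtomRep

end RelRep

/-! ### Cones and the infinite descent -/

section Cone

variable {d : ℕ} {G R : Type u}

/-- The colours of the edges of a cone with the given tint, with base `0`, `1` and apex `2`. -/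
def coneCol (g : G) (x y : Fin (d + 3)) : Color G R :=
  if (x.1 = 0 ∧ y.1 = 2) ∨ (x.1 = 2 ∧ y.1 = 0) then tint g
  else if (x.1 = 1 ∧ y.1 = 2) ∨ (x.1 = 2 ∧ y.1 = 1) then green
  else neutral

theorem coneCol_conv (g : G) (x y : Fin (d + 3)) :
    (coneCol g y x : Color G R) = (coneCol g x y).conv := by
  unfold coneCol
  split_ifs <;> first | rfl | (exfalso; omega)

variable [Rainbow G R]

theorem coneCol_tri (g : G) {x y z : Fin (d + 3)} (hxy : x ≠ y) (hxz : x ≠ z) (hyz : y ≠ z) :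
    Tri (coneCol g x y : Color G R) (coneCol g x z) (coneCol g y z) := by
  rw [Ne, Fin.ext_iff] at hxy hxz hyz
  unfold coneCol
  split_ifs <;> first
    | (exfalso; omega)
    | exact ⟨trivial, trivial⟩
    | exact ⟨fun p hp => absurd hp (by simp), trivial⟩

open Classical in
/-- The coloured structure of a cone. -/
noncomputable def coneNet (g : G) : Net d G R (Fin (d + 3)) where
  col c x y := if Proper c x y then coneCol g x y else neutral
  col_neutral h := if_neg h
  col_conv c x y := by
    by_cases h : Proper c x y
    · rw [if_pos h, if_pos h.symm, coneCol_conv]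
    · rw [if_neg h, if_neg fun h' => h h'.symm]; rfl
  tri hxy hxz hyz := by
    rw [if_pos hxy, if_pos hxz, if_pos hyz]
    exact coneCol_tri g hxy.2.2.2 hxz.2.2.2 hyz.2.2.2

/-- The atom of a cone. -/
noncomputable def coneAtom (g : G) : Atoms d G R := ⟨(coneNet g).pat id, Net.isAtom_pat _ _⟩

/-- The coordinates of the context. -/
def ctxIdx (k : Fin d) : Fin (d + 3) := ⟨k.1 + 3, by omega⟩

theorem proper_ctxIdx {a b : Fin (d + 3)} (ha : a.1 < 3) (hb : b.1 < 3) (hab : a ≠ b) :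
    Proper (ctxIdx : Fin d → Fin (d + 3)) a b := by
  refine ⟨fun k l h => ?_, ?_, ?_, hab⟩
  · simp only [ctxIdx, Fin.mk.injEq] at h; omega
  · rintro ⟨k, rfl⟩; simp [ctxIdx] at ha
  · rintro ⟨k, rfl⟩; simp [ctxIdx] at hb

theorem coneAtom_col (g : G) {a b : Fin (d + 3)} (ha : a.1 < 3) (hb : b.1 < 3) (hab : a ≠ b) :
    (coneAtom g : Atoms d G R).1.col ctxIdx a b = coneCol g a b :=
  if_pos (proper_ctxIdx ha hb hab)

-- The tint occurs only on edges at the apex, coordinate `2`. So an apex can be exchanged for one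
-- with another tint over the same base.
open Classical in
theorem coneAtom_agree (g g' : G) : (coneAtom g : Atoms d G R).1.Agree {2}ᶜ (coneAtom g').1 := by
  have h2 : ((2 : Fin (d + 3)) : ℕ) = 2 := rfl
  refine ⟨fun _ _ _ _ => Iff.rfl, fun h _ a ha b hb => ?_⟩
  change (if _ then coneCol g a b else _) = if _ then coneCol g' a b else _
  have ha' : a.1 ≠ 2 := fun h => ha (Fin.ext h)
  have hb' : b.1 ≠ 2 := fun h => hb (Fin.ext h)
  have : (coneCol g a b : Color G R) = coneCol g' a b := by
    unfold coneCol
    split_ifs <;> first | rfl | (exfalso; omega)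
  rw [this]

/-- The sequence of positions `u`, `v`, `w`, followed by the context. -/
def posTuple (u v w : Fin (d + 5)) (i : Fin (d + 3)) : Fin (d + 5) :=
  -- Positions `0`, `1` are meant for the base and `2`, `3`, `4` for three apexes, so the context,
  -- which starts at coordinate `3`, is shifted by `2` to start at position `5`.
  if i.1 = 0 then u else if i.1 = 1 then v else if i.1 = 2 then w else ⟨i.1 + 2, by omega⟩

theorem posTuple_injective {w : Fin (d + 5)} (h2 : 2 ≤ w.1) (h4 : w.1 ≤ 4) :
    Function.Injective (posTuple ⟨0, by omega⟩ ⟨1, by omega⟩ w : Fin (d + 3) → Fin (d + 5)) := by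
  intro i j hij
  have := congrArg Fin.val hij
  unfold posTuple at this
  apply Fin.ext
  split_ifs at this <;> simp only at this <;> omega

end Cone

namespace RelRep

variable {d : ℕ} {G R : Type u} [Rainbow G R] {M : Type v} {κ : Type w}

/-- A complete square representation would give an infinite descending sequence of ranks of red
indices. -/
theorem not_isComplete_of_isSquare (S : RelRep (d + 3) (Set (Atoms d G R)) M) (hS : S.IsSquare κ)
    (pos : Fin (d + 5) ↪ κ) (g : ℕ → G) (rank : R → ℕ) (hg : ∀ n, g n ≠ g (n + 1))
    (hg' : ∀ n, g n ≠ g (n + 2))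
    (hrank : ∀ n k l, Rainbow.hom (g n) (g (n + 1)) k l → rank l < rank k) : ¬ S.IsComplete := by
  intro hC
  have hat : ∀ x : Fin (d + 3) → M, ∃ p : Atoms d G R, x ∈ S.V → x ∈ S.f {p} := by
    intro x
    by_cases hx : x ∈ S.V
    · obtain ⟨p, hp⟩ := S.exists_atom_of_isComplete hC hx
      exact ⟨p, fun _ => hp⟩
    · exact ⟨coneAtom (g 0), fun h => absurd h hx⟩
  choose at_ hat using hat
  let tup : (κ → M) → Fin (d + 5) → Fin (d + 5) → Fin (d + 5) → Fin (d + 3) → M :=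
    fun s u v w k => s (pos (posTuple u v w k))
  have hmem : ∀ s ∈ S.cliqueSeqs κ, ∀ u v w, tup s u v w ∈ S.f {at_ (tup s u v w)} :=
    fun s hs u v w => hat _ (S.comp_mem_V hs _)
  -- The third place of the tuple is filled with a repetition of `v`. The facts `C01`, `C02`, `C12`
  -- show that the edge from `u` to `v` has the same colour in every tuple that displays it, since
  -- neighbouring tuples have neighbouring atoms.
  let C : (κ → M) → Fin (d + 5) → Fin (d + 5) → Color G R :=
    fun s u v => (at_ (tup s u v v)).1.col ctxIdx 0 1
  have hctx : ∀ (k : Fin d) (a : Fin (d + 3)), a.1 < 3 → ctxIdx k ∈ ({a}ᶜ : Set (Fin (d + 3))) := by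
    rintro k a ha rfl
    simp [ctxIdx] at ha
  have h0 : ((0 : Fin (d + 3)) : ℕ) = 0 := rfl
  have h1 : ((1 : Fin (d + 3)) : ℕ) = 1 := rfl
  have h2 : ((2 : Fin (d + 3)) : ℕ) = 2 := rfl
  have n01 : (0 : Fin (d + 3)) ≠ 1 := fun h => by have := congrArg Fin.val h; omega
  have n02 : (0 : Fin (d + 3)) ≠ 2 := fun h => by have := congrArg Fin.val h; omega
  have n12 : (1 : Fin (d + 3)) ≠ 2 := fun h => by have := congrArg Fin.val h; omega
  have off0 : ∀ s u u' v w, EqOff 0 (tup s u v w) (tup s u' v w) := by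
    intro s u u' v w j hj
    have : j.1 ≠ 0 := fun h => hj (Fin.ext h)
    simp only [tup, posTuple, if_neg this]
  have off1 : ∀ s u v v' w, EqOff 1 (tup s u v w) (tup s u v' w) := by
    intro s u v v' w j hj
    have : j.1 ≠ 1 := fun h => hj (Fin.ext h)
    simp only [tup, posTuple, if_neg this]
  have off2 : ∀ s u v w w', EqOff 2 (tup s u v w) (tup s u v w') := by
    intro s u v w w' j hj
    have : j.1 ≠ 2 := fun h => hj (Fin.ext h)
    simp only [tup, posTuple, if_neg this]
  have C01 : ∀ s ∈ S.cliqueSeqs κ, ∀ u v w, (at_ (tup s u v w)).1.col ctxIdx 0 1 = C s u v := by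
    intro s hs u v w
    exact (S.atom_agree (hmem s hs u v w) (hmem s hs u v v) (off2 s u v w v)).2 _
      (fun k => hctx k 2 (by omega)) _ n02 _ n12
  have C02 : ∀ s ∈ S.cliqueSeqs κ, ∀ u v w, (at_ (tup s u w v)).1.col ctxIdx 0 2 = C s u v := by
    intro s hs u v w
    rw [(S.atom_agree (hmem s hs u w v) (hmem s hs u v v) (off1 s u w v v)).2 _
      (fun k => hctx k 1 (by omega)) _ n01 _ n12.symm]
    exact (at_ (tup s u v v)).2.congr _ _ _ _ _ _ (fun k => (at_ (tup s u v v)).2.equiv.refl _)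
      ((at_ (tup s u v v)).2.equiv.refl _) ((S.atom_eq_iff (hmem s hs u v v) 2 1).2 rfl)
  have C12 : ∀ s ∈ S.cliqueSeqs κ, ∀ u v w, (at_ (tup s w u v)).1.col ctxIdx 1 2 = C s u v := by
    intro s hs u v w
    rw [(S.atom_agree (hmem s hs w u v) (hmem s hs u u v) (off0 s w u u v)).2 _
      (fun k => hctx k 0 (by omega)) _ n01.symm _ n02.symm, ← C02 s hs u v u]
    exact (at_ (tup s u u v)).2.congr _ _ _ _ _ _ (fun k => (at_ (tup s u u v)).2.equiv.refl _)
      ((S.atom_eq_iff (hmem s hs u u v) 1 0).2 rfl) ((at_ (tup s u u v)).2.equiv.refl _)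
  let P0 : Fin (d + 5) := ⟨0, by omega⟩
  let P1 : Fin (d + 5) := ⟨1, by omega⟩
  -- the colours of the edges from an apex to the base
  have Capex : ∀ s ∈ S.cliqueSeqs κ, ∀ w n, tup s P0 P1 w ∈ S.f {coneAtom (g n)} →
      C s P0 w = tint (g n) ∧ C s P1 w = green := by
    intro s hs w n hn
    have he : at_ (tup s P0 P1 w) = coneAtom (g n) := S.atom_unique (hmem s hs _ _ _) hn
    rw [← C02 s hs P0 w P1, ← C12 s hs P1 w P0, he, coneAtom_col _ (by omega) (by omega) n02,
      coneAtom_col _ (by omega) (by omega) n12]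
    constructor
    · exact if_pos (Or.inl ⟨h0, h2⟩)
    · refine (if_neg ?_).trans (if_pos (Or.inl ⟨h1, h2⟩))
      omega
  have proper_of : ∀ (p : Atoms d G R) (a b : Fin (d + 3)), p.1.col ctxIdx a b ≠ neutral →
      p.1.IsProper ctxIdx a b := fun p a b h => by
    by_contra hp; exact h (p.2.col_neutral _ _ _ hp)
  -- two apexes with different tints are joined by a red edge
  have Cred : ∀ s ∈ S.cliqueSeqs κ, ∀ w w' n n', g n ≠ g n' →
      tup s P0 P1 w ∈ S.f {coneAtom (g n)} → tup s P0 P1 w' ∈ S.f {coneAtom (g n')} →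
      ∃ k l, C s w w' = red k l ∧ Rainbow.hom (g n) (g n') k l := by
    intro s hs w w' n n' hnn hn hn'
    obtain ⟨t1, t2⟩ := Capex s hs w n hn
    obtain ⟨t3, t4⟩ := Capex s hs w' n' hn'
    have htri : ∀ u a c, a ≠ neutral → c ≠ neutral → C s u w = a → C s u w' = c →
        ¬ (at_ (tup s u w w')).1.eq 1 2 → VertexLaw a c (C s w w') := by
      intro u a c ha hc e1 e2 hne
      rw [← C01 s hs u w w'] at e1
      rw [← C02 s hs u w' w] at e2
      have p1 := proper_of _ _ _ (e1 ▸ ha)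
      have p2 := proper_of _ _ _ (e2 ▸ hc)
      have := ((at_ (tup s u w w')).2.tri _ _ _ _ p1 p2 ⟨p1.1, p1.2.2.1, p2.2.2.1, hne⟩).1
      rwa [e1, e2, C12 s hs w w' u] at this
    have hne : ∀ u, ¬ (at_ (tup s u w w')).1.eq 1 2 := by
      intro u h
      have h3 : s (pos w) = s (pos w') := (S.atom_eq_iff (hmem s hs u w w') 1 2).1 h
      have h4 : tup s P0 P1 w = tup s P0 P1 w' := by
        funext j
        by_cases hj : j.1 = 2
        · have h5 : ¬ j.1 = 0 := by omega
          have h6 : ¬ j.1 = 1 := by omega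
          simpa only [tup, posTuple, if_neg h5, if_neg h6, if_pos hj] using h3
        · simp only [tup, posTuple, if_neg hj]
      have : C s P0 w = C s P0 w' := by
        rw [← C02 s hs P0 w P1, ← C02 s hs P0 w' P1, h4]
      rw [t1, t3] at this
      exact hnn (Color.tint.inj this)
    have l1 := htri P0 _ _ (by simp [neutral]) (by simp [neutral]) t1 t3 (hne _)
    have l2 := htri P1 _ _ (by simp [neutral]) (by simp [neutral]) t2 t4 (hne _)
    rcases hcol : C s w w' with ⟨i, T⟩ | _ | _ | ⟨k, l⟩ <;> rw [hcol] at l1 l2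
    -- A white edge would have to be marked `true` for the base point `P0` and `false` for `P1`.
    · simp only [VertexLaw] at l1 l2
      rw [l1] at l2
      simp at l2
    · exact l1.elim
    · exact l1.elim
    · exact ⟨k, l, rfl, l1⟩
  have extend : ∀ s ∈ S.cliqueSeqs κ, ∀ w w' n n', 2 ≤ w'.1 → w'.1 ≤ 4 →
      tup s P0 P1 w ∈ S.f {coneAtom (g n)} →
      ∃ t ∈ S.cliqueSeqs κ, EqOff (pos w') t s ∧ tup t P0 P1 w' ∈ S.f {coneAtom (g n')} := by
    intro s hs w w' n n' h2' h4' hn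
    have hl : Function.Injective fun k => pos (posTuple P0 P1 w' k) :=
      pos.injective.comp (posTuple_injective h2' h4')
    obtain ⟨t, ht, h5, h6⟩ := IsSquare.exists_extend S hS hs hl (hmem s hs P0 P1 w')
      (((S.atom_agree (hmem s hs P0 P1 w') hn (off2 s P0 P1 w' w))).trans
        (coneAtom_agree (g n) (g n')))
    refine ⟨t, ht, ?_, h6⟩
    have h7 : posTuple P0 P1 w' (2 : Fin (d + 3)) = w' := by
      have e1 : ¬ ((2 : Fin (d + 3)) : ℕ) = 0 := by omega
      have e2 : ¬ ((2 : Fin (d + 3)) : ℕ) = 1 := by omega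
      simp only [posTuple, if_neg e1, if_neg e2, if_pos h2]
    rwa [h7] at h5
  -- sequences agreeing outside an apex position have the same tuples avoiding it
  have tup_congr : ∀ (s t : κ → M) (u v w w' : Fin (d + 5)), EqOff (pos w') t s → 2 ≤ w'.1 →
      w'.1 ≤ 4 → u ≠ w' → v ≠ w' → w ≠ w' → tup t u v w = tup s u v w := by
    intro s t u v w w' hst h2' h4' hu hv hw
    funext k
    refine hst _ fun h => ?_
    have h := pos.injective h
    unfold posTuple at h
    split_ifs at h
    · exact hu h
    · exact hv h
    · exact hw h
    · have := congrArg Fin.val h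
      simp only at this
      omega
  -- Apexes of tints `g n`, `g (n + 1)` sit at `w`, `w'`, and `w''` is free. An apex of tint `g (n +
  -- 2)` is put at `w''`. It is red to both others, as its tint differs from theirs, so coherence
  -- identifies `l` with the first index of the edge from `w'` to `w''`, whose second index has
  -- smaller rank. Then `w` becomes the free place.
  have descent : ∀ r : ℕ, ∀ s ∈ S.cliqueSeqs κ, ∀ (w w' w'' : Fin (d + 5)) (n : ℕ) (k l : R),
      (∀ x ∈ ({w, w', w''} : Set (Fin (d + 5))), 2 ≤ x.1 ∧ x.1 ≤ 4) → w ≠ w' → w ≠ w'' → w' ≠ w'' →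
      tup s P0 P1 w ∈ S.f {coneAtom (g n)} → tup s P0 P1 w' ∈ S.f {coneAtom (g (n + 1))} →
      C s w w' = red k l → rank l = r → False := by
    intro r
    induction r using Nat.strong_induction_on with
    | _ r ih =>
      intro s hs w w' w'' n k l hrange hww' hww'' hw'w'' hn hn' hCkl hr
      obtain ⟨h2', h4'⟩ := hrange w'' (by simp)
      obtain ⟨t, ht, hts, hn''⟩ := extend s hs w' w'' (n + 1) (n + 2) h2' h4' hn'
      have hP0 : P0 ≠ w'' := fun h => by
        have := congrArg Fin.val h; simp only [P0] at this; omega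
      have hP1 : P1 ≠ w'' := fun h => by
        have := congrArg Fin.val h; simp only [P1] at this; omega
      have tc := fun u v w => tup_congr s t u v w w'' hts h2' h4'
      rw [← tc _ _ _ hP0 hP1 hww''] at hn
      rw [← tc _ _ _ hP0 hP1 hw'w''] at hn'
      have hC' : C t w w' = red k l := by
        rw [← hCkl]
        simp only [C]
        rw [tc _ _ _ hww'' hw'w'' hw'w'']
      obtain ⟨k', l', e1, h5⟩ := Cred t ht w' w'' _ _ (hg (n + 1)) hn' hn''
      obtain ⟨k'', l'', e2, h6⟩ := Cred t ht w w'' _ _ (hg' n) hn hn''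
      have d1 := C01 t ht w w' w''
      have d2 := C02 t ht w w'' w'
      have d3 := C12 t ht w' w'' w
      rw [hC'] at d1
      rw [e2] at d2
      rw [e1] at d3
      have p1 := proper_of _ _ _ (d1.trans_ne (by simp [neutral]))
      have p2 := proper_of _ _ _ (d2.trans_ne (by simp [neutral]))
      have p3 := proper_of _ _ _ (d3.trans_ne (by simp [neutral]))
      have htri := ((at_ (tup t w w' w'')).2.tri _ _ _ _ p1 p2 p3).2
      rw [d1, d2, d3] at htri
      obtain ⟨-, hl, -⟩ := htri
      refine ih (rank l') ?_ t ht w' w'' w (n + 1) k' l' ?_ hw'w'' hww'.symm hww''.symm hn' hn'' e1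
        rfl
      · rw [← hr, hl]; exact hrank _ _ _ h5
      · intro x hx
        refine hrange x ?_
        simp only [Set.mem_insert_iff, Set.mem_singleton_iff] at hx ⊢
        tauto
  let Q0 : Fin (d + 5) := ⟨2, by omega⟩
  let Q1 : Fin (d + 5) := ⟨3, by omega⟩
  let Q2 : Fin (d + 5) := ⟨4, by omega⟩
  have q01 : Q0 ≠ Q1 := by simp [Q0, Q1]
  have q02 : Q0 ≠ Q2 := by simp [Q0, Q2]
  have q12 : Q1 ≠ Q2 := by simp [Q1, Q2]
  obtain ⟨s, hs, hs0⟩ := IsSquare.exists_realize S hS hC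
    (pos.injective.comp (posTuple_injective (w := Q0) le_rfl (by simp [Q0]))) (coneAtom (g 0))
  obtain ⟨t, ht, hts, ht1⟩ := extend s hs Q0 Q1 0 1 (by simp [Q1]) (by simp [Q1]) hs0
  have ht0 : tup t P0 P1 Q0 ∈ S.f {coneAtom (g 0)} := by
    rw [tup_congr s t P0 P1 Q0 Q1 hts (by simp [Q1]) (by simp [Q1]) (by simp [P0, Q1])
      (by simp [P1, Q1]) q01]
    exact hs0
  obtain ⟨k, l, hkl, -⟩ := Cred t ht Q0 Q1 0 1 (hg 0) ht0 ht1
  refine descent (rank l) t ht Q0 Q1 Q2 0 k l ?_ q01 q02 q12 ht0 ht1 hkl rfl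
  intro x hx
  simp only [Set.mem_insert_iff, Set.mem_singleton_iff] at hx
  rcases hx with rfl | rfl | rfl <;> simp [Q0, Q1, Q2]

end RelRep

/-! ### Valuations and the completion of graphs with a new point -/

section Valuation

variable {G R : Type u} {X : Type v}

/-- `x` is the apex of a cone with tint `t` over the base `b₀`, `b₁`. -/
def IsApex (col : X → X → Color G R) (b₀ b₁ x : X) (t : G) : Prop :=
  col x b₀ = tint t ∧ col x b₁ = green

/-- Completion of two triangles with a common edge to the new point; `v₁` and `v₂` give the indices
of the red edges. -/
def Color.complete (v₁ v₂ : G → R) : Color G R → Color G R → Color G R → Color G R → Color G R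
  -- The arguments are the colours of `A x`, of `A` to the new point, of `B x` and of `B` to the new
  -- point. In the first two cases `x` and the new point are apexes over one base formed by `A` and
  -- `B`.
  | tint t, tint u, green, green => red (v₁ t) (v₁ u)
  | green, green, tint t, tint u => red (v₂ t) (v₂ u)
  -- In these four cases `A` and `B` are both apexes over `x` and the new point, in one or the other
  -- orientation. Only their two tints are listed, so a valuation of the new base has just these two
  -- to respect.
  | tint t, green, tint u, green => white false (some (t, u))
  | tint t, green, green, tint u => white false (some (t, u))
  | green, tint t, tint u, green => white false (some (t, u))
  | green, tint t, green, tint u => white false (some (t, u))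
  | tint _, tint _, _, _ => white true none
  | _, _, tint _, tint _ => white true none
  | _, _, _, _ => neutral

/-- Completion never uses tints or green. So only edges from `A` or `B` can join the new point to a
cone. -/
theorem complete_white_or_red (v₁ v₂ : G → R) (a α b β : Color G R) :
    (∃ i T, complete v₁ v₂ a α b β = white i T) ∨
      (∃ t u, a = tint t ∧ α = tint u ∧ b = green ∧ β = green ∧
        complete v₁ v₂ a α b β = red (v₁ t) (v₁ u)) ∨
      ∃ t u, a = green ∧ α = green ∧ b = tint t ∧ β = tint u ∧
        complete v₁ v₂ a α b β = red (v₂ t) (v₂ u) := by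
  cases a <;> cases α <;> cases b <;> cases β <;>
    first
    | exact Or.inl ⟨_, _, rfl⟩
    | exact Or.inr (Or.inl ⟨_, _, rfl, rfl, rfl, rfl, rfl⟩)
    | exact Or.inr (Or.inr ⟨_, _, rfl, rfl, rfl, rfl, rfl⟩)

theorem allowed_left (t u : G) : Allowed (some (t, u)) t := by
  rintro p hp
  obtain rfl := Option.mem_some_iff.1 hp
  exact Or.inl rfl

theorem allowed_right (t u : G) : Allowed (some (t, u)) u := by
  rintro p hp
  obtain rfl := Option.mem_some_iff.1 hp
  exact Or.inr rfl

theorem allowed_none (t : G) : Allowed none t := fun _ hp => absurd hp (by simp)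

theorem allowed_some_iff {t u s : G} : Allowed (some (t, u)) s ↔ s = t ∨ s = u :=
  ⟨fun h => h _ rfl, fun h p hp => by obtain rfl := Option.mem_some_iff.1 hp; exact h⟩

theorem conv_eq_tint {a : Color G R} {t : G} : a.conv = tint t ↔ a = tint t := by
  cases a <;> simp [conv]

theorem conv_eq_green {a : Color G R} : a.conv = green ↔ a = green := by
  cases a <;> simp [conv]

theorem coherent_of_ne {a b c : Color G R}
    (h : (∀ k l, a ≠ red k l) ∨ (∀ k l, b ≠ red k l) ∨ ∀ k l, c ≠ red k l) : Coherent a b c := by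
  cases a <;> cases b <;> cases c <;> first | trivial | simp at h

variable [Rainbow G R]

theorem vertexLaw_complete_left {v₁ v₂ : G → R} {a α b β : Color G R}
    (h₁ : ∀ t u, a = tint t → α = tint u → b = green → β = green →
      Rainbow.hom t u (v₁ t) (v₁ u)) : VertexLaw a α (complete v₁ v₂ a α b β) := by
  cases a <;> cases α <;> cases b <;> cases β <;>
    first
    | trivial
    | exact h₁ _ _ rfl rfl rfl rfl
    | exact allowed_none _
    | exact allowed_left _ _

theorem vertexLaw_complete_right {v₁ v₂ : G → R} {a α b β : Color G R}
    (h₂ : ∀ t u, a = green → α = green → b = tint t → β = tint u →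
      Rainbow.hom t u (v₂ t) (v₂ u)) : VertexLaw b β (complete v₁ v₂ a α b β) := by
  cases a <;> cases α <;> cases b <;> cases β <;>
    first
    | trivial
    | exact h₂ _ _ rfl rfl rfl rfl
    | exact allowed_none _
    | exact allowed_left _ _
    | exact allowed_right _ _

theorem vertexLaw_of_mid {a c b : Color G R} (h : (∃ i T, c = white i T) ∨ ∃ k l, c = red k l) :
    VertexLaw a c b := by
  rcases h with ⟨i, T, rfl⟩ | ⟨k, l, rfl⟩ <;> cases a <;> trivial

theorem vertexLaw_of_left {a c b : Color G R} (h : (∃ i T, a = white i T) ∨ ∃ k l, a = red k l) :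
    VertexLaw a c b := by
  rcases h with ⟨i, T, rfl⟩ | ⟨k, l, rfl⟩ <;> cases c <;> trivial

/-- Two apexes over a common base, seen from both base points, are joined by a red edge. -/
theorem exists_red {t u : G} {b : Color G R} (h₁ : VertexLaw (tint t) (tint u) b)
    (h₂ : VertexLaw green green b) : ∃ k l, b = red k l ∧ Rainbow.hom t u k l := by
  rcases b with ⟨i, T⟩ | _ | _ | ⟨k, l⟩
  · simp only [VertexLaw] at h₁ h₂
    rw [h₁] at h₂
    simp at h₂
  · exact h₁.elim
  · exact h₁.elim
  · exact ⟨k, l, rfl, h₁⟩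

theorem exists_white {t : G} {b : Color G R} (h : VertexLaw (tint t) green b) :
    ∃ i T, b = white i T ∧ Allowed T t := by
  rcases b with ⟨i, T⟩ | _ | _ | ⟨k, l⟩
  · exact ⟨i, T, rfl, h⟩
  all_goals exact h.elim

/-- `w` gives the indices of the red edges between the apexes over the base `b₀`, `b₁`. -/
def ValLaw (col : X → X → Color G R) (S : Set X) (b₀ b₁ : X) (w : G → R) : Prop :=
  (∀ x ∈ S, ∀ y ∈ S, x ≠ y → ∀ t u, IsApex col b₀ b₁ x t → IsApex col b₀ b₁ y u →
    col x y = red (w t) (w u)) ∧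
  ∀ i T, col b₀ b₁ = white i T → ∀ t u, Allowed T t → Allowed T u → Rainbow.hom t u (w t) (w u)

/-- `v` gives the indices of the red edges between apexes over all bases. -/
def IsVal (col : X → X → Color G R) (S : Set X) (v : X → X → G → R) : Prop :=
  ∀ b₀ ∈ S, ∀ b₁ ∈ S, b₀ ≠ b₁ → ValLaw col S b₀ b₁ (v b₀ b₁)

/-- When the list has only two tints, no map that is admissible on all tints is needed: one
admissible pair suffices. -/
theorem exists_pairVal {t u : G} {k l : R} (h : Rainbow.hom t u k l) :
    ∃ w : G → R, w t = k ∧ w u = l ∧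
      ∀ p q, Allowed (some (t, u)) p → Allowed (some (t, u)) q → Rainbow.hom p q (w p) (w q) := by
  classical
  have hw : ∃ w : G → R, w t = k ∧ w u = l := by
    by_cases htu : t = u
    · subst htu
      exact ⟨fun _ => k, rfl, Rainbow.eq_of_hom h⟩
    · exact ⟨fun p => if p = t then k else l, by simp, by simp [Ne.symm htu]⟩
  obtain ⟨w, rfl, rfl⟩ := hw
  refine ⟨w, rfl, rfl, fun p q hp hq => ?_⟩
  rw [allowed_some_iff] at hp hq
  rcases hp with rfl | rfl <;> rcases hq with rfl | rfl
  · exact Rainbow.hom_self _ _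
  · exact h
  · exact Rainbow.hom_symm h
  · exact Rainbow.hom_self _ _

/-- The main extension lemma for graphs: edges from a new point to at most two old points `A`, `B`
can be completed, preserving the existence of valuations. -/
theorem exists_complete {col : X → X → Color G R} {S : Set X}
    (hconv : ∀ x y, col y x = (col x y).conv) (hdiag : ∀ x, col x x = neutral)
    (htri : ∀ x ∈ S, ∀ y ∈ S, ∀ z ∈ S, x ≠ y → x ≠ z → y ≠ z →
      Tri (col x y) (col x z) (col y z))
    {v : X → X → G → R} (hv : IsVal col S v) (ρ : G → R)
    (hρ : ∀ s t, Rainbow.hom s t (ρ s) (ρ t)) {A B : X} (hA : A ∈ S) (hB : B ∈ S)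
    (e₀ : X → Color G R) (he₀ : NewLaw col e₀ {A, B}) :
    ∃ (e : X → Color G R) (v' : Option X → Option X → G → R), e A = e₀ A ∧ e B = e₀ B ∧
      NewLaw col e S ∧ IsVal (optCol col e) {o | ∀ x ∈ o, x ∈ S} v' ∧
      ∀ x y, v' (some x) (some y) = v x y := by
  classical
  let e : X → Color G R := fun x => if x = A ∨ x = B then e₀ x else
    complete (v A B) (v B A) (col A x) (e₀ A) (col B x) (e₀ B)
  have eA : e A = e₀ A := if_pos (Or.inl rfl)
  have eB : e B = e₀ B := if_pos (Or.inr rfl)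
  have eX : ∀ x, x ≠ A → x ≠ B →
      e x = complete (v A B) (v B A) (col A x) (e₀ A) (col B x) (e₀ B) :=
    fun x hxA hxB => if_neg fun h => h.elim hxA hxB
  have eX' : ∀ x, x ≠ A → x ≠ B → (∃ i T, e x = white i T) ∨ ∃ k l, e x = red k l := by
    intro x hxA hxB
    rw [eX x hxA hxB]
    rcases complete_white_or_red (v A B) (v B A) (col A x) (e₀ A) (col B x) (e₀ B) with
      h | ⟨t, u, -, -, -, -, h⟩ | ⟨t, u, -, -, -, -, h⟩
    · exact Or.inl h
    · exact Or.inr ⟨_, _, h⟩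
    · exact Or.inr ⟨_, _, h⟩
  have e_green : ∀ x, (e x = green ∨ ∃ t, e x = tint t) → x = A ∨ x = B := by
    intro x hx
    by_contra hcon
    push Not at hcon
    rcases eX' x hcon.1 hcon.2 with ⟨i, T, h⟩ | ⟨k, l, h⟩ <;> rw [h] at hx <;> simp at hx
  -- admissibility of the tints of old and new apexes
  have hom_of : ∀ A' ∈ S, ∀ B' ∈ S, NewLaw col e₀ {A', B'} → ∀ x ∈ S, x ≠ A' → x ≠ B' → ∀ t u,
      col A' x = tint t → e₀ A' = tint u → col B' x = green → e₀ B' = green →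
      Rainbow.hom t u (v A' B' t) (v A' B' u) := by
    intro A' hA' B' hB' hnew x hx hxA hxB t u h1 h2 h3 h4
    have hAB : A' ≠ B' := by
      rintro rfl; rw [h2] at h4; simp at h4
    -- Seen from the apex `x` the edge `A' B'` is white and allows `t`; seen from the new point it
    -- is white and allows `u`. The valuation of this base is then admissible at `t`, `u`.
    have t1 := (htri x hx A' hA' B' hB' hxA hxB hAB).1
    rw [hconv A' x, hconv B' x, h1, h3] at t1
    obtain ⟨i, T, hT, ht⟩ := exists_white t1
    have t2 := (hnew A' (by simp) B' (by simp) hAB).2.1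
    rw [h2, h4] at t2
    obtain ⟨i', T', hT', hu⟩ := exists_white t2
    rw [hT] at hT'
    obtain ⟨rfl, rfl⟩ := Color.white.inj hT'
    exact (hv A' hA' B' hB' hAB).2 i T hT t u ht hu
  have vA : ∀ x ∈ S, x ≠ A → x ≠ B → VertexLaw (col A x) (e₀ A) (e x) := by
    intro x hx hxA hxB
    rw [eX x hxA hxB]
    exact vertexLaw_complete_left fun t u => hom_of A hA B hB he₀ x hx hxA hxB t u
  have vB : ∀ x ∈ S, x ≠ A → x ≠ B → VertexLaw (col B x) (e₀ B) (e x) := by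
    intro x hx hxA hxB
    rw [eX x hxA hxB]
    refine vertexLaw_complete_right fun t u h1 h2 h3 h4 => ?_
    exact hom_of B hB A hA (by rwa [Set.pair_comm]) x hx hxB hxA t u h3 h4 h1 h2
  -- a red new edge excludes red edges to `A` and `B`
  have red_ne : ∀ x, x ≠ A → x ≠ B → (∃ k l, e x = red k l) →
      (∀ k l, e₀ A ≠ red k l) ∧ ∀ k l, e₀ B ≠ red k l := by
    rintro x hxA hxB ⟨k, l, h⟩
    rw [eX x hxA hxB] at h
    rcases complete_white_or_red (v A B) (v B A) (col A x) (e₀ A) (col B x) (e₀ B) with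
      ⟨i, T, h'⟩ | ⟨t, u, -, h1, -, h2, -⟩ | ⟨t, u, -, h1, -, h2, -⟩
    · rw [h'] at h; simp at h
    · rw [h1, h2]; simp
    · rw [h1, h2]; simp
  have hnew : NewLaw col e S := by
    intro x hx y hy hxy
    by_cases hxP : x = A ∨ x = B
    · by_cases hyP : y = A ∨ y = B
      · have ex : e x = e₀ x := if_pos hxP
        have ey : e y = e₀ y := if_pos hyP
        rw [ex, ey]
        exact he₀ x hxP y hyP hxy
      · have hyP' := hyP
        push Not at hyP'
        refine ⟨?_, vertexLaw_of_mid (eX' y hyP'.1 hyP'.2), ?_⟩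
        · rcases hxP with rfl | rfl
          · rw [eA]; exact vA y hy hyP'.1 hyP'.2
          · rw [eB]; exact vB y hy hyP'.1 hyP'.2
        · rcases eX' y hyP'.1 hyP'.2 with ⟨i, T, h⟩ | h
          · exact coherent_of_ne (Or.inr (Or.inl (by rw [h]; simp)))
          · have := red_ne y hyP'.1 hyP'.2 h
            rcases hxP with rfl | rfl
            · exact coherent_of_ne (Or.inr (Or.inr (by rw [eA]; exact this.1)))
            · exact coherent_of_ne (Or.inr (Or.inr (by rw [eB]; exact this.2)))
    · push Not at hxP
      have hex := eX' x hxP.1 hxP.2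
      by_cases hyP : y = A ∨ y = B
      · refine ⟨vertexLaw_of_mid hex, vertexLaw_of_left hex, ?_⟩
        rcases hex with ⟨i, T, h⟩ | h
        · exact coherent_of_ne (Or.inr (Or.inr (by rw [h]; simp)))
        · have := red_ne x hxP.1 hxP.2 h
          rcases hyP with rfl | rfl
          · exact coherent_of_ne (Or.inr (Or.inl (by rw [eA]; exact this.1)))
          · exact coherent_of_ne (Or.inr (Or.inl (by rw [eB]; exact this.2)))
      · push Not at hyP
        refine ⟨vertexLaw_of_mid hex, vertexLaw_of_left hex, ?_⟩
        have cx := complete_white_or_red (v A B) (v B A) (col A x) (e₀ A) (col B x) (e₀ B)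
        have cy := complete_white_or_red (v A B) (v B A) (col A y) (e₀ A) (col B y) (e₀ B)
        rw [← eX x hxP.1 hxP.2] at cx
        rw [← eX y hyP.1 hyP.2] at cy
        rcases cx with ⟨i, T, h⟩ | ⟨t, u, h1, h2, h3, h4, h5⟩ | ⟨t, u, h1, h2, h3, h4, h5⟩
        · exact coherent_of_ne (Or.inr (Or.inr (by rw [h]; simp)))
        · rcases cy with ⟨i, T, h⟩ | ⟨t', u', h1', h2', h3', h4', h5'⟩ |
            ⟨t', u', h1', h2', h3', h4', h5'⟩
          · exact coherent_of_ne (Or.inr (Or.inl (by rw [h]; simp)))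
          · have hAB : A ≠ B := by
              rintro rfl; rw [h1] at h3; simp at h3
            -- The old edge between the apexes `x`, `y` and both new edges take their indices from
            -- the valuation of one base, so the red triangle is coherent.
            have := (hv A hA B hB hAB).1 x hx y hy hxy t t'
              ⟨by rw [hconv, h1]; rfl, by rw [hconv, h3]; rfl⟩
              ⟨by rw [hconv, h1']; rfl, by rw [hconv, h3']; rfl⟩
            rw [h2] at h2'
            rw [this, h5, h5', Color.tint.inj h2']
            exact ⟨rfl, rfl, rfl⟩
          · rw [h2] at h2'; simp at h2'
        · rcases cy with ⟨i, T, h⟩ | ⟨t', u', h1', h2', h3', h4', h5'⟩ |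
            ⟨t', u', h1', h2', h3', h4', h5'⟩
          · exact coherent_of_ne (Or.inr (Or.inl (by rw [h]; simp)))
          · rw [h2] at h2'; simp at h2'
          · have hBA : B ≠ A := by
              rintro rfl; rw [h1] at h3; simp at h3
            have := (hv B hB A hA hBA).1 x hx y hy hxy t t'
              ⟨by rw [hconv, h3]; rfl, by rw [hconv, h1]; rfl⟩
              ⟨by rw [hconv, h3']; rfl, by rw [hconv, h1']; rfl⟩
            rw [h4] at h4'
            rw [this, h5, h5', Color.tint.inj h4']
            exact ⟨rfl, rfl, rfl⟩
  set S' : Set (Option X) := {o | ∀ x ∈ o, x ∈ S} with hS'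
  -- bases of old points
  have old : ∀ b₀ ∈ S, ∀ b₁ ∈ S, b₀ ≠ b₁ → ValLaw (optCol col e) S' (some b₀) (some b₁) (v b₀ b₁) := by
    intro b₀ hb₀ b₁ hb₁ hb
    -- edges from an old apex to the new point, when that is an apex as well
    have key : ∀ x ∈ S, ∀ t u, IsApex col b₀ b₁ x t → e b₀ = tint u → e b₁ = green →
        e x = red (v b₀ b₁ t) (v b₀ b₁ u) := by
      rintro x hx t u ⟨h1, h2⟩ h3 h4
      have hxb₀ : x ≠ b₀ := by
        rintro rfl; rw [hdiag] at h1; simp [neutral] at h1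
      have hxb₁ : x ≠ b₁ := by
        rintro rfl; rw [hdiag] at h2; simp [neutral] at h2
      have h1' : col b₀ x = tint t := by rw [hconv, h1]; rfl
      have h2' : col b₁ x = green := by rw [hconv, h2]; rfl
      rcases e_green b₀ (Or.inr ⟨u, h3⟩) with rfl | rfl <;>
        rcases e_green b₁ (Or.inl h4) with rfl | rfl
      · exact absurd rfl hb
      · rw [eA] at h3
        rw [eB] at h4
        rw [eX x hxb₀ hxb₁, h1', h2', h3, h4]; rfl
      · rw [eA] at h4
        rw [eB] at h3
        rw [eX x hxb₁ hxb₀, h1', h2', h3, h4]; rfl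
      · exact absurd rfl hb
    refine ⟨?_, (hv b₀ hb₀ b₁ hb₁ hb).2⟩
    rintro (_ | x) hx (_ | y) hy hxy t u ⟨h1, h2⟩ ⟨h3, h4⟩
    · exact absurd rfl hxy
    · change (e y).conv = _
      rw [key y (hy y rfl) u t ⟨h3, h4⟩ (conv_eq_tint.1 h1) (conv_eq_green.1 h2)]; rfl
    · exact key x (hx x rfl) t u ⟨h1, h2⟩ (conv_eq_tint.1 h3) (conv_eq_green.1 h4)
    · exact (hv b₀ hb₀ b₁ hb₁ hb).1 x (hx x rfl) y (hy y rfl) (fun h => hxy (h ▸ rfl)) t u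
        ⟨h1, h2⟩ ⟨h3, h4⟩
  -- bases containing the new point
  -- bases containing the new point
  have pair_base : ∀ (o₀ o₁ : Option X) t u,
      (∀ x ∈ S', ∀ t, IsApex (optCol col e) o₀ o₁ x t → x = some A ∨ x = some B) →
      IsApex (optCol col e) o₀ o₁ (some A) t → IsApex (optCol col e) o₀ o₁ (some B) u →
      optCol col e o₀ o₁ = white false (some (t, u)) →
      (∃ k l, col A B = red k l ∧ Rainbow.hom t u k l) →
      ∃ w, ValLaw (optCol col e) S' o₀ o₁ w := by
    rintro o₀ o₁ t u hap h1 h2 hw ⟨k, l, hkl, hhom⟩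
    obtain ⟨w, rfl, rfl, hw'⟩ := exists_pairVal hhom
    refine ⟨w, ?_, ?_⟩
    · intro x hx y hy hxy p q hp hq
      have tA : ∀ p, IsApex (optCol col e) o₀ o₁ (some A) p → p = t := fun p hp =>
        Color.tint.inj (hp.1.symm.trans h1.1)
      have tB : ∀ p, IsApex (optCol col e) o₀ o₁ (some B) p → p = u := fun p hp =>
        Color.tint.inj (hp.1.symm.trans h2.1)
      rcases hap x hx p hp with rfl | rfl <;> rcases hap y hy q hq with rfl | rfl
      · exact absurd rfl hxy
      · rw [tA p hp, tB q hq]; exact hkl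
      · rw [tB p hp, tA q hq]
        change col B A = _
        rw [hconv, hkl]; rfl
      · exact absurd rfl hxy
    · intro i T hT p q hp hq
      rw [hw] at hT
      obtain ⟨-, rfl⟩ := Color.white.inj hT
      exact hw' p q hp hq
  have single_base : ∀ (o₀ o₁ : Option X),
      (∀ x ∈ S', ∀ t, IsApex (optCol col e) o₀ o₁ x t → x = some A ∨ x = some B) →
      ¬ (A ≠ B ∧ (∃ t, IsApex (optCol col e) o₀ o₁ (some A) t) ∧
        ∃ u, IsApex (optCol col e) o₀ o₁ (some B) u) →
      ∃ w, ValLaw (optCol col e) S' o₀ o₁ w := by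
    intro o₀ o₁ hap hno
    -- With at most one apex there is no red edge to match, and `ρ` is admissible for every list.
    refine ⟨ρ, ?_, fun _ _ _ t u _ _ => hρ t u⟩
    intro x hx y hy hxy p q hp hq
    refine (hno ?_).elim
    rcases hap x hx p hp with rfl | rfl <;> rcases hap y hy q hq with rfl | rfl
    · exact absurd rfl hxy
    · exact ⟨fun h => hxy (h ▸ rfl), ⟨p, hp⟩, q, hq⟩
    · exact ⟨fun h => hxy (h ▸ rfl), ⟨q, hq⟩, p, hp⟩
    · exact absurd rfl hxy
  have base : ∀ o₀ ∈ S', ∀ o₁ ∈ S', o₀ ≠ o₁ → ∃ w, ValLaw (optCol col e) S' o₀ o₁ w := by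
    rintro (_ | b₀) hb₀ (_ | b₁) hb₁ hb
    · exact absurd rfl hb
    · have hap : ∀ x ∈ S', ∀ t, IsApex (optCol col e) none (some b₁) x t →
          x = some A ∨ x = some B := by
        rintro (_ | x) hx t ⟨h1, h2⟩
        · simp [optCol, neutral] at h1
        · rcases e_green x (Or.inr ⟨t, h1⟩) with rfl | rfl
          · exact Or.inl rfl
          · exact Or.inr rfl
      by_cases hno : A ≠ B ∧ (∃ t, IsApex (optCol col e) none (some b₁) (some A) t) ∧
        ∃ u, IsApex (optCol col e) none (some b₁) (some B) u
      swap
      · exact single_base _ _ hap hno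
      obtain ⟨hAB, ⟨t, hA1, hA2⟩, u, hB1, hB2⟩ := hno
      refine pair_base _ _ t u hap ⟨hA1, hA2⟩ ⟨hB1, hB2⟩ ?_ ?_
      all_goals
        change e A = tint t at hA1
        change e B = tint u at hB1
        change col A b₁ = green at hA2
        change col B b₁ = green at hB2
        have hbA : b₁ ≠ A := by
          rintro rfl; rw [hdiag] at hA2; simp [neutral] at hA2
        have hbB : b₁ ≠ B := by
          rintro rfl; rw [hdiag] at hB2; simp [neutral] at hB2
        rw [eA] at hA1
        rw [eB] at hB1
      · change (e b₁).conv = _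
        rw [eX b₁ hbA hbB, hA1, hA2, hB1, hB2]; rfl
      · have h1 := (he₀ A (by simp) B (by simp) hAB).2.1
        have h2 := (htri b₁ (hb₁ b₁ rfl) A hA B hB hbA hbB hAB).1
        rw [hconv A b₁, hconv B b₁, hA2, hB2] at h2
        rw [hA1, hB1] at h1
        exact exists_red h1 h2
    · have hap : ∀ x ∈ S', ∀ t, IsApex (optCol col e) (some b₀) none x t →
          x = some A ∨ x = some B := by
        rintro (_ | x) hx t ⟨h1, h2⟩
        · simp [optCol, neutral] at h2
        · rcases e_green x (Or.inl h2) with rfl | rfl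
          · exact Or.inl rfl
          · exact Or.inr rfl
      by_cases hno : A ≠ B ∧ (∃ t, IsApex (optCol col e) (some b₀) none (some A) t) ∧
        ∃ u, IsApex (optCol col e) (some b₀) none (some B) u
      swap
      · exact single_base _ _ hap hno
      obtain ⟨hAB, ⟨t, hA1, hA2⟩, u, hB1, hB2⟩ := hno
      refine pair_base _ _ t u hap ⟨hA1, hA2⟩ ⟨hB1, hB2⟩ ?_ ?_
      all_goals
        change e A = green at hA2
        change e B = green at hB2
        change col A b₀ = tint t at hA1
        change col B b₀ = tint u at hB1
        have hbA : b₀ ≠ A := by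
          rintro rfl; rw [hdiag] at hA1; simp [neutral] at hA1
        have hbB : b₀ ≠ B := by
          rintro rfl; rw [hdiag] at hB1; simp [neutral] at hB1
        rw [eA] at hA2
        rw [eB] at hB2
      · change e b₀ = _
        rw [eX b₀ hbA hbB, hA1, hA2, hB1, hB2]; rfl
      · have h1 := (he₀ A (by simp) B (by simp) hAB).2.1
        have h2 := (htri b₀ (hb₀ b₀ rfl) A hA B hB hbA hbB hAB).1
        rw [hconv A b₀, hconv B b₀, hA1, hB1] at h2
        rw [hA2, hB2] at h1
        exact exists_red h2 h1
    · exact ⟨_, old b₀ (hb₀ b₀ rfl) b₁ (hb₁ b₁ rfl) fun h => hb (h ▸ rfl)⟩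
  -- Old bases keep their valuation, which makes valuations pass to unions of chains.
  let v' : Option X → Option X → G → R := fun o₀ o₁ => match o₀, o₁ with
    | some b₀, some b₁ => v b₀ b₁
    | o₀, o₁ => if h : ∃ w, ValLaw (optCol col e) S' o₀ o₁ w then h.choose else ρ
  refine ⟨e, v', eA, eB, hnew, ?_, fun _ _ => rfl⟩
  rintro (_ | b₀) hb₀ (_ | b₁) hb₁ hb
  · exact absurd rfl hb
  · have h := base _ hb₀ _ hb₁ hb
    simp only [v', dif_pos h]
    exact h.choose_spec
  · have h := base _ hb₀ _ hb₁ hb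
    simp only [v', dif_pos h]
    exact h.choose_spec
  · exact old b₀ (hb₀ b₀ rfl) b₁ (hb₁ b₁ rfl) fun h => hb (h ▸ rfl)

end Valuation

/-! ### Extensions of coloured structures that preserve valuations -/

section Saturation

variable {d : ℕ} {G R : Type u} [Rainbow G R] {X : Type v}

theorem IsVal.congr {col col' : X → X → Color G R} {S : Set X} {v : X → X → G → R}
    (h : IsVal col S v) (hcol : ∀ x ∈ S, ∀ y ∈ S, col x y = col' x y) : IsVal col' S v := by
  intro b₀ hb₀ b₁ hb₁ hb
  obtain ⟨h1, h2⟩ := h b₀ hb₀ b₁ hb₁ hb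
  refine ⟨fun x hx y hy hxy t u ht hu => ?_, fun i T hT => h2 i T ((hcol _ hb₀ _ hb₁).trans hT)⟩
  rw [← hcol x hx y hy]
  exact h1 x hx y hy hxy t u ⟨(hcol x hx _ hb₀).trans ht.1, (hcol x hx _ hb₁).trans ht.2⟩
    ⟨(hcol y hy _ hb₀).trans hu.1, (hcol y hy _ hb₁).trans hu.2⟩

theorem Net.col_self (N : Net d G R X) (c : Fin d → X) (x : X) : N.col c x x = neutral :=
  N.col_neutral fun h => h.2.2.2 rfl

/-- The colours of the edges to a new point realizing an atom, for one context. -/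
theorem Net.exists_newLaw (N : Net d G R X) {c : Fin d → X} (hc : Function.Injective c)
    {v : X → X → G → R} (hv : IsVal (N.col c) (Set.range c)ᶜ v) (ρ : G → R)
    (hρ : ∀ s t, Rainbow.hom s t (ρ s) (ρ t)) (s : Fin (d + 3) → X) {i : Fin (d + 3)}
    {q : Pat d G R} (hq : q.IsAtom) (hag : q.Agree {i}ᶜ (N.pat s))
    (hfresh : ∀ j, j ≠ i → ¬ q.eq i j) :
    ∃ (e : X → Color G R) (v' : Option X → Option X → G → R),
      NewLaw (N.col c) e (Set.range c)ᶜ ∧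
      IsVal (optCol (N.col c) e) {o | ∀ x ∈ o, x ∈ (Set.range c)ᶜ} v' ∧
      (∀ x y, v' (some x) (some y) = v x y) ∧
      ∀ h : Fin d → Fin (d + 3), (∀ k, h k ≠ i) → c = s ∘ h → ∀ a, a ≠ i → s a ∉ Set.range c →
        e (s a) = q.col h a i := by
  classical
  have htri : ∀ x ∈ (Set.range c)ᶜ, ∀ y ∈ (Set.range c)ᶜ, ∀ z ∈ (Set.range c)ᶜ, x ≠ y → x ≠ z →
      y ≠ z → Tri (N.col c x y) (N.col c x z) (N.col c y z) :=
    fun x hx y hy z hz hxy hxz hyz => N.tri ⟨hc, hx, hy, hxy⟩ ⟨hc, hx, hz, hxz⟩ ⟨hc, hy, hz, hyz⟩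
  by_cases H : ∃ h : Fin d → Fin (d + 3), (∀ k, h k ≠ i) ∧ c = s ∘ h ∧ ∃ a, a ≠ i ∧
      s a ∉ Set.range c
  · obtain ⟨h, hh, rfl, a, ha, hac⟩ := H
    obtain ⟨g, hg⟩ := hq.exists_prescribed hag i
    -- there are at most two points of the sequence outside the context
    have hb : ∃ b, b ≠ i ∧ s b ∉ Set.range (s ∘ h) ∧ ∀ j, j ≠ i → s j ∉ Set.range (s ∘ h) →
        s j = s a ∨ s j = s b := by
      by_cases hb : ∃ b, b ≠ i ∧ s b ∉ Set.range (s ∘ h) ∧ s b ≠ s a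
      · obtain ⟨b, hb, hbc, hba⟩ := hb
        refine ⟨b, hb, hbc, fun j hj hjc => ?_⟩
        by_contra hcon
        push Not at hcon
        refine not_four_outside hc.of_comp (g := ![a, b, j, i])
          (injective_vec_four (fun h => hba (h ▸ rfl)) (fun h => hcon.1 (h ▸ rfl)) ha
            (fun h => hcon.2 (h ▸ rfl)) hb hj) ?_
        intro k l
        fin_cases l
        · rintro rfl; exact hac ⟨k, rfl⟩
        · rintro rfl; exact hbc ⟨k, rfl⟩
        · rintro rfl; exact hjc ⟨k, rfl⟩
        · exact hh k
      · push Not at hb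
        exact ⟨a, ha, hac, fun j hj hjc => Or.inl (hb j hj hjc)⟩
    obtain ⟨b, hb, hbc, hab⟩ := hb
    have hprop : ∀ x y, x ≠ i → y ≠ i → s x ∉ Set.range (s ∘ h) → s y ∉ Set.range (s ∘ h) →
        s x ≠ s y → q.IsProper h x y := by
      intro x y hx hy hxc hyc hxy
      refine ⟨fun k l hkl => hc ((hag.1 _ (hh k) _ (hh l)).1 hkl), fun k hk => ?_, fun k hk => ?_,
        fun h => hxy ((hag.1 _ hx _ hy).1 h)⟩
      · exact hxc ⟨k, (hag.1 _ (hh k) _ hx).1 hk⟩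
      · exact hyc ⟨k, (hag.1 _ (hh k) _ hy).1 hk⟩
    have hprop' : ∀ x, x ≠ i → s x ∉ Set.range (s ∘ h) → q.IsProper h x i := by
      intro x hx hxc
      refine ⟨fun k l hkl => hc ((hag.1 _ (hh k) _ (hh l)).1 hkl), fun k hk => ?_, fun k hk => ?_,
        fun h => hfresh x hx (hq.equiv.symm h)⟩
      · exact hxc ⟨k, (hag.1 _ (hh k) _ hx).1 hk⟩
      · exact hfresh _ (hh k) (hq.equiv.symm hk)
    have hlaw : ∀ x y, x ≠ i → y ≠ i → s x ∉ Set.range (s ∘ h) → s y ∉ Set.range (s ∘ h) →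
        s x ≠ s y → VertexLaw (N.col (s ∘ h) (s x) (s y)) (g (s ∘ h) (s x)) (g (s ∘ h) (s y)) ∧
        VertexLaw (g (s ∘ h) (s x)) (g (s ∘ h) (s y)) (N.col (s ∘ h) (s x) (s y)) ∧
        Coherent (N.col (s ∘ h) (s x) (s y)) (g (s ∘ h) (s y)) (g (s ∘ h) (s x)) := by
      intro x y hx hy hxc hyc hxy
      have p1 := hprop x y hx hy hxc hyc hxy
      have p2 := hprop' x hx hxc
      have p3 := hprop' y hy hyc
      have sym : ∀ x, q.IsProper h x i → q.IsProper h i x := fun x p =>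
        ⟨p.1, p.2.2.1, p.2.1, fun h => p.2.2.2 (hq.equiv.symm h)⟩
      have t1 := hq.tri h x y i p1 p2 p3
      have t2 := (hq.tri h i x y (sym x p2) (sym y p3) p1).1.conv
      rw [← hq.col_conv, ← hq.col_conv] at t2
      have e1 : q.col h x y = N.col (s ∘ h) (s x) (s y) := hag.2 h hh x hx y hy
      rw [hg h hh x hx, hg h hh y hy, ← e1]
      exact ⟨t1.1, t2, t1.2⟩
    have he₀ : NewLaw (N.col (s ∘ h)) (g (s ∘ h)) {s a, s b} := by
      rintro x (rfl | rfl) y (rfl | rfl) hxy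
      · exact absurd rfl hxy
      · exact hlaw a b ha hb hac hbc hxy
      · exact hlaw b a hb ha hbc hac hxy
      · exact absurd rfl hxy
    obtain ⟨e, v', e1, e2, h1, h2, h3⟩ := exists_complete (N.col_conv (s ∘ h))
      (N.col_self (s ∘ h)) htri hv ρ hρ hac hbc _ he₀
    refine ⟨e, v', h1, h2, h3, fun h' hh' hc' j hj hjc => ?_⟩
    rw [← hg h' hh' j hj, ← hc']
    rcases hab j hj hjc with h | h <;> rw [h]
    · exact e1
    · exact e2
  · by_cases hS : ∃ A, A ∈ (Set.range c)ᶜ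
    · obtain ⟨A, hA⟩ := hS
      -- Nothing is prescribed in this context; taking `A = B` makes the law for the given edges
      -- vacuous.
      obtain ⟨e, v', -, -, h1, h2, h3⟩ := exists_complete (N.col_conv c) (N.col_self c) htri hv ρ hρ
        hA hA (fun _ => neutral) (by
          rintro x (rfl | rfl) y (rfl | rfl) hxy <;> exact absurd rfl hxy)
      exact ⟨e, v', h1, h2, h3, fun h hh hc a ha hac => (H ⟨h, hh, hc, a, ha, hac⟩).elim⟩
    · push Not at hS
      refine ⟨fun _ => neutral, fun o₀ o₁ => match o₀, o₁ with
        | some x, some y => v x y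
        | _, _ => ρ, fun x hx => absurd hx (hS x), ?_, fun _ _ => rfl,
        fun h hh hc a ha hac => (H ⟨h, hh, hc, a, ha, hac⟩).elim⟩
      rintro (_ | b₀) hb₀ (_ | b₁) hb₁ hb
      · exact absurd rfl hb
      · exact absurd (hb₁ b₁ rfl) (hS b₁)
      · exact absurd (hb₀ b₀ rfl) (hS b₀)
      · exact absurd (hb₀ b₀ rfl) (hS b₀)

/-- One-point extensions of coloured structures with valuations. -/
theorem Net.exists_extend_val (N : Net d G R X) (v : (Fin d → X) → X → X → G → R)
    (hv : ∀ c, Function.Injective c → IsVal (N.col c) (Set.range c)ᶜ (v c)) (ρ : G → R)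
    (hρ : ∀ s t, Rainbow.hom s t (ρ s) (ρ t)) (s : Fin (d + 3) → X) {i : Fin (d + 3)}
    {q : Pat d G R} (hq : q.IsAtom) (hag : q.Agree {i}ᶜ (N.pat s))
    (hfresh : ∀ j, j ≠ i → ¬ q.eq i j) :
    ∃ (N' : Net d G R (Option X)) (v' : (Fin d → Option X) → Option X → Option X → G → R),
      (∀ c, Function.Injective c → IsVal (N'.col c) (Set.range c)ᶜ (v' c)) ∧
      (∀ c x y, N'.col (some ∘ c) (some x) (some y) = N.col c x y) ∧
      (∀ c x y, Function.Injective c → v' (some ∘ c) (some x) (some y) = v c x y) ∧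
      N'.pat (Function.update (some ∘ s) i none) = q := by
  classical
  have hex : ∀ c : Fin d → X, ∃ (e : X → Color G R) (v' : Option X → Option X → G → R),
      Function.Injective c → NewLaw (N.col c) e (Set.range c)ᶜ ∧
      IsVal (optCol (N.col c) e) {o | ∀ x ∈ o, x ∈ (Set.range c)ᶜ} v' ∧
      (∀ x y, v' (some x) (some y) = v c x y) ∧
      ∀ h : Fin d → Fin (d + 3), (∀ k, h k ≠ i) → c = s ∘ h → ∀ a, a ≠ i → s a ∉ Set.range c →
        e (s a) = q.col h a i := by
    intro c
    by_cases hc : Function.Injective c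
    · obtain ⟨e, v', h⟩ := N.exists_newLaw hc (hv c hc) ρ hρ s hq hag hfresh
      exact ⟨e, v', fun _ => h⟩
    · exact ⟨fun _ => neutral, fun _ _ => ρ, fun h => absurd h hc⟩
  choose e v' hev using hex
  obtain ⟨N', h1, h2, h3, h4⟩ := N.exists_extend s (i := i) (W := {i}ᶜ) (by simp) hq hag
    (fun j hj => hfresh j hj) e (fun c hc => (hev c hc).1)
    (fun h hh hinj a ha hac => (hev _ hinj).2.2.2 h hh rfl a ha hac)
  have hpat : N'.pat (Function.update (some ∘ s) i none) = q :=
    ((h3.mono fun a _ => Classical.em (a = i)).eq).symm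
  have hchoose : ∀ c : Fin d → X, ∀ h : ∃ c₀ : Fin d → X, (some ∘ c : Fin d → Option X) = some ∘ c₀,
      h.choose = c := by
    intro c h
    have := h.choose_spec
    exact (funext fun k => Option.some_injective _ (congrFun this k)).symm
  refine ⟨N', fun c => if h : ∃ c₀ : Fin d → X, c = some ∘ c₀ then v' h.choose else fun _ _ => ρ,
    ?_, h1, ?_, hpat⟩
  · intro c hc
    by_cases hn : none ∈ Set.range c
    · have : ¬ ∃ c₀ : Fin d → X, c = some ∘ c₀ := by
        rintro ⟨c₀, rfl⟩
        obtain ⟨k, hk⟩ := hn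
        exact absurd hk (by simp)
      simp only [dif_neg this]
      intro b₀ hb₀ b₁ hb₁ hb
      -- In a context containing the new point all non-neutral edges join points of one sequence of
      -- length `d + 3`. Two apexes and their base would be four of its points outside the context,
      -- so two apexes never occur and `ρ` serves as a valuation.
      refine ⟨?_, fun _ _ _ t u _ _ => hρ t u⟩
      rintro x hx y hy hxy t u ⟨hx0, hx1⟩ ⟨hy0, hy1⟩
      exfalso
      obtain ⟨⟨h, hch⟩, ⟨ax, hax⟩, a0, ha0⟩ := h4 c x b₀ hn (by rw [hx0]; simp [neutral])
      obtain ⟨-, ⟨ay, hay⟩, a1, ha1⟩ := h4 c y b₁ hn (by rw [hy1]; simp [neutral])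
      have ne0 : ∀ z t, N'.col c z b₀ = tint t → z ≠ b₀ := by
        rintro z t hz rfl
        rw [N'.col_self] at hz; simp [neutral] at hz
      have ne1 : ∀ z, N'.col c z b₁ = green → z ≠ b₁ := by
        rintro z hz rfl
        rw [N'.col_self] at hz; simp [neutral] at hz
      have hinj : Function.Injective h := (hch ▸ hc : Function.Injective (_ ∘ h)).of_comp
      refine not_four_outside hinj (g := ![ax, ay, a0, a1])
        (injective_vec_four ?_ ?_ ?_ ?_ ?_ ?_) ?_
      · rintro rfl; exact hxy (hax.trans hay.symm)
      · rintro rfl; exact ne0 x _ hx0 (hax.trans ha0.symm)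
      · rintro rfl; exact ne1 x hx1 (hax.trans ha1.symm)
      · rintro rfl; exact ne0 y _ hy0 (hay.trans ha0.symm)
      · rintro rfl; exact ne1 y hy1 (hay.trans ha1.symm)
      · rintro rfl; exact hb (ha0.trans ha1.symm)
      · have hck : ∀ k, c k = Function.update (some ∘ s) i none (h k) := fun k => congrFun hch k
        intro k l
        fin_cases l
        · rintro rfl; exact hx ⟨k, (hck k).trans hax.symm⟩
        · rintro rfl; exact hy ⟨k, (hck k).trans hay.symm⟩
        · rintro rfl; exact hb₀ ⟨k, (hck k).trans ha0.symm⟩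
        · rintro rfl; exact hb₁ ⟨k, (hck k).trans ha1.symm⟩
    · obtain ⟨c, rfl⟩ := exists_old_of_none_notMem hn
      have hex : ∃ c₀ : Fin d → X, (some ∘ c : Fin d → Option X) = some ∘ c₀ := ⟨c, rfl⟩
      simp only [dif_pos hex]
      rw [hchoose c hex]
      have hinj : Function.Injective c :=
        (Function.Injective.of_comp_iff (Option.some_injective X) c).1 hc
      have hset : (Set.range (some ∘ c))ᶜ = {o : Option X | ∀ x ∈ o, x ∈ (Set.range c)ᶜ} := by
        ext o
        constructor
        · rintro ho x rfl ⟨k, rfl⟩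
          exact ho ⟨k, rfl⟩
        · rintro ho ⟨k, rfl⟩
          exact ho (c k) rfl ⟨k, rfl⟩
      rw [hset]
      refine (hev c hinj).2.1.congr ?_
      rintro (_ | x) hx (_ | y) hy
      · exact (N'.col_self _ _).symm
      · rw [N'.col_conv, h2 c y hinj (hy y rfl)]; rfl
      · exact (h2 c x hinj (hx x rfl)).symm
      · exact (h1 c x y).symm
  · intro c x y hc
    have hex : ∃ c₀ : Fin d → X, (some ∘ c : Fin d → Option X) = some ∘ c₀ := ⟨c, rfl⟩
    simp only [dif_pos hex]
    rw [hchoose c hex]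
    exact (hev c hc).2.2.1 x y

end Saturation

/-! ### Saturated structures from Zorn's lemma -/

section Saturated

variable {d : ℕ} {G R : Type u}

/-- Names for the points of a saturated structure: `mk s i q` realizes `q` when put in place of the
`i`-th point of `s`. -/
inductive Node (d : ℕ) (G R : Type u) : Type u
  | root : Node d G R
  | mk (s : Fin (d + 3) → Node d G R) (i : Fin (d + 3)) (q : Pat d G R) : Node d G R

theorem Net.pat_update_eq [Rainbow G R] {X : Type v} (N : Net d G R X) (s : Fin (d + 3) → X)
    {i j : Fin (d + 3)} (hij : j ≠ i) {q : Pat d G R} (hq : q.IsAtom)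
    (hag : q.Agree {i}ᶜ (N.pat s)) (hqij : q.eq i j) :
    N.pat (Function.update s i (s j)) = q := by
  refine ((N.isAtom_pat _).eq_of_agree hq hij.symm (j := j)
    ((N.pat_agree_of_eqOff (eqOff_update i s _)).trans hag.symm) ?_ hqij)
  change Function.update s i (s j) i = Function.update s i (s j) j
  rw [Function.update_self, Function.update_of_ne hij]

theorem proper_comp_iff_of_injOn {X : Type v} {Y : Type w} {f : X → Y} {D : Set X}
    (hf : Set.InjOn f D) {c : Fin d → X} {x y : X} (hc : ∀ k, c k ∈ D) (hx : x ∈ D) (hy : y ∈ D) :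
    Proper (f ∘ c) (f x) (f y) ↔ Proper c x y := by
  have h1 : ∀ z ∈ D, (f z ∈ Set.range (f ∘ c) ↔ z ∈ Set.range c) := fun z hz =>
    ⟨fun ⟨k, hk⟩ => ⟨k, hf (hc k) hz hk⟩, fun ⟨k, hk⟩ => ⟨k, congrArg f hk⟩⟩
  have h2 : Function.Injective (f ∘ c) ↔ Function.Injective c :=
    ⟨fun h => h.of_comp, fun h k l hkl => h (hf (hc k) (hc l) hkl)⟩
  simp only [Proper, h1 x hx, h1 y hy, h2, ne_eq, hf.eq_iff hx hy]

variable [Rainbow G R]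

theorem IsVal.comap {X : Type v} {Y : Type w} {f : Y → X} {S : Set X} {S' : Set Y}
    {col : X → X → Color G R} {v : X → X → G → R} (h : IsVal col S v) (hf : Set.InjOn f S')
    (hS : ∀ y ∈ S', f y ∈ S) :
    IsVal (fun x y => col (f x) (f y)) S' fun x y => v (f x) (f y) := by
  intro b₀ hb₀ b₁ hb₁ hb
  obtain ⟨h1, h2⟩ := h _ (hS _ hb₀) _ (hS _ hb₁) (hf.ne hb₀ hb₁ hb)
  exact ⟨fun x hx y hy hxy => h1 _ (hS x hx) _ (hS y hy) (hf.ne hx hy hxy), h2⟩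

/-- A coloured structure with valuations on a set `D` of names, all of which realize what they are
meant to realize. -/
structure PartialNet (d : ℕ) (G R : Type u) [Rainbow G R] where
  D : Set (Node d G R)
  col : (Fin d → Node d G R) → Node d G R → Node d G R → Color G R
  val : (Fin d → Node d G R) → Node d G R → Node d G R → G → R
  root_mem : Node.root ∈ D
  col_neutral : ∀ c x y, (∀ k, c k ∈ D) → x ∈ D → y ∈ D → ¬ Proper c x y → col c x y = neutral
  col_conv : ∀ c x y, (∀ k, c k ∈ D) → x ∈ D → y ∈ D → col c y x = (col c x y).conv
  tri : ∀ c x y z, (∀ k, c k ∈ D) → x ∈ D → y ∈ D → z ∈ D → Proper c x y → Proper c x z →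
    Proper c y z → Tri (col c x y) (col c x z) (col c y z)
  isVal : ∀ c, (∀ k, c k ∈ D) → Function.Injective c → IsVal (col c) (D \ Set.range c) (val c)
  sat : ∀ s i q, Node.mk s i q ∈ D → (∀ k, s k ∈ D) ∧
    (⟨fun a b => Function.update s i (.mk s i q) a = Function.update s i (.mk s i q) b,
      fun h a b => col (Function.update s i (.mk s i q) ∘ h) (Function.update s i (.mk s i q) a)
        (Function.update s i (.mk s i q) b)⟩ : Pat d G R) = q

namespace PartialNet

/-- The order of extension. -/
structure Le (P Q : PartialNet d G R) : Prop where
  sub : P.D ⊆ Q.D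
  col : ∀ c x y, (∀ k, c k ∈ P.D) → x ∈ P.D → y ∈ P.D → P.col c x y = Q.col c x y
  val : ∀ c x y, (∀ k, c k ∈ P.D) → Function.Injective c → x ∈ P.D → y ∈ P.D →
    P.val c x y = Q.val c x y

theorem Le.trans {P Q S : PartialNet d G R} (h : P.Le Q) (h' : Q.Le S) : P.Le S where
  sub := h.sub.trans h'.sub
  col c x y hc hx hy := (h.col c x y hc hx hy).trans
    (h'.col c x y (fun k => h.sub (hc k)) (h.sub hx) (h.sub hy))
  val c x y hc hi hx hy := (h.val c x y hc hi hx hy).trans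
    (h'.val c x y (fun k => h.sub (hc k)) hi (h.sub hx) (h.sub hy))

omit [Rainbow G R] in
theorem update_mem {D : Set (Node d G R)} {s : Fin (d + 3) → Node d G R} {i : Fin (d + 3)}
    {z : Node d G R} (hs : ∀ k, s k ∈ D) (hz : z ∈ D) (k) : Function.update s i z k ∈ D := by
  by_cases h : k = i
  · subst h; simpa using hz
  · rw [Function.update_of_ne h]; exact hs k

/-- The structure with one point. -/
def single (ρ : G → R) : PartialNet d G R where
  D := {.root}
  col _ _ _ := neutral
  val _ _ _ := ρ
  root_mem := rfl
  col_neutral _ _ _ _ _ _ _ := rfl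
  col_conv _ _ _ _ _ _ := rfl
  tri c x y z hc hx hy hz h := absurd (hx.trans hy.symm) h.2.2.2
  isVal c hc hi := by
    rintro x ⟨hx, -⟩ y ⟨hy, -⟩ hxy
    exact absurd (hx.trans hy.symm) hxy
  sat s i q h := by simp at h

/-- Each instance of a law involves finitely many points, and these lie in one member of the chain.
Colours and valuations are read in a chosen member containing the points concerned; all such members
agree. -/
theorem exists_upper {C : Set (PartialNet d G R)} (hC : IsChain Le C) (hne : C.Nonempty) :
    ∃ Q, ∀ P ∈ C, P.Le Q := by
  classical
  let D : Set (Node d G R) := ⋃ P ∈ C, P.D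
  have hdir : DirectedOn (fun P Q : PartialNet d G R => P.D ⊆ Q.D) C := by
    intro P hP Q hQ
    by_cases h : P = Q
    · exact ⟨Q, hQ, h ▸ subset_rfl, subset_rfl⟩
    rcases hC hP hQ h with h | h
    · exact ⟨Q, hQ, h.sub, subset_rfl⟩
    · exact ⟨P, hP, subset_rfl, h.sub⟩
  have hfin : ∀ F : Finset (Node d G R), (∀ x ∈ F, x ∈ D) → ∃ P ∈ C, ∀ x ∈ F, x ∈ P.D := by
    intro F hF
    exact DirectedOn.exists_mem_subset_of_finset_subset_biUnion hne hdir hF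
  have hmem : ∀ P ∈ C, ∀ x ∈ P.D, x ∈ D := fun P hP x hx => Set.mem_biUnion hP hx
  have hfin' : ∀ (c : Fin d → Node d G R) (F : Finset (Node d G R)), (∀ k, c k ∈ D) →
      (∀ x ∈ F, x ∈ D) → ∃ P ∈ C, (∀ k, c k ∈ P.D) ∧ ∀ x ∈ F, x ∈ P.D := by
    intro c F hc hF
    obtain ⟨P, hP, h⟩ := hfin (Finset.univ.image c ∪ F) (by
      intro x hx
      rcases Finset.mem_union.1 hx with hx | hx
      · obtain ⟨k, -, rfl⟩ := Finset.mem_image.1 hx; exact hc k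
      · exact hF x hx)
    exact ⟨P, hP, fun k => h _ (Finset.mem_union_left _ (Finset.mem_image_of_mem _
      (Finset.mem_univ k))), fun x hx => h _ (Finset.mem_union_right _ hx)⟩
  obtain ⟨P₀, hP₀⟩ := hne
  have hsel : ∀ (c : Fin d → Node d G R) (x y : Node d G R), ∃ P ∈ C,
      (∀ k, c k ∈ D) → x ∈ D → y ∈ D → (∀ k, c k ∈ P.D) ∧ x ∈ P.D ∧ y ∈ P.D := by
    intro c x y
    by_cases h : (∀ k, c k ∈ D) ∧ x ∈ D ∧ y ∈ D
    · obtain ⟨P, hP, h1, h2⟩ := hfin' c {x, y} h.1 (by simp [h.2.1, h.2.2])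
      exact ⟨P, hP, fun _ _ _ => ⟨h1, h2 x (by simp), h2 y (by simp)⟩⟩
    · exact ⟨P₀, hP₀, fun h1 h2 h3 => absurd ⟨h1, h2, h3⟩ h⟩
  choose sel hselC hsel using hsel
  let col := fun c x y => (sel c x y).col c x y
  let val := fun c x y => (sel c x y).val c x y
  have hcol : ∀ P ∈ C, ∀ c x y, (∀ k, c k ∈ P.D) → x ∈ P.D → y ∈ P.D →
      P.col c x y = col c x y := by
    intro P hP c x y hc hx hy
    obtain ⟨h1, h2, h3⟩ := hsel c x y (fun k => hmem P hP _ (hc k)) (hmem P hP _ hx) (hmem P hP _ hy)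
    by_cases h : P = sel c x y
    · simp only [col, ← h]
    rcases hC hP (hselC c x y) h with h | h
    · exact h.col c x y hc hx hy
    · exact (h.col c x y h1 h2 h3).symm
  have hval : ∀ P ∈ C, ∀ c x y, (∀ k, c k ∈ P.D) → Function.Injective c → x ∈ P.D → y ∈ P.D →
      P.val c x y = val c x y := by
    intro P hP c x y hc hi hx hy
    obtain ⟨h1, h2, h3⟩ := hsel c x y (fun k => hmem P hP _ (hc k)) (hmem P hP _ hx) (hmem P hP _ hy)
    by_cases h : P = sel c x y
    · simp only [val, ← h]
    rcases hC hP (hselC c x y) h with h | h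
    · exact h.val c x y hc hi hx hy
    · exact (h.val c x y h1 hi h2 h3).symm
  refine ⟨⟨D, col, val, hmem P₀ hP₀ _ P₀.root_mem, ?_, ?_, ?_, ?_, ?_⟩,
    fun P hP => ⟨hmem P hP, hcol P hP, hval P hP⟩⟩
  · intro c x y hc hx hy h
    obtain ⟨P, hP, hc, hF⟩ := hfin' c {x, y} hc (by simp [hx, hy])
    rw [← hcol P hP c x y hc (hF x (by simp)) (hF y (by simp))]
    exact P.col_neutral c x y hc (hF x (by simp)) (hF y (by simp)) h
  · intro c x y hc hx hy
    obtain ⟨P, hP, hc, hF⟩ := hfin' c {x, y} hc (by simp [hx, hy])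
    rw [← hcol P hP c x y hc (hF x (by simp)) (hF y (by simp)),
      ← hcol P hP c y x hc (hF y (by simp)) (hF x (by simp))]
    exact P.col_conv c x y hc (hF x (by simp)) (hF y (by simp))
  · intro c x y z hc hx hy hz
    obtain ⟨P, hP, hc, hF⟩ := hfin' c {x, y, z} hc (by simp [hx, hy, hz])
    have hx := hF x (by simp)
    have hy := hF y (by simp)
    have hz := hF z (by simp)
    rw [← hcol P hP c x y hc hx hy, ← hcol P hP c x z hc hx hz, ← hcol P hP c y z hc hy hz]
    exact P.tri c x y z hc hx hy hz
  · rintro c hc hi b₀ ⟨hb₀, hb₀'⟩ b₁ ⟨hb₁, hb₁'⟩ hb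
    constructor
    · rintro x ⟨hx, hx'⟩ y ⟨hy, hy'⟩ hxy t u
      obtain ⟨P, hP, hc, hF⟩ := hfin' c {b₀, b₁, x, y} hc (by simp [hb₀, hb₁, hx, hy])
      have hx := hF x (by simp)
      have hy := hF y (by simp)
      have hb₀ := hF b₀ (by simp)
      have hb₁ := hF b₁ (by simp)
      have := (P.isVal c hc hi b₀ ⟨hb₀, hb₀'⟩ b₁ ⟨hb₁, hb₁'⟩ hb).1 x ⟨hx, hx'⟩ y ⟨hy, hy'⟩ hxy t u
      simp only [IsApex] at this ⊢
      rwa [hcol P hP c x y hc hx hy, hcol P hP c x b₀ hc hx hb₀, hcol P hP c y b₀ hc hy hb₀,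
        hcol P hP c x b₁ hc hx hb₁, hcol P hP c y b₁ hc hy hb₁,
        hval P hP c b₀ b₁ hc hi hb₀ hb₁] at this
    · obtain ⟨P, hP, hc, hF⟩ := hfin' c {b₀, b₁} hc (by simp [hb₀, hb₁])
      have hb₀ := hF b₀ (by simp)
      have hb₁ := hF b₁ (by simp)
      have := (P.isVal c hc hi b₀ ⟨hb₀, hb₀'⟩ b₁ ⟨hb₁, hb₁'⟩ hb).2
      rwa [hcol P hP c b₀ b₁ hc hb₀ hb₁, hval P hP c b₀ b₁ hc hi hb₀ hb₁] at this
  · intro s i q h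
    obtain ⟨P, hP, h⟩ := Set.mem_iUnion₂.1 h
    obtain ⟨h1, h2⟩ := P.sat s i q h
    refine ⟨fun k => hmem P hP _ (h1 k), Eq.trans ?_ h2⟩
    apply Pat.ext
    · rfl
    · funext g a b
      exact (hcol P hP _ _ _ (fun k => update_mem h1 h _) (update_mem h1 h _)
        (update_mem h1 h _)).symm

/-- The coloured structure on the points of a partial structure. -/
def net (P : PartialNet d G R) : Net d G R P.D where
  col c x y := P.col (Subtype.val ∘ c) x y
  col_neutral {c x y} h := P.col_neutral _ _ _ (fun k => (c k).2) x.2 y.2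
    (by rwa [proper_comp_iff Subtype.val_injective])
  col_conv c x y := P.col_conv _ _ _ (fun k => (c k).2) x.2 y.2
  tri {c x y z} h1 h2 h3 := P.tri _ _ _ _ (fun k => (c k).2) x.2 y.2 z.2
    ((proper_comp_iff Subtype.val_injective).2 h1) ((proper_comp_iff Subtype.val_injective).2 h2)
    ((proper_comp_iff Subtype.val_injective).2 h3)

theorem pat_net (P : PartialNet d G R) (s : Fin (d + 3) → P.D) : P.net.pat s =
    ⟨fun a b => (s a : Node d G R) = s b,
      fun h a b => P.col (fun k => (s (h k) : Node d G R)) (s a) (s b)⟩ := by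
  apply Pat.ext
  · funext a b; exact propext Subtype.ext_iff
  · rfl

theorem isVal_net (P : PartialNet d G R) (c : Fin d → P.D) (hc : Function.Injective c) :
    IsVal (P.net.col c) (Set.range c)ᶜ fun x y => P.val (Subtype.val ∘ c) x y := by
  refine (P.isVal (Subtype.val ∘ c) (fun k => (c k).2) (Subtype.val_injective.comp hc)).comap
    Subtype.val_injective.injOn ?_
  rintro y hy
  exact ⟨y.2, fun ⟨k, hk⟩ => hy ⟨k, Subtype.val_injective hk⟩⟩

/-- Adding a name that realizes an atom. -/
theorem exists_adjoin (P : PartialNet d G R) (ρ : G → R)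
    (hρ : ∀ s t, Rainbow.hom s t (ρ s) (ρ t)) (s : Fin (d + 3) → P.D) {i : Fin (d + 3)}
    {q : Pat d G R} (hq : q.IsAtom) (hag : q.Agree {i}ᶜ (P.net.pat s))
    (hfresh : ∀ j, j ≠ i → ¬ q.eq i j) :
    ∃ Q : PartialNet d G R, P.Le Q ∧ Node.mk (fun k => (s k : Node d G R)) i q ∈ Q.D := by
  classical
  set ν : Node d G R := Node.mk (fun k => (s k : Node d G R)) i q with hν
  by_cases hνD : ν ∈ P.D
  · exact ⟨P, ⟨subset_rfl, fun _ _ _ _ _ _ => rfl, fun _ _ _ _ _ _ _ => rfl⟩, hνD⟩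
  obtain ⟨N', v', h1, h2, h3, h4⟩ := P.net.exists_extend_val
    (fun c x y => P.val (Subtype.val ∘ c) x y) P.isVal_net ρ hρ s hq hag hfresh
  -- This map identifies the enlarged set of names with `Option P.D`; the extended structure is
  -- pulled back along it.
  let ψ : Node d G R → Option P.D := fun x => if h : x ∈ P.D then some ⟨x, h⟩ else none
  have hψ : ∀ x : P.D, ψ x = some x := fun x => dif_pos x.2
  have hψν : ψ ν = none := dif_neg hνD
  have hψi : Set.InjOn ψ (insert ν P.D) := by
    rintro x (rfl | hx) y (rfl | hy) h
    · rfl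
    · rw [hψν, hψ ⟨y, hy⟩] at h; cases h
    · rw [hψν, hψ ⟨x, hx⟩] at h; cases h
    · rw [hψ ⟨x, hx⟩, hψ ⟨y, hy⟩] at h
      exact congrArg Subtype.val (Option.some.inj h)
  have hcomp : ∀ c : Fin d → Node d G R, (∀ k, c k ∈ P.D) →
      ∃ c' : Fin d → P.D, c = Subtype.val ∘ c' ∧ ψ ∘ c = some ∘ c' := fun c hc =>
    ⟨fun k => ⟨c k, hc k⟩, rfl, funext fun k => hψ ⟨c k, hc k⟩⟩
  have hcol : ∀ c x y, (∀ k, c k ∈ P.D) → x ∈ P.D → y ∈ P.D →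
      P.col c x y = N'.col (ψ ∘ c) (ψ x) (ψ y) := by
    intro c x y hc hx hy
    obtain ⟨c', rfl, h⟩ := hcomp c hc
    rw [h, hψ ⟨x, hx⟩, hψ ⟨y, hy⟩, h2]
    rfl
  refine ⟨⟨insert ν P.D, fun c x y => N'.col (ψ ∘ c) (ψ x) (ψ y),
    fun c x y => v' (ψ ∘ c) (ψ x) (ψ y), Or.inr P.root_mem, ?_, ?_, ?_, ?_, ?_⟩,
    ⟨Set.subset_insert _ _, hcol, ?_⟩, Set.mem_insert _ _⟩
  · intro c x y hc hx hy h
    exact N'.col_neutral fun h' => h ((proper_comp_iff_of_injOn hψi hc hx hy).1 h')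
  · intro c x y hc hx hy
    exact N'.col_conv _ _ _
  · intro c x y z hc hx hy hz hxy hxz hyz
    exact N'.tri ((proper_comp_iff_of_injOn hψi hc hx hy).2 hxy)
      ((proper_comp_iff_of_injOn hψi hc hx hz).2 hxz)
      ((proper_comp_iff_of_injOn hψi hc hy hz).2 hyz)
  · intro c hc hi
    refine (h1 (ψ ∘ c) fun k l hkl => hi (hψi (hc k) (hc l) hkl)).comap
      (hψi.mono Set.sdiff_subset) ?_
    rintro y ⟨hy, hyc⟩ ⟨k, hk⟩
    exact hyc ⟨k, hψi (hc k) hy hk⟩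
  · rintro s' i' q' (h | h)
    · obtain ⟨rfl, rfl, rfl⟩ := Node.mk.inj h
      refine ⟨fun k => Or.inr (s k).2, ?_⟩
      refine Eq.trans ?_ h4
      have hu : ∀ a, ψ (Function.update (fun k => (s k : Node d G R)) i' ν a) =
          Function.update (some ∘ s) i' none a := by
        intro a
        by_cases ha : a = i'
        · subst ha; simp [hψν]
        · rw [Function.update_of_ne ha, Function.update_of_ne ha]; exact hψ _
      have hmem := fun a => update_mem (D := insert ν P.D) (i := i') (fun k => Or.inr (s k).2)
        (Set.mem_insert ν P.D) a
      apply Pat.ext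
      · funext a b
        change (_ = _) = (_ = _)
        rw [← hu a, ← hu b]
        exact propext (hψi.eq_iff (hmem a) (hmem b)).symm
      · funext h a b
        change N'.col _ _ _ = N'.col _ _ _
        rw [← hu a, ← hu b]
        congr 1
        funext k
        exact hu (h k)
    · obtain ⟨hs, hsat⟩ := P.sat s' i' q' h
      refine ⟨fun k => Or.inr (hs k), Eq.trans ?_ hsat⟩
      apply Pat.ext
      · rfl
      · funext g a b
        exact (hcol _ _ _ (fun k => update_mem hs h _) (update_mem hs h _)
          (update_mem hs h _)).symm
  · intro c x y hc hi hx hy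
    obtain ⟨c', rfl, h⟩ := hcomp c hc
    simp only
    rw [h, hψ ⟨x, hx⟩, hψ ⟨y, hy⟩, h3 _ _ _ (Function.Injective.of_comp hi)]

end PartialNet

/-- A coloured structure realizing all atoms that agree with the pattern of one of its sequences
outside one coordinate. -/
def Net.IsSaturated {X : Type v} (N : Net d G R X) : Prop :=
  ∀ (s : Fin (d + 3) → X) (i : Fin (d + 3)) (q : Pat d G R), q.IsAtom → q.Agree {i}ᶜ (N.pat s) →
    ∃ z, N.pat (Function.update s i z) = q

-- In a maximal partial structure a demand for a fresh point has its name already present, since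
-- adjoining the name adds nothing, and present names realize their atoms. A demand that is not
-- fresh is met by an old point.
variable (d) in
theorem exists_isSaturated (ρ : G → R) (hρ : ∀ s t, Rainbow.hom s t (ρ s) (ρ t)) :
    ∃ (X : Type u) (_ : Nonempty X) (N : Net d G R X), N.IsSaturated := by
  obtain ⟨P, hP⟩ := exists_maximal_of_chains_bounded (r := PartialNet.Le (d := d) (G := G) (R := R))
    (fun C hC => by
      rcases C.eq_empty_or_nonempty with rfl | hne
      · exact ⟨PartialNet.single ρ, fun _ h => h.elim⟩
      · exact PartialNet.exists_upper hC hne) (fun h h' => h.trans h')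
  refine ⟨P.D, ⟨⟨_, P.root_mem⟩⟩, P.net, fun s i q hq hag => ?_⟩
  by_cases hfresh : ∀ j, j ≠ i → ¬ q.eq i j
  · obtain ⟨Q, hPQ, hν⟩ := P.exists_adjoin ρ hρ s hq hag hfresh
    have hν := (hP Q hPQ).sub hν
    refine ⟨⟨_, hν⟩, ?_⟩
    rw [PartialNet.pat_net]
    refine Eq.trans ?_ (P.sat _ _ _ hν).2
    have hu : ∀ a, ((Function.update s i ⟨_, hν⟩ a : P.D) : Node d G R) =
        Function.update (fun k => (s k : Node d G R)) i (.mk (fun k => (s k : Node d G R)) i q) a := by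
      intro a
      by_cases ha : a = i
      · subst ha; simp
      · rw [Function.update_of_ne ha, Function.update_of_ne ha]
    simp only [hu]
    rfl
  · push Not at hfresh
    obtain ⟨j, hj, hqj⟩ := hfresh
    exact ⟨s j, P.net.pat_update_eq s hj hq hag hqj⟩

/-- In a saturated structure every atom is realized. -/
theorem Net.IsSaturated.exists_pat_eq {X : Type v} [Nonempty X] {N : Net d G R X}
    (hN : N.IsSaturated) {q : Pat d G R} (hq : q.IsAtom) : ∃ s, N.pat s = q := by
  obtain ⟨Y, -, L, r, rfl⟩ := hq.exists_net
  have key : ∀ F : Finset (Fin (d + 3)), ∃ s, N.pat s = L.pat fun i => if i ∈ F then r i else r 0 := by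
    intro F
    induction F using Finset.induction_on with
    | empty =>
      obtain ⟨x⟩ := ‹Nonempty X›
      refine ⟨fun _ => x, Pat.ext ?_ ?_⟩
      · funext a b; exact propext ⟨fun _ => rfl, fun _ => rfl⟩
      · funext h a b
        exact (N.col_self _ _).trans (L.col_self _ _).symm
    | insert i F hi ih =>
      obtain ⟨s, hs⟩ := ih
      obtain ⟨z, hz⟩ := hN s i (L.pat fun j => if j ∈ insert i F then r j else r 0)
        (L.isAtom_pat _) (by
          rw [hs]
          exact L.pat_agree fun a ha => by
            have : a ≠ i := ha
            simp [Finset.mem_insert, this])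
      exact ⟨_, hz⟩
  simpa using key Finset.univ

end Saturated

/-! ### Colours and patterns over an ultrapower of the index sets -/

section GermColor

variable {ι : Type} {U : Ultrafilter ι}

/-- A representative of a germ. -/
noncomputable def germRep {β : Type u} (s : (U : Filter ι).Germ β) : ι → β := Quotient.out s

theorem coe_germRep {β : Type u} (s : (U : Filter ι).Germ β) :
    ((germRep s : ι → β) : (U : Filter ι).Germ β) = s := Quotient.out_eq s

theorem eq_iff_germRep {β : Type u} {s t : (U : Filter ι).Germ β} :
    s = t ↔ ∀ᶠ j in U, germRep s j = germRep t j := by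
  conv_lhs => rw [← coe_germRep s, ← coe_germRep t]
  exact Filter.Germ.coe_eq

theorem germRep_coe {β : Type u} (f : ι → β) :
    ∀ᶠ j in U, germRep (f : (U : Filter ι).Germ β) j = f j :=
  Filter.Germ.coe_eq.1 (coe_germRep _)

variable {G R : Type u}

/-- The ultrapower of a pair of index sets. -/
noncomputable instance germRainbow [Rainbow G R] :
    Rainbow ((U : Filter ι).Germ G) ((U : Filter ι).Germ R) where
  hom s t k l := ∀ᶠ j in U, Rainbow.hom (germRep s j) (germRep t j) (germRep k j) (germRep l j)
  hom_symm h := h.mono fun _ => Rainbow.hom_symm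
  hom_self _ _ := .of_forall fun _ => Rainbow.hom_self _ _
  eq_of_hom h := eq_iff_germRep.2 (h.mono fun _ => Rainbow.eq_of_hom)

/-- The components of a colour with germs as indices. -/
noncomputable def Color.at : Color ((U : Filter ι).Germ G) ((U : Filter ι).Germ R) → ι → Color G R
  | white i S, j => white i (S.map fun p => (germRep p.1 j, germRep p.2 j))
  | tint s, j => tint (germRep s j)
  | green, _ => green
  | red k l, j => red (germRep k j) (germRep l j)

theorem Color.at_conv (a : Color ((U : Filter ι).Germ G) ((U : Filter ι).Germ R)) (j : ι) :
    a.conv.at j = (a.at j).conv := by cases a <;> rfl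

theorem Color.eq_iff_at {a b : Color ((U : Filter ι).Germ G) ((U : Filter ι).Germ R)} :
    a = b ↔ ∀ᶠ j in U, a.at j = b.at j := by
  rcases a with ⟨i, _ | ⟨s, t⟩⟩ | s | _ | ⟨k, l⟩ <;>
    rcases b with ⟨i', _ | ⟨s', t'⟩⟩ | s' | _ | ⟨k', l'⟩ <;>
    simp [Color.at, eq_iff_germRep, Filter.eventually_and, U.neBot.ne]

/-- There are finitely many shapes of colours, so the ultrafilter selects one, and the indices
combine to germs. The bounded length of the lists on white edges matters here. -/
theorem Color.exists_at (f : ι → Color G R) :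
    ∃ a : Color ((U : Filter ι).Germ G) ((U : Filter ι).Germ R), ∀ᶠ j in U, a.at j = f j := by
  have h : ∀ᶠ j in U, (∃ i, f j = white i none) ∨ (∃ p : G × G, f j = white false (some p)) ∨
      (∃ p : G × G, f j = white true (some p)) ∨ (∃ s, f j = tint s) ∨ f j = green ∨
      ∃ p : R × R, f j = red p.1 p.2 := by
    refine .of_forall fun j => ?_
    rcases f j with ⟨_ | _, _ | p⟩ | s | _ | ⟨k, l⟩ <;> simp
  have wit : ∀ {β : Type u} {P : ι → β → Prop}, (∀ᶠ j in (U : Filter ι), ∃ x, P j x) →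
      ∃ g : ι → β, ∀ᶠ j in (U : Filter ι), P j (g j) := by
    intro β P h
    obtain ⟨-, x, -⟩ := h.exists
    have : ∀ j, ∃ y, (∃ x, P j x) → P j y := fun j => by
      by_cases hj : ∃ x, P j x
      · exact ⟨hj.choose, fun _ => hj.choose_spec⟩
      · exact ⟨x, fun h => absurd h hj⟩
    choose g hg using this
    exact ⟨g, h.mono hg⟩
  have pair : ∀ i : Bool, (∀ᶠ j in U, ∃ p : G × G, f j = white i (some p)) →
      ∃ a : Color ((U : Filter ι).Germ G) ((U : Filter ι).Germ R), ∀ᶠ j in U, a.at j = f j := by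
    intro i h
    obtain ⟨g, hg⟩ := wit h
    refine ⟨white i (some (((fun j => (g j).1 : ι → G) : (U : Filter ι).Germ G),
      ((fun j => (g j).2 : ι → G) : (U : Filter ι).Germ G))), ?_⟩
    filter_upwards [hg, germRep_coe (U := U) fun j => (g j).1,
      germRep_coe (U := U) fun j => (g j).2] with j h1 h2 h3
    rw [h1]
    simp only [Color.at, Option.map_some, h2, h3]
  simp only [Ultrafilter.eventually_or] at h
  rcases h with h | h | h | h | h | h
  · have : (∀ᶠ j in U, f j = white false none) ∨ ∀ᶠ j in U, f j = white true none := by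
      rw [← Ultrafilter.eventually_or]
      refine h.mono ?_
      rintro j ⟨_ | _, h⟩
      · exact Or.inl h
      · exact Or.inr h
    rcases this with h | h
    · exact ⟨white false none, h.mono fun j h => h.symm⟩
    · exact ⟨white true none, h.mono fun j h => h.symm⟩
  · exact pair _ h
  · exact pair _ h
  · obtain ⟨g, hg⟩ := wit h
    refine ⟨tint (g : (U : Filter ι).Germ G), ?_⟩
    filter_upwards [hg, germRep_coe (U := U) g] with j h1 h2
    rw [h1]; simp only [Color.at, h2]
  · exact ⟨green, h.mono fun j h => h.symm⟩
  · obtain ⟨g, hg⟩ := wit h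
    refine ⟨red ((fun j => (g j).1 : ι → R) : (U : Filter ι).Germ R)
      ((fun j => (g j).2 : ι → R) : (U : Filter ι).Germ R), ?_⟩
    filter_upwards [hg, germRep_coe (U := U) fun j => (g j).1,
      germRep_coe (U := U) fun j => (g j).2] with j h1 h2 h3
    rw [h1]
    simp only [Color.at, h2, h3]

theorem Color.allowed_iff_at (S : Option ((U : Filter ι).Germ G × (U : Filter ι).Germ G))
    (s : (U : Filter ι).Germ G) : Allowed S s ↔ ∀ᶠ j in U,
      Allowed (S.map fun p => (germRep p.1 j, germRep p.2 j)) (germRep s j) := by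
  rcases S with _ | p <;> simp [Allowed, eq_iff_germRep, Ultrafilter.eventually_or]

theorem Color.coherent_iff_at (a b c : Color ((U : Filter ι).Germ G) ((U : Filter ι).Germ R)) :
    Coherent a b c ↔ ∀ᶠ j in U, Coherent (a.at j) (b.at j) (c.at j) := by
  cases a <;> cases b <;> cases c <;>
    simp [Color.at, Coherent, eq_iff_germRep, Filter.eventually_and]

theorem Color.vertexLaw_iff_at [Rainbow G R]
    (a c b : Color ((U : Filter ι).Germ G) ((U : Filter ι).Germ R)) :
    VertexLaw a c b ↔ ∀ᶠ j in U, VertexLaw (a.at j) (c.at j) (b.at j) := by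
  cases a <;> cases c <;> cases b <;>
    first
    | exact Iff.rfl
    | exact Color.allowed_iff_at _ _
    | simp [Color.at, VertexLaw, U.neBot.ne]

theorem Color.tri_iff_at [Rainbow G R]
    (a c b : Color ((U : Filter ι).Germ G) ((U : Filter ι).Germ R)) :
    Tri a c b ↔ ∀ᶠ j in U, Tri (a.at j) (c.at j) (b.at j) := by
  simp only [Tri, Filter.eventually_and, ← Color.vertexLaw_iff_at, ← Color.coherent_iff_at]

variable {d : ℕ}

/-- The components of a pattern with germs as indices. -/
noncomputable def Pat.at (p : Pat d ((U : Filter ι).Germ G) ((U : Filter ι).Germ R)) (j : ι) :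
    Pat d G R where
  eq := p.eq
  col h a b := (p.col h a b).at j

theorem Pat.agree_iff_at {p q : Pat d ((U : Filter ι).Germ G) ((U : Filter ι).Germ R)}
    {W : Set (Fin (d + 3))} : p.Agree W q ↔ ∀ᶠ j in U, (p.at j).Agree W (q.at j) := by
  constructor
  · intro h
    refine .of_forall fun j => ⟨h.1, fun g hg a ha b hb => ?_⟩
    change (p.col g a b).at j = (q.col g a b).at j
    rw [h.2 g hg a ha b hb]
  · intro h
    obtain ⟨j, hj⟩ := h.exists
    exact ⟨hj.1, fun g hg a ha b hb =>
      Color.eq_iff_at.2 (h.mono fun j hj => hj.2 g hg a ha b hb)⟩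

/-- This is Łoś's theorem for atoms: a pattern has finitely many entries, so the laws for all of
them hold simultaneously on a set of the ultrafilter. -/
theorem Pat.isAtom_iff_at [Rainbow G R]
    {p : Pat d ((U : Filter ι).Germ G) ((U : Filter ι).Germ R)} :
    p.IsAtom ↔ ∀ᶠ j in U, (p.at j).IsAtom := by
  constructor
  · intro hp
    have htri : ∀ᶠ j in U, ∀ h a b c, p.IsProper h a b → p.IsProper h a c → p.IsProper h b c →
        Tri ((p.col h a b).at j) ((p.col h a c).at j) ((p.col h b c).at j) := by
      simp only [Filter.eventually_all]
      intro h a b c h1 h2 h3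
      exact (Color.tri_iff_at _ _ _).1 (hp.tri h a b c h1 h2 h3)
    refine htri.mono fun j htri => ⟨hp.equiv, ?_, ?_, ?_, htri⟩
    · intro h h' a a' b b' hh ha hb
      exact congrArg (Color.at · j) (hp.congr h h' a a' b b' hh ha hb)
    · intro h a b hab
      exact congrArg (Color.at · j) (hp.col_neutral h a b hab)
    · intro h a b
      exact (congrArg (Color.at · j) (hp.col_conv h a b)).trans (Color.at_conv _ _)
  · intro hp
    obtain ⟨j, hj⟩ := hp.exists
    refine ⟨hj.equiv, ?_, ?_, ?_, ?_⟩
    · intro h h' a a' b b' hh ha hb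
      exact Color.eq_iff_at.2 (hp.mono fun _ hj => hj.congr h h' a a' b b' hh ha hb)
    · intro h a b hab
      exact Color.eq_iff_at.2 (hp.mono fun _ hj => hj.col_neutral h a b hab)
    · intro h a b
      exact Color.eq_iff_at.2 (hp.mono fun _ hj => (hj.col_conv h a b).trans
        (Color.at_conv _ _).symm)
    · intro h a b c h1 h2 h3
      exact (Color.tri_iff_at _ _ _).2 (hp.mono fun j hj => hj.tri h a b c h1 h2 h3)

theorem Pat.exists_at (f : ι → Pat d G R) :
    ∃ p : Pat d ((U : Filter ι).Germ G) ((U : Filter ι).Germ R), ∀ᶠ j in U, p.at j = f j := by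
  have h : ∀ g a b, ∃ e : Color ((U : Filter ι).Germ G) ((U : Filter ι).Germ R),
      ∀ᶠ j in U, e.at j = (f j).col g a b := fun g a b => Color.exists_at _
  choose e he using h
  refine ⟨⟨fun a b => ∀ᶠ j in U, (f j).eq a b, e⟩, ?_⟩
  have h1 : ∀ᶠ j in U, ∀ g a b, (e g a b).at j = (f j).col g a b := by
    simp only [Filter.eventually_all]; exact he
  have h2 : ∀ᶠ j in U, ∀ a b, ((∀ᶠ j in U, (f j).eq a b) ↔ (f j).eq a b) := by
    simp only [Filter.eventually_all]
    intro a b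
    by_cases hab : ∀ᶠ j in U, (f j).eq a b
    · exact hab.mono fun j hj => ⟨fun _ => hj, fun _ => hab⟩
    · exact (Ultrafilter.eventually_not.2 hab).mono fun j hj =>
        ⟨fun h => absurd h hab, fun h => absurd h hj⟩
  filter_upwards [h1, h2] with j h1 h2
  apply Pat.ext
  · funext a b; exact propext (h2 a b)
  · funext g a b; exact h1 g a b

end GermColor

/-! ### Set algebras with all sequences in the unit -/

section FullSetAlgebra

theorem seqCyl_comm_subset {κ : Type w} {M : Type v} (i j : κ) (x : Set (Set.univ : Set (κ → M))) :
    seqCyl _ i (seqCyl _ j x) ⊆ seqCyl _ j (seqCyl _ i x) := by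
  classical
  rintro s ⟨t, ⟨r, hr, hrt⟩, hts⟩
  refine ⟨⟨Function.update s.1 j (r.1 j), trivial⟩, ⟨r, hr, fun k hk => ?_⟩, eqOff_update j _ _⟩
  by_cases hkj : k = j
  · subst hkj; simp
  · exact ((hrt k hkj).trans (hts k hk)).trans (Function.update_of_ne hkj _ _).symm

variable {m : ℕ} {M : Type u} (B : BooleanSubalgebra (Set (Set.univ : Set (Fin m → M))))
  (hc : ∀ i, ∀ x ∈ B, seqCyl _ i x ∈ B) (hd : ∀ i j, seqDiag _ i j ∈ B)

/-- A field of sets of sequences closed under the unrelativized cylindric operations. -/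
@[reducible] def fullSetAlgebra : CylindricAlgebra (Fin m) B :=
  seqAlgebra Set.univ (fun _ _ _ _ => Set.mem_univ _) B hc hd fun i j x _ => seqCyl_comm_subset i j x

/-- Set algebras in which every sequence lies in an atom have complete flat representations. -/
theorem hasCompleteFlatRep_fullSetAlgebra [Nonempty M] (h0 : 0 < m)
    (hat : ∀ s : (Set.univ : Set (Fin m → M)), ∃ b ∈ B, s ∈ b ∧ ∀ x ∈ B, s ∈ x → b ⊆ x)
    (n : Ordinal.{u}) :
    letI := fullSetAlgebra B hc hd
    HasCompleteFlatRep m n B := by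
  classical
  let _ := fullSetAlgebra B hc hd
  let S : RelRep m B M :=
    { V := Set.univ
      f := fun b => {s | (⟨s, trivial⟩ : (Set.univ : Set (Fin m → M))) ∈ b.1}
      base_nonempty := inferInstance
      base_eq := fun x => ⟨fun _ => x, trivial, ⟨0, h0⟩, rfl⟩
      injective := fun b b' h => Subtype.ext (Set.ext fun s => Set.ext_iff.1 h s.1)
      map_bot := rfl
      map_top := rfl
      map_sup := fun _ _ => rfl
      map_inf := fun _ _ => rfl
      map_compl := fun b => by
        ext s
        exact ⟨fun h => ⟨trivial, h⟩, fun h => h.2⟩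
      map_cyl := fun i b => by
        ext s
        constructor
        · rintro ⟨t, ht, hts⟩; exact ⟨trivial, t.1, ht, hts⟩
        · rintro ⟨-, t, ht, hts⟩; exact ⟨⟨t, trivial⟩, ht, hts⟩
      map_diag := fun i j => by
        ext s
        exact ⟨fun h => ⟨trivial, h⟩, fun h => h.2⟩ }
  -- Every sequence is a clique sequence, so the clique guarded quantifiers are the ordinary ones
  -- and commute.
  have hcl : ∀ a : n.ToType → M, a ∈ S.cliqueSeqs n.ToType := fun a s _ => trivial
  refine ⟨M, S, ⟨?_, ?_⟩, ?_⟩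
  · rintro s - b i l hl ⟨t, ht, hts⟩
    refine ⟨Function.update s (l i) (t.1 i), hcl _, eqOff_update _ _ _, ?_⟩
    have : (fun k => Function.update s (l i) (t.1 i) (l k)) = t.1 := by
      funext k
      by_cases hk : k = i
      · subst hk; simp
      · rw [Function.update_of_ne (hl.ne hk)]; exact (hts k hk).symm
    rw [this]
    exact ht
  · intro φ a _ i j
    have key : ∀ i j, S.Sat (.ex i (.ex j φ)) a → S.Sat (.ex j (.ex i φ)) a := by
      rintro i j ⟨b, -, hba, c, -, hcb, hc⟩
      refine ⟨Function.update a j (c j), hcl _, eqOff_update j _ _, c, hcl _, fun k hk => ?_, hc⟩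
      by_cases hkj : k = j
      · subst hkj; simp
      · exact ((hcb k hkj).trans (hba k hk)).trans (Function.update_of_ne hkj _ _).symm
    exact ⟨key i j, key j i⟩
  · intro X a ha
    ext s
    constructor
    · intro hs
      exact ⟨trivial, fun x hx => ha.1 hx hs⟩
    · rintro ⟨-, hs⟩
      obtain ⟨b, hb, hsb, hmin⟩ := hat ⟨s, trivial⟩
      -- The least member containing `s` is a lower bound of `X`, hence below the infimum.
      have : (⟨b, hb⟩ : B) ≤ a := ha.2 fun x hx => hmin x.1 x.2 (hs x hx)
      exact this hsb

end FullSetAlgebra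

/-! ### The ultrapower of the complex algebra as a set algebra -/

section GermAlgebra

variable {ι : Type} {U : Ultrafilter ι} {d : ℕ} {G R : Type u} [Rainbow G R] {M : Type u}
  (N : Net d ((U : Filter ι).Germ G) ((U : Filter ι).Germ R) M)

/-- The set of sequences whose pattern belongs to the ultraproduct of the sets `a j`. -/
def internalSet (a : ι → Set (Atoms d G R)) : Set (Set.univ : Set (Fin (d + 3) → M)) :=
  {s | ∀ᶠ j in U, ∃ q ∈ a j, q.1 = (N.pat s.1).at j}

variable {N} in
theorem mem_internalSet {a : ι → Set (Atoms d G R)} {s : (Set.univ : Set (Fin (d + 3) → M))} :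
    s ∈ internalSet N a ↔ ∀ᶠ j in (U : Filter ι), ∃ q ∈ a j, q.1 = (N.pat s.1).at j := Iff.rfl

theorem Net.eventually_isAtom_at (s : Fin (d + 3) → M) : ∀ᶠ j in U, ((N.pat s).at j).IsAtom :=
  Pat.isAtom_iff_at.1 (N.isAtom_pat s)

theorem internalSet_congr {a b : ι → Set (Atoms d G R)} (h : ∀ᶠ j in U, a j = b j) :
    internalSet N a = internalSet N b := by
  have key : ∀ {a b : ι → Set (Atoms d G R)}, (∀ᶠ j in U, a j = b j) →
      internalSet N a ⊆ internalSet N b := fun h s hs => by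
    filter_upwards [h, mem_internalSet.1 hs] with j h1 h2
    rwa [← h1]
  exact (key h).antisymm (key (h.mono fun _ h => h.symm))

theorem internalSet_sup (a b : ι → Set (Atoms d G R)) :
    internalSet N (fun j => a j ⊔ b j) = internalSet N a ⊔ internalSet N b := by
  ext s
  change _ ↔ s ∈ internalSet N a ∨ s ∈ internalSet N b
  rw [mem_internalSet, mem_internalSet, mem_internalSet, ← Ultrafilter.eventually_or]
  refine Filter.eventually_congr (.of_forall fun j => ?_)
  constructor
  · rintro ⟨q, hq | hq, h⟩
    · exact Or.inl ⟨q, hq, h⟩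
    · exact Or.inr ⟨q, hq, h⟩
  · rintro (⟨q, hq, h⟩ | ⟨q, hq, h⟩)
    · exact ⟨q, Or.inl hq, h⟩
    · exact ⟨q, Or.inr hq, h⟩

theorem internalSet_compl (a : ι → Set (Atoms d G R)) :
    internalSet N (fun j => (a j)ᶜ) = (internalSet N a)ᶜ := by
  ext s
  change _ ↔ ¬ s ∈ internalSet N a
  rw [mem_internalSet, mem_internalSet, ← Ultrafilter.eventually_not]
  refine Filter.eventually_congr ((N.eventually_isAtom_at s.1).mono fun j hj => ?_)
  constructor
  · rintro ⟨q, hq, h⟩ ⟨q', hq', h'⟩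
    exact hq ((Subtype.ext (h.trans h'.symm) : q = q') ▸ hq')
  · intro h
    exact ⟨⟨_, hj⟩, fun h' => h ⟨_, h', rfl⟩, rfl⟩

theorem internalSet_inf (a b : ι → Set (Atoms d G R)) :
    internalSet N (fun j => a j ⊓ b j) = internalSet N a ⊓ internalSet N b := by
  have h := internalSet_sup N (fun j => (a j)ᶜ) fun j => (b j)ᶜ
  rw [internalSet_compl, internalSet_compl, ← compl_inf] at h
  rw [← compl_inj_iff, ← h, ← internalSet_compl]
  simp only [compl_inf]

theorem internalSet_bot : internalSet N (fun _ => ⊥) = ⊥ := by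
  ext s
  refine ⟨fun h => ?_, fun h => h.elim⟩
  obtain ⟨j, q, hq, -⟩ := (mem_internalSet.1 h).exists
  exact hq.elim

theorem internalSet_top : internalSet N (fun _ => ⊤) = ⊤ := by
  rw [← compl_inj_iff, compl_top, ← internalSet_bot N, ← internalSet_compl]
  simp only [compl_top]

theorem internalSet_diag (i j : Fin (d + 3)) :
    internalSet N (fun _ => diag i j) = seqDiag _ i j := by
  ext s
  change _ ↔ s.1 i = s.1 j
  rw [mem_internalSet]
  constructor
  · intro h
    obtain ⟨k, q, hq, hqs⟩ := h.exists
    have : ((N.pat s.1).at k).eq i j := hqs ▸ hq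
    exact this
  · intro h
    exact (N.eventually_isAtom_at s.1).mono fun k hk => ⟨⟨_, hk⟩, h, rfl⟩

/-- Saturation is needed from left to right: neighbours found in the components combine to an atom
over the germs that agrees with the pattern of `s` off `i`, and changing one point of `s` realizes
it. -/
theorem internalSet_cyl (hN : N.IsSaturated) (i : Fin (d + 3)) (a : ι → Set (Atoms d G R)) :
    internalSet N (fun j => cyl i (a j)) = seqCyl _ i (internalSet N a) := by
  classical
  ext s
  constructor
  · intro h
    have h : ∀ᶠ j in U, ∃ q : Atoms d G R, (∃ r ∈ a j, r.1.Agree {i}ᶜ q.1) ∧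
        q.1 = (N.pat s.1).at j := h
    have hr : ∀ j, ∃ r : Pat d G R,
        (∃ q : Atoms d G R, (∃ r ∈ a j, r.1.Agree {i}ᶜ q.1) ∧ q.1 = (N.pat s.1).at j) →
        ∃ r' ∈ a j, r'.1 = r ∧ r.Agree {i}ᶜ ((N.pat s.1).at j) := by
      intro j
      by_cases hj : ∃ q : Atoms d G R, (∃ r ∈ a j, r.1.Agree {i}ᶜ q.1) ∧ q.1 = (N.pat s.1).at j
      · obtain ⟨q, ⟨r, hr, hrq⟩, hq⟩ := hj
        exact ⟨r.1, fun _ => ⟨r, hr, rfl, hq ▸ hrq⟩⟩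
      · exact ⟨(N.pat s.1).at j, fun h => absurd h hj⟩
    choose r hr using hr
    obtain ⟨p, hp⟩ := Pat.exists_at (U := U) r
    have h1 : p.IsAtom := Pat.isAtom_iff_at.2 (by
      filter_upwards [h, hp] with j h1 h2
      obtain ⟨r', -, h3, -⟩ := hr j h1
      rw [h2, ← h3]; exact r'.2)
    have h2 : p.Agree {i}ᶜ (N.pat s.1) := Pat.agree_iff_at.2 (by
      filter_upwards [h, hp] with j h1 h2
      obtain ⟨r', -, -, h3⟩ := hr j h1
      rwa [h2])
    obtain ⟨z, hz⟩ := hN s.1 i p h1 h2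
    refine ⟨⟨Function.update s.1 i z, trivial⟩, ?_, eqOff_update _ _ _⟩
    rw [mem_internalSet]
    filter_upwards [h, hp] with j h1 h2
    obtain ⟨r', h3, h4, -⟩ := hr j h1
    exact ⟨r', h3, by rw [hz, h2, h4]⟩
  · rintro ⟨t, ht, hts⟩
    have h1 := Pat.agree_iff_at.1 (N.pat_agree_of_eqOff hts)
    rw [mem_internalSet]
    filter_upwards [mem_internalSet.1 ht, h1, N.eventually_isAtom_at s.1] with j h2 h3 h4
    obtain ⟨q, hq, hqt⟩ := h2
    exact ⟨⟨_, h4⟩, ⟨q, hq, by rw [hqt]; exact h3⟩, rfl⟩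

/-- If `a j ⊆ b j` fails almost everywhere, the witnesses combine to an atom over the germs. A
sequence realizing it lies in one internal set but not in the other. -/
theorem internalSet_injective (hN : N.IsSaturated) [Nonempty M] {a b : ι → Set (Atoms d G R)}
    (h : internalSet N a = internalSet N b) : ∀ᶠ j in U, a j = b j := by
  have key : ∀ {a b : ι → Set (Atoms d G R)}, internalSet N a = internalSet N b →
      ∀ᶠ j in U, a j ⊆ b j := by
    intro a b h
    by_contra hcon
    rw [← Ultrafilter.eventually_not] at hcon
    obtain ⟨j₀, hj₀⟩ := hcon.exists
    obtain ⟨q₀, -, -⟩ := Set.not_subset.1 hj₀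
    have hq : ∀ j, ∃ q, ¬ a j ⊆ b j → q ∈ a j ∧ q ∉ b j := by
      intro j
      by_cases hj : a j ⊆ b j
      · exact ⟨q₀, fun h => absurd hj h⟩
      · obtain ⟨q, hq⟩ := Set.not_subset.1 hj
        exact ⟨q, fun _ => hq⟩
    choose q hq using hq
    obtain ⟨p, hp⟩ := Pat.exists_at (U := U) fun j => (q j).1
    obtain ⟨s, hs⟩ := hN.exists_pat_eq (Pat.isAtom_iff_at.2 (hp.mono fun j hj => hj ▸ (q j).2))
    have h1 : (⟨s, trivial⟩ : (Set.univ : Set (Fin (d + 3) → M))) ∈ internalSet N a := by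
      rw [mem_internalSet]
      filter_upwards [hcon, hp] with j h1 h2
      exact ⟨q j, (hq j h1).1, by rw [hs, h2]⟩
    rw [h] at h1
    obtain ⟨j, ⟨q', hq', h3⟩, h4, h5⟩ := ((mem_internalSet.1 h1).and (hcon.and hp)).exists
    have : q' = q j := Subtype.ext (by rw [h3, hs, h5])
    exact (hq j h4).2 (this ▸ hq')
  filter_upwards [key h, key h.symm] with j h1 h2
  exact h1.antisymm h2

/-- The field of sets of the form `internalSet N a`. -/
def internalSets : BooleanSubalgebra (Set (Set.univ : Set (Fin (d + 3) → M))) where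
  carrier := Set.range (internalSet N)
  supClosed' := by
    rintro _ ⟨a, rfl⟩ _ ⟨b, rfl⟩
    exact ⟨_, internalSet_sup N a b⟩
  infClosed' := by
    rintro _ ⟨a, rfl⟩ _ ⟨b, rfl⟩
    exact ⟨_, internalSet_inf N a b⟩
  compl_mem' := by
    rintro _ ⟨a, rfl⟩
    exact ⟨_, internalSet_compl N a⟩
  bot_mem' := ⟨_, internalSet_bot N⟩

/-- The cylindric set algebra of the sets of the form `internalSet N a`. -/
@[reducible] def Net.IsSaturated.algebra (hN : N.IsSaturated) :
    CylindricAlgebra (Fin (d + 3)) (internalSets N) :=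
  fullSetAlgebra _ (by rintro i _ ⟨a, rfl⟩; exact ⟨_, internalSet_cyl N hN i a⟩)
    fun i j => ⟨_, internalSet_diag N i j⟩

theorem Net.IsSaturated.hasCompleteFlatRep [Nonempty M] (hN : N.IsSaturated) (n : Ordinal.{u}) :
    letI := Net.IsSaturated.algebra N hN
    HasCompleteFlatRep (d + 3) n (internalSets N) := by
  refine hasCompleteFlatRep_fullSetAlgebra _ _ _ (by omega) (fun s => ?_) n
  -- The least member containing `s` is the internal set of the components of its pattern, which are
  -- single atoms almost everywhere.
  refine ⟨_, ⟨fun j => {q | q.1 = (N.pat s.1).at j}, rfl⟩,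
    (N.eventually_isAtom_at s.1).mono fun j hj => ⟨⟨_, hj⟩, rfl, rfl⟩, ?_⟩
  rintro _ ⟨a, rfl⟩ hs t ht
  rw [mem_internalSet]
  filter_upwards [mem_internalSet.1 hs, mem_internalSet.1 ht] with j h1 h2
  obtain ⟨q, hq, h3⟩ := h1
  obtain ⟨q', hq', h4⟩ := h2
  exact ⟨q, hq, h3.trans (Eq.trans (Eq.symm hq') h4)⟩

/-- The set algebra over a saturated structure is the ultrapower of the complex algebra. -/
theorem Net.IsSaturated.exists_equiv [Nonempty M] (hN : N.IsSaturated) :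
    letI := Net.IsSaturated.algebra N hN
    Nonempty ((caLang (d + 3)).Equiv ((U : Filter ι).Product fun _ => Set (Atoms d G R))
      (internalSets N)) := by
  let _ := Net.IsSaturated.algebra N hN
  let F : ((U : Filter ι).Product fun _ => Set (Atoms d G R)) → internalSets N :=
    Quotient.lift (fun a => ⟨internalSet N a, a, rfl⟩)
      fun a b h => Subtype.ext (internalSet_congr N h)
  have hF : Function.Bijective F := by
    constructor
    · intro x y
      induction x using Quotient.inductionOn with | _ a
      induction y using Quotient.inductionOn with | _ b
      exact fun h => Quotient.sound (internalSet_injective N hN (congrArg Subtype.val h))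
    · rintro ⟨_, a, rfl⟩
      exact ⟨Quotient.mk _ a, rfl⟩
  refine ⟨⟨Equiv.ofBijective F hF, ?_, fun r => r.elim⟩⟩
  intro k f x
  obtain ⟨a, rfl⟩ : ∃ a : Fin k → ι → Set (Atoms d G R), x = fun i =>
      (Quotient.mk _ (a i) : (U : Filter ι).Product fun _ => Set (Atoms d G R)) :=
    ⟨fun i => (x i).out, funext fun i => (Quotient.out_eq (x i)).symm⟩
  change F _ = _
  erw [FirstOrder.Language.Ultraproduct.funMap_cast]
  apply Subtype.ext
  cases f with
  | bot => exact internalSet_bot N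
  | top => exact internalSet_top N
  | diag i j => exact internalSet_diag N i j
  | compl => exact internalSet_compl N _
  | cyl i => exact internalSet_cyl N hN i _
  | sup => exact internalSet_sup N _ _
  | inf => exact internalSet_inf N _ _

end GermAlgebra

/-! ### Integer tints and the homomorphism on the ultrapower -/

section IntegerRainbow

/-- Tints are integers and the indices of red edges are natural numbers that decrease along
consecutive tints. -/
instance integerRainbow : Rainbow (ULift.{u} ℤ) (ULift.{u} ℕ) where
  hom s t k l := (t.down = s.down + 1 → l.down < k.down) ∧
    (s.down = t.down + 1 → k.down < l.down) ∧ (s = t → k = l)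
  hom_symm h := ⟨h.2.1, h.1, fun e => (h.2.2 e.symm).symm⟩
  hom_self s k := ⟨fun h => by omega, fun h => by omega, fun _ => rfl⟩
  eq_of_hom h := h.2.2 rfl

variable (U : Ultrafilter ℕ)

/-- Sequences of integers at a constant distance almost everywhere. -/
def galaxySetoid : Setoid (ℕ → ℤ) where
  r f g := ∃ k : ℤ, ∀ᶠ j in U, f j = g j + k
  iseqv :=
    ⟨fun f => ⟨0, .of_forall fun j => by simp⟩,
      fun ⟨k, h⟩ => ⟨-k, h.mono fun j hj => by omega⟩,
      fun ⟨k, h⟩ ⟨l, h'⟩ => ⟨k + l, by filter_upwards [h, h'] with j h1 h2; omega⟩⟩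

/-- The height of a sequence is its distance from a chosen representative of its galaxy. -/
theorem exists_galaxy_height : ∃ z : (ℕ → ℤ) → ℤ, ∀ (f g : ℕ → ℤ) (k : ℤ),
    (∀ᶠ j in U, f j = g j + k) → z f = z g + k := by
  have h : ∀ f : ℕ → ℤ, ∃ k : ℤ, ∀ᶠ j in U, f j = (Quotient.mk (galaxySetoid U) f).out j + k :=
    fun f => (galaxySetoid U).symm (Quotient.exact (Quotient.out_eq _))
  choose z hz using h
  refine ⟨z, fun f g k hk => ?_⟩
  have e : Quotient.mk (galaxySetoid U) f = Quotient.mk (galaxySetoid U) g := Quotient.sound ⟨k, hk⟩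
  have hf := hz f
  rw [e] at hf
  obtain ⟨j, h1, h2, h3⟩ := (hf.and ((hz g).and hk)).exists
  omega

/-- A tint gets in component `j` the index `j - z`, truncated at `0`, where `z` is its height. If
one tint is the successor of another, their heights differ by one, so the index drops by one as soon
as `j` exceeds the larger height, hence almost everywhere. No map from the integers to the natural
numbers has this property; this separates the algebra from its ultrapower. -/
theorem exists_hom_ultrapower (hU : (U : Filter ℕ) ≤ Filter.atTop) :
    ∃ ρ : (U : Filter ℕ).Germ (ULift.{u} ℤ) → (U : Filter ℕ).Germ (ULift.{u} ℕ),
      ∀ s t, Rainbow.hom s t (ρ s) (ρ t) := by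
  obtain ⟨z, hz⟩ := exists_galaxy_height U
  let f : (U : Filter ℕ).Germ (ULift.{u} ℤ) → ℕ → ℤ := fun s j => (germRep s j).down
  let r : (U : Filter ℕ).Germ (ULift.{u} ℤ) → ℕ → ULift.{u} ℕ := fun s j =>
    ⟨((j : ℤ) - z (f s)).toNat⟩
  have key : ∀ s t : (U : Filter ℕ).Germ (ULift.{u} ℤ), ∀ᶠ j in U, f t j = f s j + 1 →
      (r t j).down < (r s j).down := by
    intro s t
    by_cases h : ∀ᶠ j in U, f t j = f s j + 1
    · have h1 := hz _ _ _ h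
      filter_upwards [hU (Filter.eventually_gt_atTop (z (f t)).toNat)] with j hj _
      simp only [r]
      omega
    · exact (Ultrafilter.eventually_not.2 h).mono fun j hj h => absurd h hj
  have key' : ∀ s t : (U : Filter ℕ).Germ (ULift.{u} ℤ), ∀ᶠ j in U, germRep s j = germRep t j →
      r s j = r t j := by
    intro s t
    by_cases h : ∀ᶠ j in U, germRep s j = germRep t j
    · exact .of_forall fun j _ => by rw [eq_iff_germRep.2 h]
    · exact (Ultrafilter.eventually_not.2 h).mono fun j hj h => absurd h hj
  refine ⟨fun s => (r s : (U : Filter ℕ).Germ (ULift.{u} ℕ)), fun s t => ?_⟩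
  change ∀ᶠ j in (U : Filter ℕ), Rainbow.hom _ _ _ _
  filter_upwards [germRep_coe (U := U) (r s), germRep_coe (U := U) (r t), key s t, key t s,
    key' s t] with j h1 h2 h3 h4 h5
  rw [h1, h2]
  exact ⟨h3, h4, h5⟩

end IntegerRainbow

/-! ### Conclusion -/

/-- The class of algebras with complete flat representations is not elementary. -/
theorem not_isElementaryClass_hasCompleteFlatRep (d : ℕ) (n : Ordinal.{u})
    (hn : ((d + 5 : ℕ) : Ordinal.{u}) ≤ n) :
    ¬ IsElementaryClass.{u} (d + 3)
      (fun (A : Type u) [BooleanAlgebra A] [CylindricAlgebra (Fin (d + 3)) A] =>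
        HasCompleteFlatRep (d + 3) n A) := by
  rintro ⟨T, hT⟩
  let U : Ultrafilter ℕ := Filter.hyperfilter ℕ
  obtain ⟨ρ, hρ⟩ := exists_hom_ultrapower.{u} U
    ((Filter.hyperfilter_le_cofinite (α := ℕ)).trans Nat.cofinite_eq_atTop.le)
  obtain ⟨M, _, N, hN⟩ := exists_isSaturated d ρ hρ
  let _ := Net.IsSaturated.algebra N hN
  have hB : FirstOrder.Language.Theory.Model (internalSets N) T :=
    (hT _).1 (Net.IsSaturated.hasCompleteFlatRep N hN n)
  obtain ⟨e⟩ := Net.IsSaturated.exists_equiv N hN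
  have hP : FirstOrder.Language.Theory.Model ((U : Filter ℕ).Product fun _ =>
      Set (Atoms d (ULift.{u} ℤ) (ULift.{u} ℕ))) T :=
    FirstOrder.Language.StrongHomClass.theory_model e.symm
  have hA : FirstOrder.Language.Theory.Model (Set (Atoms d (ULift.{u} ℤ) (ULift.{u} ℕ))) T := by
    refine ⟨fun φ hφ => ?_⟩
    -- A sentence true in the ultrapower holds in almost all factors, which are all the same
    -- algebra.
    obtain ⟨_, h⟩ := ((FirstOrder.Language.Ultraproduct.sentence_realize φ).1
      (hP.realize_of_mem φ hφ)).exists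
    exact h
  obtain ⟨X, S, hS, hC⟩ := (hT _).2 hA
  refine S.not_isComplete_of_isSquare hS.1 (dimIncl (d + 5) n hn) (fun k => ⟨k⟩) ULift.down
    (fun k h => ?_) (fun k h => ?_) (fun k a b h => h.1 ?_) hC
  · have := congrArg ULift.down h
    simp at this
  · have := congrArg ULift.down h
    simp at this
  · simp

theorem mainTheorem11 (m : ℕ) (hm : 2 < m) (n : Ordinal.{u}) (hmn : (m : Ordinal.{u}) < n) :
    (∀ (A : Type u) [BooleanAlgebra A] [CylindricAlgebra (Fin m) A],
      HasFlatRep m n A → MemSNr m n hmn.le A) ∧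
    (∀ (A : Type u) [BooleanAlgebra A] [CylindricAlgebra (Fin m) A],
      HasCompleteFlatRep m n A → MemScNr m n hmn.le A) ∧
    ((m : Ordinal.{u}) + 3 ≤ n →
      ¬ IsElementaryClass.{u} m
        (fun (A : Type u) [BooleanAlgebra A] [CylindricAlgebra (Fin m) A] =>
          HasCompleteFlatRep m n A)) := by
  refine ⟨fun A _ _ h => h.memSNr hm.le hmn.le, fun A _ _ h => h.memScNr hm.le hmn.le, fun h => ?_⟩
  obtain ⟨d, rfl⟩ : ∃ d, m = d + 3 := ⟨m - 3, by omega⟩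
  refine not_isElementaryClass_hasCompleteFlatRep d n (le_trans ?_ h)
  have : ((d + 3 : ℕ) : Ordinal.{u}) + 3 = ((d + 3 + 3 : ℕ) : Ordinal.{u}) := by push_cast; rfl
  rw [this]
  exact Nat.cast_le.2 (by omega)
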